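/- Consider four-dimensional semi-Riemannian metrics (of any signature) $$\mathbf g=\tilde g_{ij}\,dt^i\,dt^j+h_{kl}\,(dz^k+f^k_i\,dt^i)(dz^l+f^l_j\,dt^j),\qquad i,j,k,l\in\{1,2\},$$ whose coefficients depend on $(t^1,t^2)$ only, with $\tilde{\mathbf g}=(\tilde g_{ij})$ and $\mathbf h=(h_{kl})$ symmetric and nondegenerate; so $\partial_{z^1},\partial_{z^2}$ are commuting Killing fields with non-null orbits. Let $J^2$ be the space of second-order jets of such metrics, let $D_i$ denote total derivatives with respect to $t^i$, and write $u_{,i}=D_iu$. The pseudogroup of transformations $\bar t^{\,i}=\phi^i(t)$, $\bar z^{\,i}=\alpha^i_jz^j+\psi^i(t)$, with $\phi,\psi$ smooth, $J_\phi=\det(\partial\phi^i/\partial t^j)\ne0$ and $(\alpha^i_j)\in GL(2,\mathbb R)$ constant, acts on $J^2$. A scalar differential (semi-)invariant of order $\le2$ is a function on (a subset of) $J^2$ which under this action is multiplied by $(\operatorname{sgn}J_\phi)^m(\operatorname{sgn}\det\alpha)^n$ for some fixed $m,n$; it is an invariant if $m=n=0$. For a symmetric form $\mu_{ij}$ put $C_\mu=\mu_{ij}\tilde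 g^{ij}$ and $Q_\mu=\det(\mu_{ij})/\det\tilde{\mathbf g}$. Put $$\sigma_i=\frac{(\det\mathbf h)_{,i}}{\det\mathbf h},\quad \rho_{ij}=\sigma_i\sigma_j,\quad \chi_{ij}=\frac{h_{11,i}h_{22,j}+h_{11,j}h_{22,i}-2h_{12,i}h_{12,j}}{2\det\mathbf h},\quad \gamma=\chi-\tfrac14\rho,$$ $$\mathcal C^k=\frac{f^k_{1,2}-f^k_{2,1}}{\sqrt{|\det\tilde{\mathbf g}|}},\quad \ell_{\mathcal C}=h_{kl}\mathcal C^k\mathcal C^l,\quad \Theta_{\mathrm I}=\frac{1}{|\det\mathbf h|^{1/2}|\det\tilde{\mathbf g}|^{1/2}}\begin{vmatrix}h_{11,1}&h_{12,1}&h_{22,1}\\h_{11,2}&h_{12,2}&h_{22,2}\\(\mathcal C^2)^2&-\mathcal C^1\mathcal C^2&(\mathcal C^1)^2\end{vmatrix},$$ $$X=\tilde g^{is}\sigma_sD_i,\qquad X^\perp=\frac{\sigma_2D_1-\sigma_1D_2}{\sqrt{|\det\tilde{\mathbf g}|}}.$$ Fix $\Lambda\in\mathbb R$ and let $\mathcal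 E\subset J^2$ be the set of jets satisfying the $\Lambda$-vacuum Einstein equations $R_{\mu\nu}-\Lambda\,\mathbf g_{\mu\nu}=0$. Then the ten functions $$C_\rho,\ C_\chi,\ Q_\chi,\ Q_\gamma,\ \ell_{\mathcal C},\ \Theta_{\mathrm I},\ XC_\chi,\ XQ_\gamma,\ X^\perp C_\chi,\ X^\perp Q_\gamma$$ form a maximal functionally independent set of scalar differential (semi-)invariants of order $\le2$ at generic points of $\mathcal E$. Precisely: $\Theta_{\mathrm I}$, $X^\perp C_\chi$ and $X^\perp Q_\gamma$ are semi-invariants and the other seven are invariants; and there is a dense, relatively open subset of $\mathcal E$ at each point $\theta$ of which (i) the differentials at $\theta$ of the restrictions of the ten functions to $\mathcal E$ are linearly independent; (ii) if $F$ is a differentiable function on an open neighbourhood $W$ of $\theta$ in $J^2$ whose restriction to $\mathcal E\cap W$ is a (semi-)invariant, then the differential at $\theta$ of $F|_{\mathcal E}$ is a linear combination of those ten differentials. -/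

import Mathlib

open scoped ContDiff Topology Matrix

namespace KillingJet

noncomputable section

/-! ## The bundle of metrics and its second-order jets

Adapted coordinates are `(t¹, t², z¹, z²)`, the Killing fields being `∂/∂z¹, ∂/∂z²`.  A metric with
non-null Killing leaves is written as
`g = g̃_ij dtⁱ dtʲ + h_kl (dzᵏ + f_iᵏ dtⁱ)(dzˡ + f_jˡ dtʲ)`,
where `g̃`, `f`, `h` depend on `t` only. -/

/-- The plane of `(t¹, t²)`, or of `(z¹, z²)`. -/
abbrev Plane : Type := Fin 2 → ℝ

/-- Points `(t, z)` of the four-dimensional manifold. -/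
abbrev Base : Type := Plane × Plane

/-- Fibre coordinates `(g̃, f, h)`.  Symmetric `2 × 2` matrices are stored as the triple of the
entries `11, 12, 22`; `f i k` stands for `f_iᵏ`. -/
abbrev Fib : Type := (Fin 3 → ℝ) × (Fin 2 → Fin 2 → ℝ) × (Fin 3 → ℝ)

/-- Second-order jets: the base point, the fibre coordinates, their derivatives in `t¹, t²`, and
their second derivatives `∂₁∂₁, ∂₁∂₂, ∂₂∂₂`. -/
abbrev Jet2 : Type := Base × Fib × (Fin 2 → Fib) × (Fin 3 → Fib)

/-- The position of the symmetric pair `(i, j)` in the list `11, 12, 22`. -/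
def symIdx (i j : Fin 2) : Fin 3 := ⟨i.1 + j.1, by omega⟩

/-- The matrix `(g̃_ij)` of the orbit metric. -/
def orbitMat (u : Fib) : Matrix (Fin 2) (Fin 2) ℝ := Matrix.of fun i j => u.1 (symIdx i j)

/-- The matrix `(f_iᵏ)`, with row index `i` and column index `k`. -/
def shiftMat (u : Fib) : Matrix (Fin 2) (Fin 2) ℝ := Matrix.of fun i k => u.2.1 i k

/-- The matrix `(h_kl)` of the metric along the Killing leaves. -/
def killMat (u : Fib) : Matrix (Fin 2) (Fin 2) ℝ := Matrix.of fun k l => u.2.2 (symIdx k l)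

/-- Indices of the four coordinates: `inl i` is `tⁱ` and `inr k` is `zᵏ`. -/
abbrev Idx : Type := Fin 2 ⊕ Fin 2

/-- The `4 × 4` matrix of the metric `g` in the coordinates `(t, z)`. -/
def metricMat (u : Fib) : Matrix Idx Idx ℝ :=
  Matrix.fromBlocks
    (orbitMat u + shiftMat u * killMat u * (shiftMat u)ᵀ) (shiftMat u * killMat u)
    (killMat u * (shiftMat u)ᵀ) (killMat u)

/-- The jets of metrics: both `g̃` and `h` are nondegenerate.  (Since `det g = det g̃ · det h`, this
says that `g` is nondegenerate with non-null Killing leaves.) -/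
def metricJets : Set Jet2 := {θ | (orbitMat θ.2.1).det ≠ 0 ∧ (killMat θ.2.1).det ≠ 0}

/-- Partial derivative with respect to the `i`-th coordinate of the plane. -/
def pd {E : Type*} [NormedAddCommGroup E] [NormedSpace ℝ E] (i : Fin 2) (σ : Plane → E)
    (t : Plane) : E :=
  fderiv ℝ σ t (Pi.single i 1)

/-- The second jet at `x = (t, z)` of a section, whose coefficients depend on `t` only. -/
def jetAt (σ : Plane → Fib) (x : Base) : Jet2 :=
  (x, σ x.1, fun i => pd i σ x.1, ![pd 0 (pd 0 σ) x.1, pd 0 (pd 1 σ) x.1, pd 1 (pd 1 σ) x.1])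

/-! ## Total derivatives and the Einstein equations -/

/-- The value at `θ` of the total derivative `D_a` as a tangent vector, with no components along the
second-order coordinates. -/
def totalVec : Idx → Jet2 → Jet2
  | Sum.inl i, θ => ((Pi.single i 1, 0), θ.2.2.1 i, fun j => θ.2.2.2 (symIdx i j), 0)
  | Sum.inr k, _ => ((0, Pi.single k 1), 0, 0, 0)

/-- The total derivative `D_a F` of a function `F` of order at most one (it is only applied to such
functions, for which the second-order components of `D_a` play no role). -/
def totalD (a : Idx) (F : Jet2 → ℝ) (θ : Jet2) : ℝ := fderiv ℝ F θ (totalVec a θ)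

/-- The components `g_ab`. -/
def metric (a b : Idx) (θ : Jet2) : ℝ := metricMat θ.2.1 a b

/-- The Christoffel symbols `Γᶜ_ab`. -/
def christoffel (c a b : Idx) (θ : Jet2) : ℝ :=
  (1 / 2) * ∑ d, (metricMat θ.2.1)⁻¹ c d *
    (totalD a (metric d b) θ + totalD b (metric a d) θ - totalD d (metric a b) θ)

/-- The Ricci tensor `R_ab = ∂_c Γᶜ_ab - ∂_b Γᶜ_ac + Γᶜ_cd Γᵈ_ab - Γᶜ_bd Γᵈ_ac`. -/
def ricci (a b : Idx) (θ : Jet2) : ℝ :=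
  (∑ c, (totalD c (christoffel c a b) θ - totalD b (christoffel c a c) θ)) +
    ∑ c, ∑ d, (christoffel c c d θ * christoffel d a b θ -
      christoffel c b d θ * christoffel d a c θ)

/-- The subset of the second jet space cut out by the `Λ`-vacuum equations
`R_ab - Λ g_ab = 0`. -/
def einsteinJets (Λ : ℝ) : Set Jet2 :=
  {θ | θ ∈ metricJets ∧ ∀ a b, ricci a b θ - Λ * metric a b θ = 0}

/-! ## The pseudogroup and its (semi-)invariants -/

/-- A transformation `t̄ = φ(t)`, `z̄ = α z + ψ(t)`. -/
structure AdaptedChange where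
  phi : Plane → Plane
  psi : Plane → Plane
  alpha : Matrix (Fin 2) (Fin 2) ℝ

/-- The image of a point of the manifold. -/
def AdaptedChange.app (P : AdaptedChange) (x : Base) : Base :=
  (P.phi x.1, P.alpha *ᵥ x.2 + P.psi x.1)

/-- The Jacobian matrix of `φ`. -/
def AdaptedChange.phiJac (P : AdaptedChange) (t : Plane) : Matrix (Fin 2) (Fin 2) ℝ :=
  Matrix.of fun i j => pd j P.phi t i

/-- The `4 × 4` Jacobian matrix of the transformation; rows belong to the new coordinates. -/
def AdaptedChange.jac (P : AdaptedChange) (t : Plane) : Matrix Idx Idx ℝ :=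
  Matrix.fromBlocks (P.phiJac t) 0 (Matrix.of fun k j => pd j P.psi t k) P.alpha

/-- The transformation is smooth near `t` and locally invertible there. -/
def AdaptedChange.RegularAt (P : AdaptedChange) (t : Plane) : Prop :=
  ContDiffAt ℝ ∞ P.phi t ∧ ContDiffAt ℝ ∞ P.psi t ∧ (P.phiJac t).det ≠ 0 ∧ P.alpha.det ≠ 0

/-- Near `t`, the metric of `σ` is the pullback under `P` of the metric of `σ'`. -/
def AdaptedChange.Carries (P : AdaptedChange) (σ σ' : Plane → Fib) (t : Plane) : Prop :=
  ∀ᶠ s in 𝓝 t, metricMat (σ s) = (P.jac s)ᵀ * metricMat (σ' (P.phi s)) * P.jac s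

/-- On `D`, the function `F` is multiplied by `(sgn J_φ)ᵐ (sgn det α)ⁿ` under the prolonged action of
every pseudogroup transformation. -/
def TransformsWith (m n : ℕ) (F : Jet2 → ℝ) (D : Set Jet2) : Prop :=
  ∀ (P : AdaptedChange) (σ σ' : Plane → Fib) (x : Base),
    P.RegularAt x.1 → ContDiffAt ℝ ∞ σ x.1 → ContDiffAt ℝ ∞ σ' (P.phi x.1) →
    P.Carries σ σ' x.1 → jetAt σ x ∈ D → jetAt σ' (P.app x) ∈ D →
    F (jetAt σ' (P.app x)) =
      Real.sign (P.phiJac x.1).det ^ m * Real.sign P.alpha.det ^ n * F (jetAt σ x)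

/-- Scalar differential invariants of order at most two. -/
def IsInvariantOn (F : Jet2 → ℝ) (D : Set Jet2) : Prop := TransformsWith 0 0 F D

/-- Scalar differential (semi-)invariants of order at most two. -/
def IsSemiInvariantOn (F : Jet2 → ℝ) (D : Set Jet2) : Prop := ∃ m n : ℕ, TransformsWith m n F D

/-! ## The ten (semi-)invariants -/

/-- `det h`. -/
def detH (θ : Jet2) : ℝ := (killMat θ.2.1).det

/-- `det g̃`. -/
def detG (θ : Jet2) : ℝ := (orbitMat θ.2.1).det

/-- The derivative `h_kl,i`. -/
def dh (k l i : Fin 2) (θ : Jet2) : ℝ := totalD (Sum.inl i) (fun η => killMat η.2.1 k l) θ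

/-- The components of `σ = d(det h) / det h`. -/
def sig (i : Fin 2) (θ : Jet2) : ℝ := totalD (Sum.inl i) detH θ / detH θ

/-- `ρ = σ²`. -/
def rho (θ : Jet2) : Matrix (Fin 2) (Fin 2) ℝ := Matrix.of fun i j => sig i θ * sig j θ

/-- `χ = (dh₁₁ dh₂₂ - dh₁₂ dh₁₂) / det h`, as a symmetric bilinear form. -/
def chi (θ : Jet2) : Matrix (Fin 2) (Fin 2) ℝ :=
  Matrix.of fun i j =>
    (dh 0 0 i θ * dh 1 1 j θ + dh 0 0 j θ * dh 1 1 i θ - 2 * (dh 0 1 i θ * dh 0 1 j θ)) /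
      (2 * detH θ)

/-- `γ = χ - ρ / 4`. -/
def gam (θ : Jet2) : Matrix (Fin 2) (Fin 2) ℝ := chi θ - (1 / 4 : ℝ) • rho θ

/-- The trace `C_μ = μ_ij g̃ⁱʲ`. -/
def traceInv (μ : Jet2 → Matrix (Fin 2) (Fin 2) ℝ) (θ : Jet2) : ℝ :=
  ∑ i, ∑ j, μ θ i j * (orbitMat θ.2.1)⁻¹ i j

/-- The determinant `Q_μ = det μ / det g̃`. -/
def detInv (μ : Jet2 → Matrix (Fin 2) (Fin 2) ℝ) (θ : Jet2) : ℝ := (μ θ).det / detG θ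

/-- The components `𝒞ᵏ = (∂₂ f₁ᵏ - ∂₁ f₂ᵏ) / √|det g̃|` of the curvature vector field. -/
def curv (k : Fin 2) (θ : Jet2) : ℝ :=
  (totalD (Sum.inl 1) (fun η => shiftMat η.2.1 0 k) θ -
    totalD (Sum.inl 0) (fun η => shiftMat η.2.1 1 k) θ) / √|detG θ|

/-- `ℓ_𝒞 = g(𝒞, 𝒞)`. -/
def ellC (θ : Jet2) : ℝ := ∑ k, ∑ l, killMat θ.2.1 k l * curv k θ * curv l θ

/-- `Θ_I`. -/
def thetaI (θ : Jet2) : ℝ :=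
  1 / (√|detH θ| * √|detG θ|) *
    Matrix.det !![dh 0 0 0 θ, dh 0 1 0 θ, dh 1 1 0 θ;
                  dh 0 0 1 θ, dh 0 1 1 θ, dh 1 1 1 θ;
                  curv 1 θ ^ 2, -(curv 0 θ * curv 1 θ), curv 0 θ ^ 2]

/-- The invariant differentiation `X = g̃ⁱˢ σ_s D_i`. -/
def diffX (F : Jet2 → ℝ) (θ : Jet2) : ℝ :=
  ∑ i, ∑ s, (orbitMat θ.2.1)⁻¹ i s * sig s θ * totalD (Sum.inl i) F θ

/-- The semi-invariant differentiation `X^⊥ = (σ₂ D₁ - σ₁ D₂) / √|det g̃|`. -/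
def diffXperp (F : Jet2 → ℝ) (θ : Jet2) : ℝ :=
  sig 1 θ / √|detG θ| * totalD (Sum.inl 0) F θ - sig 0 θ / √|detG θ| * totalD (Sum.inl 1) F θ

/-- `C_ρ, C_χ, Q_χ, Q_γ, ℓ_𝒞, Θ_I, X C_χ, X Q_γ, X^⊥ C_χ, X^⊥ Q_γ`, in this order. -/
def tenInv : Fin 10 → Jet2 → ℝ :=
  ![traceInv rho, traceInv chi, detInv chi, detInv gam, ellC, thetaI,
    diffX (traceInv chi), diffX (detInv gam), diffXperp (traceInv chi), diffXperp (detInv gam)]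

/-! ## Functional independence on a subset of the jet space -/

/-- The tangent space at `θ` of a subset `S` of the jet space. -/
def tanSpace (S : Set Jet2) (θ : Jet2) : Submodule ℝ Jet2 :=
  Submodule.span ℝ (tangentConeAt ℝ S θ)

/-- The differential at `θ` of the restriction of `F` to `S`. -/
def diffOn (S : Set Jet2) (F : Jet2 → ℝ) (θ : Jet2) : tanSpace S θ →ₗ[ℝ] ℝ :=
  (fderiv ℝ F θ).toLinearMap.domRestrict (tanSpace S θ)

end

end KillingJet

/-! Call two jets equivalent (`Rel`) when a transformation of the pseudogroup carries one to the
other. A (semi-)invariant is a function that is constant, up to sign, on equivalence classes. The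
proof constructs an explicit ten-parameter slice inside the Einstein equation that meets the class
of every Einstein jet with C_ρ ≠ 0 and ℓ_𝒞 ≠ 0, and computes the ten functions on it.

Where C_ρ and ℓ_𝒞 do not vanish, X and X^⊥ frame the orbit plane, while 𝒞 and its orthogonal
complement frame the Killing leaf. These frames serve as the linear part of a transformation. Its
quadratic, cubic and fibrewise terms then remove as many derivatives of g̃ and f as the symmetry of
partial derivatives allows (`exists_rel_normalJet`). At such a normal form the ten Einstein
equations are linear in the second-order data and are solved for ten of them
(`normalJet_eq_einJet`). What survives is C_ρ, ℓ_𝒞, the four components of the tracefree parts of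
h⁻¹dh, and four second derivatives of h. These are the coordinates of `sliceJet`, and they depend
differentiably on the jet (`rel_sliceJet`, `differentiableAt_sliceCoord`).

On the slice the six first-order functions control the first six coordinates. The four second-order
functions are affine in the last four coordinates, with a linear part that is invertible when γ is
nondegenerate with nonzero discriminant. Hence the ten differentials separate the tangent vectors of
the slice at generic points (`eq_zero_of_hasDerivAt_slice`).

A fixed transformation moves the slice so that it passes through a given jet θ (`exists_slice`).
This yields a map f from ℝ¹⁰ into the equation and coordinates S with f(S θ) = θ, such that f(S η)
is equivalent to η without signs for η near θ on the equation. Every (semi-)invariant F therefore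
agrees with F ∘ f ∘ S there, its differential factors through ℝ¹⁰, and linear algebra in the dual of
ℝ¹⁰ gives independence and spanning together (`diffOn_basis_of_slice`). No manifold structure on the
equation is needed: only the span of its tangent cone enters.

Three supports carry this. The equation is invariant because the Ricci tensor is a tensor
(`ricciMat_pullback`). The ten functions are (semi-)invariant because they are built from
first-order tensors (`TensorLaw`) and their gradients. Generic jets are dense because the first
derivatives in a normal form are unconstrained and the genericity conditions are analytic in them
(`mem_closure_generic`). -/

open scoped ContDiff Topology Matrix

namespace KillingJet

noncomputable section

/-! ### Calculus of partial derivatives on the plane. -/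

section PlaneCalculus

variable {E F : Type*} [NormedAddCommGroup E] [NormedSpace ℝ E] [NormedAddCommGroup F]
  [NormedSpace ℝ F]

theorem contDiffAt_pd {w : Plane → E} {t : Plane} (hw : ContDiffAt ℝ ∞ w t) (i : Fin 2) :
    ContDiffAt ℝ ∞ (pd i w) t :=
  (hw.fderiv_right (m := ∞) (by simp)).clm_apply contDiffAt_const

theorem differentiableAt_of_smooth {w : E → F} {t : E} (hw : ContDiffAt ℝ ∞ w t) :
    DifferentiableAt ℝ w t := hw.differentiableAt (by simp)

theorem eventually_differentiableAt {w : E → F} {t : E} (hw : ContDiffAt ℝ ∞ w t) :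
    ∀ᶠ s in 𝓝 t, DifferentiableAt ℝ w s :=
  ((ContDiffAt.of_le (m := 1) hw (by norm_cast)).eventually (by simp)).mono
    fun s (hs : ContDiffAt ℝ 1 w s) => hs.differentiableAt (by simp)

theorem pd_congr {w v : Plane → E} {t : Plane} (h : w =ᶠ[𝓝 t] v) (i : Fin 2) :
    pd i w t = pd i v t := by
  simp only [pd, h.fderiv_eq]

theorem eventually_pd_congr {w v : Plane → E} {t : Plane} (h : w =ᶠ[𝓝 t] v) (i : Fin 2) :
    pd i w =ᶠ[𝓝 t] pd i v := by
  filter_upwards [h.fderiv (𝕜 := ℝ)] with s hs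
  simp only [pd, hs]

theorem pd_comm {w : Plane → E} {t : Plane} (hw : ContDiffAt ℝ 2 w t) (i j : Fin 2) :
    pd i (pd j w) t = pd j (pd i w) t := by
  have h2 : DifferentiableAt ℝ (fderiv ℝ w) t :=
    (hw.fderiv_right (m := 1) (by norm_cast)).differentiableAt (by simp)
  have key : ∀ k l : Fin 2, pd k (pd l w) t
      = fderiv ℝ (fderiv ℝ w) t (Pi.single k 1) (Pi.single l 1) := by
    intro k l
    have : pd l w = fun s => fderiv ℝ w s (Pi.single l 1) := rfl
    rw [this]
    simp only [pd]
    rw [fderiv_clm_apply h2 (differentiableAt_const _)]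
    simp
  rw [key, key]
  exact (hw.isSymmSndFDerivAt (by simp)).eq _ _

theorem pd_clm (L : E →L[ℝ] F) {w : Plane → E} {t : Plane} (hw : DifferentiableAt ℝ w t)
    (i : Fin 2) : pd i (fun s => L (w s)) t = L (pd i w t) := by
  have : fderiv ℝ (fun s => L (w s)) t = L.comp (fderiv ℝ w t) :=
    (L.hasFDerivAt.comp t hw.hasFDerivAt).fderiv
  simp [pd, this]

@[simp] theorem pd_const (c : E) (i : Fin 2) (t : Plane) : pd i (fun _ => c) t = 0 := by
  simp [pd]

theorem pd_add {w v : Plane → E} {t : Plane} (hw : DifferentiableAt ℝ w t)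
    (hv : DifferentiableAt ℝ v t) (i : Fin 2) :
    pd i (fun s => w s + v s) t = pd i w t + pd i v t := by
  simp [pd, fderiv_fun_add hw hv]

theorem pd_sub {w v : Plane → E} {t : Plane} (hw : DifferentiableAt ℝ w t)
    (hv : DifferentiableAt ℝ v t) (i : Fin 2) :
    pd i (fun s => w s - v s) t = pd i w t - pd i v t := by
  simp [pd, fderiv_fun_sub hw hv]

theorem pd_mul {w v : Plane → ℝ} {t : Plane} (hw : DifferentiableAt ℝ w t)
    (hv : DifferentiableAt ℝ v t) (i : Fin 2) :
    pd i (fun s => w s * v s) t = pd i w t * v t + w t * pd i v t := by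
  simp [pd, fderiv_fun_mul hw hv]; ring

theorem pd_const_mul (c : ℝ) {w : Plane → ℝ} {t : Plane} (hw : DifferentiableAt ℝ w t)
    (i : Fin 2) : pd i (fun s => c * w s) t = c * pd i w t := by
  simp [pd, fderiv_const_mul hw]

theorem pd_sum {ι : Type*} (u : Finset ι) {w : ι → Plane → E} {t : Plane}
    (hw : ∀ k ∈ u, DifferentiableAt ℝ (w k) t) (i : Fin 2) :
    pd i (fun s => ∑ k ∈ u, w k s) t = ∑ k ∈ u, pd i (w k) t := by
  simp [pd, fderiv_fun_sum hw]

theorem pd_comp {w : Plane → E} {φ : Plane → Plane} {t : Plane}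
    (hw : DifferentiableAt ℝ w (φ t)) (hφ : DifferentiableAt ℝ φ t) (i : Fin 2) :
    pd i (fun s => w (φ s)) t = ∑ k, pd i φ t k • pd k w (φ t) := by
  have h1 : fderiv ℝ (fun s => w (φ s)) t = (fderiv ℝ w (φ t)).comp (fderiv ℝ φ t) :=
    (hw.hasFDerivAt.comp t hφ.hasFDerivAt).fderiv
  simp only [pd, h1, ContinuousLinearMap.comp_apply]
  conv_lhs => rw [show fderiv ℝ φ t (Pi.single i 1) = ∑ k, fderiv ℝ φ t (Pi.single i 1) k •
    (Pi.single k 1 : Plane) from by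
      ext k; fin_cases k <;> simp [Fin.sum_univ_two]]
  simp only [map_sum, map_smul]

theorem pd_apply {w : Plane → Plane} {t : Plane} (hw : DifferentiableAt ℝ w t) (i k : Fin 2) :
    pd i w t k = pd i (fun s => w s k) t :=
  (pd_clm (ContinuousLinearMap.proj (R := ℝ) (φ := fun _ : Fin 2 => ℝ) k) hw i).symm

end PlaneCalculus

/-! ### Total derivatives -/

section Total

theorem contDiff_totalVec (a : Idx) : ContDiff ℝ ∞ (totalVec a) := by
  rcases a with i | k
  · have h1 : ContDiff ℝ ∞ (fun θ : Jet2 => θ.2.2.1 i) := by fun_prop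
    have h2 : ContDiff ℝ ∞ (fun θ : Jet2 => fun j : Fin 2 => θ.2.2.2 (symIdx i j)) := by fun_prop
    exact contDiff_const.prodMk (h1.prodMk (h2.prodMk contDiff_const))
  · exact contDiff_const

theorem contDiffAt_totalD {F : Jet2 → ℝ} {θ : Jet2} (hF : ContDiffAt ℝ ∞ F θ) (a : Idx) :
    ContDiffAt ℝ ∞ (totalD a F) θ :=
  (hF.fderiv_right (m := ∞) (by simp)).clm_apply (contDiff_totalVec a).contDiffAt

/-- A function of the first-order jet of the coefficients only. -/
def FirstOrder (F : Jet2 → ℝ) : Prop := ∀ θ : Jet2, ∀ x w, F (x, θ.2.1, θ.2.2.1, w) = F θ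

/-- `F` is constant along lines in these directions. -/
theorem FirstOrder.fderiv_vert {F : Jet2 → ℝ} (hF : FirstOrder F) {θ : Jet2}
    (hd : DifferentiableAt ℝ F θ) (x w) : fderiv ℝ F θ (x, 0, 0, w) = 0 := by
  have h : HasDerivAt (fun τ : ℝ => F (θ + τ • ((x, 0, 0, w) : Jet2)))
      (fderiv ℝ F θ (x, 0, 0, w)) 0 := by
    have h1 : HasDerivAt (fun τ : ℝ => θ + τ • ((x, 0, 0, w) : Jet2)) (x, 0, 0, w) 0 := by
      simpa using ((hasDerivAt_id (0 : ℝ)).smul_const ((x, 0, 0, w) : Jet2)).const_add θ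
    have h2 : HasFDerivAt F (fderiv ℝ F θ) (θ + (0 : ℝ) • ((x, 0, 0, w) : Jet2)) := by
      simpa using hd.hasFDerivAt
    exact h2.comp_hasDerivAt 0 h1
  have h3 : (fun τ : ℝ => F (θ + τ • ((x, 0, 0, w) : Jet2))) = fun _ => F θ := by
    funext τ
    have := hF θ (θ.1 + τ • x) (θ.2.2.2 + τ • w)
    rw [← this]
    congr 1
    simp [Prod.ext_iff]
  rw [h3] at h
  exact h.unique (hasDerivAt_const _ _)

theorem differentiableAt_jetAt {σ : Plane → Fib} {x : Base} (hσ : ContDiffAt ℝ 3 σ x.1) :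
    DifferentiableAt ℝ (jetAt σ) x := by
  have hp : ∀ {w : Plane → Fib}, DifferentiableAt ℝ w x.1 →
      DifferentiableAt ℝ (fun y : Base => w y.1) x := fun {w} hw =>
    DifferentiableAt.comp (g := w) (f := fun y : Base => y.1) x hw differentiableAt_fst
  have h1 : ∀ i, ContDiffAt ℝ 2 (pd i σ) x.1 := fun i =>
    (hσ.fderiv_right (m := 2) (by norm_num)).clm_apply contDiffAt_const
  have h2 : ∀ i j, ContDiffAt ℝ 1 (pd i (pd j σ)) x.1 := fun i j =>
    ((h1 j).fderiv_right (m := 1) (by norm_num)).clm_apply contDiffAt_const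
  unfold jetAt
  refine differentiableAt_id.prodMk ((hp (hσ.differentiableAt (by simp))).prodMk
    (DifferentiableAt.prodMk ?_ ?_))
  · exact differentiableAt_pi.2 fun i => hp ((h1 i).differentiableAt (by simp))
  · refine differentiableAt_pi.2 fun i => ?_
    fin_cases i <;> exact hp ((h2 _ _).differentiableAt (by simp))

theorem symIdx_comm (i j : Fin 2) : symIdx i j = symIdx j i := by
  fin_cases i <;> fin_cases j <;> rfl

theorem jetAt_second {σ : Plane → Fib} {x : Base} (hσ : ContDiffAt ℝ 2 σ x.1) (i j : Fin 2) :
    (jetAt σ x).2.2.2 (symIdx i j) = pd i (pd j σ) x.1 := by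
  fin_cases i <;> fin_cases j
  · rfl
  · rfl
  · exact pd_comm hσ 0 1
  · rfl

/-- Chain rule: the velocity of the jet along the section differs from `totalVec` only by
second-order components, coming from third derivatives of `σ`, and a first-order function does not
see them. This justifies the truncation in the definition of `totalVec`. -/
theorem totalD_jetAt {F : Jet2 → ℝ} (hF : FirstOrder F) {σ : Plane → Fib} {x : Base}
    (hσ : ContDiffAt ℝ 3 σ x.1) (hd : DifferentiableAt ℝ F (jetAt σ x)) (i : Fin 2) :
    totalD (Sum.inl i) F (jetAt σ x) = pd i (fun t => F (jetAt σ (t, x.2))) x.1 := by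
  have hj : DifferentiableAt ℝ (fun t => jetAt σ (t, x.2)) x.1 := by
    have h1 : DifferentiableAt ℝ (jetAt σ) ((fun t : Plane => ((t, x.2) : Base)) x.1) :=
      differentiableAt_jetAt hσ
    exact DifferentiableAt.comp (g := jetAt σ) (f := fun t : Plane => ((t, x.2) : Base)) x.1 h1
      (by fun_prop)
  have h2 : fderiv ℝ (fun t => F (jetAt σ (t, x.2))) x.1
      = (fderiv ℝ F (jetAt σ x)).comp (fderiv ℝ (fun t => jetAt σ (t, x.2)) x.1) :=
    (HasFDerivAt.comp (g := F) x.1 hd.hasFDerivAt hj.hasFDerivAt).fderiv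
  have h3 : pd i (fun t => jetAt σ (t, x.2)) x.1 = totalVec (Sum.inl i) (jetAt σ x) +
      ((0 : Base), 0, 0, fun k => pd i (fun t => (jetAt σ (t, x.2)).2.2.2 k) x.1) := by
    have hc : ∀ {G : Type} [NormedAddCommGroup G] [NormedSpace ℝ G] (L : Jet2 →L[ℝ] G),
        L (pd i (fun t => jetAt σ (t, x.2)) x.1) = pd i (fun t => L (jetAt σ (t, x.2))) x.1 :=
      fun L => (pd_clm L hj i).symm
    refine Prod.ext (Prod.ext ?_ ?_) (Prod.ext ?_ (Prod.ext ?_ ?_))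
    · have := hc ((ContinuousLinearMap.fst ℝ Plane Plane).comp (ContinuousLinearMap.fst ℝ Base _))
      simp only [ContinuousLinearMap.comp_apply, ContinuousLinearMap.coe_fst'] at this
      rw [this]
      ext k
      simp [jetAt, totalVec, pd, Pi.single_apply]
    · have := hc ((ContinuousLinearMap.snd ℝ Plane Plane).comp (ContinuousLinearMap.fst ℝ Base _))
      simp only [ContinuousLinearMap.comp_apply, ContinuousLinearMap.coe_fst',
        ContinuousLinearMap.coe_snd'] at this
      rw [this]
      simp [jetAt, totalVec]
    · have := hc ((ContinuousLinearMap.fst ℝ Fib _).comp (ContinuousLinearMap.snd ℝ Base _))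
      simp only [ContinuousLinearMap.comp_apply, ContinuousLinearMap.coe_fst',
        ContinuousLinearMap.coe_snd'] at this
      rw [this]
      simp [jetAt, totalVec]
    · funext k
      have := hc ((ContinuousLinearMap.proj (R := ℝ) (φ := fun _ : Fin 2 => Fib) k).comp
        ((ContinuousLinearMap.fst ℝ (Fin 2 → Fib) (Fin 3 → Fib)).comp
        ((ContinuousLinearMap.snd ℝ Fib _).comp (ContinuousLinearMap.snd ℝ Base _))))
      simp only [ContinuousLinearMap.comp_apply, ContinuousLinearMap.coe_fst',
        ContinuousLinearMap.coe_snd', ContinuousLinearMap.proj_apply] at this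
      rw [this]
      simp only [totalVec, Prod.snd_add, Prod.fst_add, Pi.add_apply, Pi.zero_apply, add_zero,
        jetAt_second (hσ.of_le (by norm_num))]
      rfl
    · funext k
      have := hc ((ContinuousLinearMap.proj (R := ℝ) (φ := fun _ : Fin 3 => Fib) k).comp
        ((ContinuousLinearMap.snd ℝ (Fin 2 → Fib) (Fin 3 → Fib)).comp
        ((ContinuousLinearMap.snd ℝ Fib _).comp (ContinuousLinearMap.snd ℝ Base _))))
      simp only [ContinuousLinearMap.comp_apply, 
        ContinuousLinearMap.coe_snd', ContinuousLinearMap.proj_apply] at this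
      rw [this]
      simp [totalVec]
  simp only [pd] at h3
  simp only [pd, h2, ContinuousLinearMap.comp_apply, h3, map_add]
  have h4 := hF.fderiv_vert hd 0 (fun k => fderiv ℝ (fun t => (jetAt σ (t, x.2)).2.2.2 k) x.1
    (Pi.single i 1))
  rw [h4, add_zero]
  rfl

theorem eventually_contDiffAt {E F : Type*} [NormedAddCommGroup E] [NormedSpace ℝ E]
    [NormedAddCommGroup F] [NormedSpace ℝ F] {w : E → F} {t : E} (hw : ContDiffAt ℝ ∞ w t) (n : ℕ) :
    ∀ᶠ s in 𝓝 t, ContDiffAt ℝ n w s :=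
  (ContDiffAt.of_le (m := n) hw (by exact_mod_cast le_top)).eventually (by simp)

theorem totalD_inr {F : Jet2 → ℝ} (hF : FirstOrder F) {θ : Jet2} (hd : DifferentiableAt ℝ F θ)
    (k : Fin 2) : totalD (Sum.inr k) F θ = 0 := hF.fderiv_vert hd _ 0

end Total

/-! ### The algebra of 2-jets of scalar functions on the plane -/

/-- 2-jets of scalar functions: value, first derivatives, second derivatives. -/
abbrev ScalarJet : Type := ℝ × (Fin 2 → ℝ) × (Fin 2 → Fin 2 → ℝ)

/-- The 2-jet of a scalar function. -/
def scalarJet (w : Plane → ℝ) (t : Plane) : ScalarJet :=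
  (w t, fun i => pd i w t, fun i j => pd i (pd j w) t)

/-- The product of 2-jets. -/
def jmul (a b : ScalarJet) : ScalarJet :=
  (a.1 * b.1, fun i => a.2.1 i * b.1 + a.1 * b.2.1 i,
    fun i j => a.2.2 i j * b.1 + a.2.1 i * b.2.1 j + a.2.1 j * b.2.1 i + a.1 * b.2.2 i j)

/-- The composition of a 2-jet with a plane transformation whose Jacobian matrix has entries with
the 2-jets `J k i`. -/
def jcomp (a : ScalarJet) (J : Fin 2 → Fin 2 → ScalarJet) : ScalarJet :=
  (a.1, fun i => ∑ k, (J k i).1 * a.2.1 k,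
    fun i j => ∑ k, ((J k j).2.1 i * a.2.1 k + (J k j).1 * ∑ l, (J l i).1 * a.2.2 l k))

theorem scalarJet_const (c : ℝ) (t : Plane) : scalarJet (fun _ => c) t = (c, 0, 0) := by
  refine Prod.ext rfl (Prod.ext ?_ ?_)
  · funext i; simp [scalarJet]
  · funext i j
    have : pd j (fun _ : Plane => c) = fun _ => 0 := by funext s; simp
    simp [scalarJet, this]

theorem scalarJet_add {w v : Plane → ℝ} {t : Plane} (hw : ContDiffAt ℝ ∞ w t)
    (hv : ContDiffAt ℝ ∞ v t) :
    scalarJet (fun s => w s + v s) t = scalarJet w t + scalarJet v t := by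
  refine Prod.ext rfl (Prod.ext ?_ ?_)
  · funext i; exact pd_add (differentiableAt_of_smooth hw) (differentiableAt_of_smooth hv) i
  · funext i j
    have : pd j (fun s => w s + v s) =ᶠ[𝓝 t] fun s => pd j w s + pd j v s := by
      filter_upwards [eventually_differentiableAt hw, eventually_differentiableAt hv] with s h1 h2
      exact pd_add h1 h2 j
    exact (pd_congr this i).trans (pd_add (differentiableAt_of_smooth (contDiffAt_pd hw j))
      (differentiableAt_of_smooth (contDiffAt_pd hv j)) i)

theorem scalarJet_sum {ι : Type*} (u : Finset ι) {w : ι → Plane → ℝ} {t : Plane}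
    (hw : ∀ k ∈ u, ContDiffAt ℝ ∞ (w k) t) :
    scalarJet (fun s => ∑ k ∈ u, w k s) t = ∑ k ∈ u, scalarJet (w k) t := by
  classical
  induction u using Finset.induction_on with
  | empty => exact (by simpa using scalarJet_const 0 t : _ = ((0, 0, 0) : ScalarJet))
  | insert a u ha ih =>
    simp only [Finset.sum_insert ha]
    rw [scalarJet_add (hw a (by simp)) (ContDiffAt.sum fun k hk => hw k (by simp [hk])),
      ih fun k hk => hw k (by simp [hk])]

theorem scalarJet_mul {w v : Plane → ℝ} {t : Plane} (hw : ContDiffAt ℝ ∞ w t)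
    (hv : ContDiffAt ℝ ∞ v t) :
    scalarJet (fun s => w s * v s) t = jmul (scalarJet w t) (scalarJet v t) := by
  refine Prod.ext rfl (Prod.ext ?_ ?_)
  · funext i; exact pd_mul (differentiableAt_of_smooth hw) (differentiableAt_of_smooth hv) i
  · funext i j
    have : pd j (fun s => w s * v s) =ᶠ[𝓝 t] fun s => pd j w s * v s + w s * pd j v s := by
      filter_upwards [eventually_differentiableAt hw, eventually_differentiableAt hv] with s h1 h2
      exact pd_mul h1 h2 j
    have h1 := differentiableAt_of_smooth hw
    have h2 := differentiableAt_of_smooth hv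
    have h3 := differentiableAt_of_smooth (contDiffAt_pd hw j)
    have h4 := differentiableAt_of_smooth (contDiffAt_pd hv j)
    refine (pd_congr this i).trans ?_
    rw [pd_add (h3.fun_mul h2) (h1.fun_mul h4), pd_mul h3 h2, pd_mul h1 h4]
    simp only [jmul, scalarJet]
    ring

theorem scalarJet_comp {w : Plane → ℝ} {φ : Plane → Plane} {t : Plane}
    (hw : ContDiffAt ℝ ∞ w (φ t)) (hφ : ContDiffAt ℝ ∞ φ t) :
    scalarJet (fun s => w (φ s)) t =
      jcomp (scalarJet w (φ t)) (fun k i => scalarJet (fun s => pd i φ s k) t) := by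
  have hφd := eventually_differentiableAt hφ
  have hwd : ∀ᶠ s in 𝓝 t, DifferentiableAt ℝ w (φ s) :=
    hφ.continuousAt.eventually (eventually_differentiableAt hw)
  refine Prod.ext rfl (Prod.ext ?_ ?_)
  · funext i
    simpa [jcomp, scalarJet] using
      pd_comp (differentiableAt_of_smooth hw) (differentiableAt_of_smooth hφ) i
  · funext i j
    have : pd j (fun s => w (φ s)) =ᶠ[𝓝 t] fun s => ∑ k, pd j φ s k * pd k w (φ s) := by
      filter_upwards [hφd, hwd] with s h1 h2
      simpa using pd_comp h2 h1 j
    have hA : ∀ k, ContDiffAt ℝ ∞ (fun s => pd j φ s k) t := fun k =>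
      contDiffAt_pi.1 (contDiffAt_pd hφ j) k
    have hB : ∀ k, DifferentiableAt ℝ (fun s => pd k w (φ s)) t := fun k =>
      DifferentiableAt.comp (g := pd k w) t (differentiableAt_of_smooth (contDiffAt_pd hw k))
        (differentiableAt_of_smooth hφ)
    refine (pd_congr this i).trans ?_
    rw [pd_sum _ fun k _ => (differentiableAt_of_smooth (hA k)).fun_mul (hB k)]
    simp only [jcomp, scalarJet]
    refine Finset.sum_congr rfl fun k _ => ?_
    rw [pd_mul (differentiableAt_of_smooth (hA k)) (hB k),
      pd_comp (differentiableAt_of_smooth (contDiffAt_pd hw k)) (differentiableAt_of_smooth hφ)]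
    simp

/-! ### Components of jets -/

/-- The component of `g̃`. -/
def compG (m : Fin 3) : Fib →L[ℝ] ℝ :=
  (ContinuousLinearMap.proj (R := ℝ) (φ := fun _ : Fin 3 => ℝ) m).comp
    (ContinuousLinearMap.fst ℝ (Fin 3 → ℝ) ((Fin 2 → Fin 2 → ℝ) × (Fin 3 → ℝ)))

/-- The component `f_iᵏ`. -/
def compF (i k : Fin 2) : Fib →L[ℝ] ℝ :=
  (ContinuousLinearMap.proj (R := ℝ) (φ := fun _ : Fin 2 => ℝ) k).comp
    ((ContinuousLinearMap.proj (R := ℝ) (φ := fun _ : Fin 2 => Fin 2 → ℝ) i).comp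
      ((ContinuousLinearMap.fst ℝ (Fin 2 → Fin 2 → ℝ) (Fin 3 → ℝ)).comp
        (ContinuousLinearMap.snd ℝ (Fin 3 → ℝ) ((Fin 2 → Fin 2 → ℝ) × (Fin 3 → ℝ)))))

/-- The component of `h`. -/
def compH (m : Fin 3) : Fib →L[ℝ] ℝ :=
  (ContinuousLinearMap.proj (R := ℝ) (φ := fun _ : Fin 3 => ℝ) m).comp
    ((ContinuousLinearMap.snd ℝ (Fin 2 → Fin 2 → ℝ) (Fin 3 → ℝ)).comp
      (ContinuousLinearMap.snd ℝ (Fin 3 → ℝ) ((Fin 2 → Fin 2 → ℝ) × (Fin 3 → ℝ))))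

@[simp] theorem compG_apply (m : Fin 3) (u : Fib) : compG m u = u.1 m := rfl
@[simp] theorem compF_apply (i k : Fin 2) (u : Fib) : compF i k u = u.2.1 i k := rfl
@[simp] theorem compH_apply (m : Fin 3) (u : Fib) : compH m u = u.2.2 m := rfl

/-- The scalar 2-jet of a component of a jet. -/
def compJet (c : Fib →L[ℝ] ℝ) (θ : Jet2) : ScalarJet :=
  (c θ.2.1, fun i => c (θ.2.2.1 i), fun i j => c (θ.2.2.2 (symIdx i j)))

theorem compJet_jetAt (c : Fib →L[ℝ] ℝ) {σ : Plane → Fib} {x : Base}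
    (hσ : ContDiffAt ℝ ∞ σ x.1) : compJet c (jetAt σ x) = scalarJet (fun s => c (σ s)) x.1 := by
  have h1 : ∀ j, (pd j fun s => c (σ s)) =ᶠ[𝓝 x.1] fun s => c (pd j σ s) := by
    intro j
    filter_upwards [eventually_differentiableAt hσ] with s hs
    exact pd_clm c hs j
  refine Prod.ext rfl (Prod.ext ?_ ?_)
  · funext i; exact (h1 i).eq_of_nhds.symm
  · funext i j
    refine Eq.trans ?_ (pd_congr (h1 j) i).symm
    rw [pd_clm c (differentiableAt_of_smooth (contDiffAt_pd hσ j)) i, ← jetAt_second (hσ.of_le (by norm_cast))]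
    rfl

theorem fib_ext {u v : Fib} (hg : ∀ m, compG m u = compG m v)
    (hf : ∀ i k, compF i k u = compF i k v) (hh : ∀ m, compH m u = compH m v) : u = v :=
  Prod.ext (funext hg) (Prod.ext (funext fun i => funext (hf i)) (funext hh))

theorem exists_symIdx (m : Fin 3) : ∃ i j, m = symIdx i j := by
  fin_cases m
  exacts [⟨0, 0, rfl⟩, ⟨0, 1, rfl⟩, ⟨1, 1, rfl⟩]

theorem jet_ext {θ η : Jet2} (h0 : θ.1 = η.1) (hg : ∀ m, compJet (compG m) θ = compJet (compG m) η)
    (hf : ∀ i k, compJet (compF i k) θ = compJet (compF i k) η)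
    (hh : ∀ m, compJet (compH m) θ = compJet (compH m) η) : θ = η := by
  refine Prod.ext h0 (Prod.ext ?_ (Prod.ext ?_ ?_))
  · exact fib_ext (fun m => congrArg (·.1) (hg m)) (fun i k => congrArg (·.1) (hf i k))
      fun m => congrArg (·.1) (hh m)
  · funext i
    exact fib_ext (fun m => congrArg (·.2.1 i) (hg m)) (fun j k => congrArg (·.2.1 i) (hf j k))
      fun m => congrArg (·.2.1 i) (hh m)
  · funext m
    obtain ⟨i, j, rfl⟩ := exists_symIdx m
    exact fib_ext (fun m => congrArg (·.2.2 i j) (hg m)) (fun i' k => congrArg (·.2.2 i j) (hf i' k))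
      fun m => congrArg (·.2.2 i j) (hh m)

/-- The polynomial section with a given jet. -/
def polySec (θ : Jet2) (t : Plane) : Fib :=
  θ.2.1 + ((t 0 - θ.1.1 0) • θ.2.2.1 0 + (t 1 - θ.1.1 1) • θ.2.2.1 1) +
    (((t 0 - θ.1.1 0) ^ 2 / 2) • θ.2.2.2 0 + ((t 0 - θ.1.1 0) * (t 1 - θ.1.1 1)) • θ.2.2.2 1 +
      ((t 1 - θ.1.1 1) ^ 2 / 2) • θ.2.2.2 2)

theorem contDiff_polySec (θ : Jet2) : ContDiff ℝ ∞ (polySec θ) := by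
  unfold polySec
  fun_prop

/-- The derivative has the shape of the left side with vanishing quadratic part, so a second
application produces the second derivatives. -/
theorem pd_poly (a : ℝ) (b : Fin 2 → ℝ) (c : Fin 3 → ℝ) (x : Plane) (i : Fin 2) :
    (pd i fun t : Plane => a + ((t 0 - x 0) * b 0 + (t 1 - x 1) * b 1) +
      ((t 0 - x 0) ^ 2 / 2 * c 0 + (t 0 - x 0) * (t 1 - x 1) * c 1 + (t 1 - x 1) ^ 2 / 2 * c 2)) =
      fun t => b i + ((t 0 - x 0) * c (symIdx i 0) + (t 1 - x 1) * c (symIdx i 1)) := by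
  have h0 : ∀ t : Plane, HasFDerivAt (fun t : Plane => t 0)
      (ContinuousLinearMap.proj (R := ℝ) (φ := fun _ : Fin 2 => ℝ) 0) t := fun t =>
    (ContinuousLinearMap.proj (R := ℝ) (φ := fun _ : Fin 2 => ℝ) 0).hasFDerivAt
  have h1 : ∀ t : Plane, HasFDerivAt (fun t : Plane => t 1)
      (ContinuousLinearMap.proj (R := ℝ) (φ := fun _ : Fin 2 => ℝ) 1) t := fun t =>
    (ContinuousLinearMap.proj (R := ℝ) (φ := fun _ : Fin 2 => ℝ) 1).hasFDerivAt
  funext t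
  have a0 := (h0 t).sub_const (x 0)
  have a1 := (h1 t).sub_const (x 1)
  have := (((a0.mul_const (b 0)).add (a1.mul_const (b 1))).const_add a).add
    ((((((a0.pow 2).mul_const (1 / 2 : ℝ)).mul_const (c 0)).add ((a0.mul a1).mul_const (c 1)))).add
    (((a1.pow 2).mul_const (1 / 2 : ℝ)).mul_const (c 2)))
  have e := this.fderiv
  have e2 : (fun t : Plane => a + ((t 0 - x 0) * b 0 + (t 1 - x 1) * b 1) +
      ((t 0 - x 0) ^ 2 / 2 * c 0 + (t 0 - x 0) * (t 1 - x 1) * c 1 + (t 1 - x 1) ^ 2 / 2 * c 2)) =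
      fun t : Plane => a + ((t 0 - x 0) * b 0 + (t 1 - x 1) * b 1) +
      ((t 0 - x 0) ^ 2 * (1 / 2) * c 0 + (t 0 - x 0) * (t 1 - x 1) * c 1 +
        (t 1 - x 1) ^ 2 * (1 / 2) * c 2) := by
    funext t; ring
  rw [e2]
  simp only [pd]
  erw [e]
  fin_cases i <;> simp [symIdx] <;> ring

/-- Every jet is realized by a smooth section, so the action on sections induces one on jets. -/
theorem jetAt_polySec (θ : Jet2) : jetAt (polySec θ) θ.1 = θ := by
  have key : ∀ c : Fib →L[ℝ] ℝ, compJet c (jetAt (polySec θ) θ.1) = compJet c θ := by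
    intro c
    rw [compJet_jetAt c (contDiff_polySec θ).contDiffAt]
    have e : (fun s => c (polySec θ s)) = fun t => c θ.2.1 + ((t 0 - θ.1.1 0) * c (θ.2.2.1 0) +
        (t 1 - θ.1.1 1) * c (θ.2.2.1 1)) + ((t 0 - θ.1.1 0) ^ 2 / 2 * c (θ.2.2.2 0) +
        (t 0 - θ.1.1 0) * (t 1 - θ.1.1 1) * c (θ.2.2.2 1) +
        (t 1 - θ.1.1 1) ^ 2 / 2 * c (θ.2.2.2 2)) := by
      funext s
      simp only [polySec, map_add, map_smul, smul_eq_mul]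
    have p := pd_poly (c θ.2.1) (fun i => c (θ.2.2.1 i)) (fun m => c (θ.2.2.2 m)) θ.1.1
    have p2 := fun j => pd_poly (c (θ.2.2.1 j)) (fun i => c (θ.2.2.2 (symIdx j i))) 0 θ.1.1
    simp only [Pi.zero_apply, mul_zero, add_zero] at p2
    rw [e]
    refine Prod.ext ?_ (Prod.ext ?_ ?_)
    · simp [scalarJet, compJet]
    · funext i
      simp only [scalarJet, compJet, p]
      simp
    · funext i j
      simp only [scalarJet, compJet, p, p2, symIdx_comm i j]
  exact jet_ext rfl (fun m => key _) (fun i k => key _) fun m => key _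

/-! ### The action of the pseudogroup on sections and jets -/

theorem jetAt_congr {σ τ : Plane → Fib} {x : Base} (h : σ =ᶠ[𝓝 x.1] τ) : jetAt σ x = jetAt τ x := by
  have h2 := fun i j => pd_congr (eventually_pd_congr h j) i
  simp only [jetAt, h.eq_of_nhds, pd_congr h, h2]

/-- The transformation law of the fibre coordinates. -/
structure FibreLaw (J B α : Matrix (Fin 2) (Fin 2) ℝ) (u u' : Fib) : Prop where
  orbit : orbitMat u = Jᵀ * orbitMat u' * J
  shift : shiftMat u * αᵀ = Jᵀ * shiftMat u' + Bᵀ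
  kill : killMat u = αᵀ * killMat u' * α

theorem orbitMat_transpose (u : Fib) : (orbitMat u)ᵀ = orbitMat u := by
  ext i j; simp [orbitMat, symIdx_comm i j]

theorem killMat_transpose (u : Fib) : (killMat u)ᵀ = killMat u := by
  ext i j; simp [killMat, symIdx_comm i j]

theorem FibreLaw.metricMat_eq {J B α : Matrix (Fin 2) (Fin 2) ℝ} {u u' : Fib}
    (h : FibreLaw J B α u u') :
    metricMat u = (Matrix.fromBlocks J 0 B α)ᵀ * metricMat u' * Matrix.fromBlocks J 0 B α := by
  have e1 : shiftMat u * killMat u = (Jᵀ * shiftMat u' + Bᵀ) * killMat u' * α := by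
    rw [← h.shift, h.kill]; simp only [Matrix.mul_assoc]
  have e2 : killMat u * (shiftMat u)ᵀ = αᵀ * (killMat u' * ((shiftMat u')ᵀ * J + B)) := by
    have := congrArg Matrix.transpose e1
    simpa [Matrix.transpose_mul, killMat_transpose, Matrix.mul_assoc] using this
  have e3 : shiftMat u * killMat u * (shiftMat u)ᵀ =
      (Jᵀ * shiftMat u' + Bᵀ) * killMat u' * ((shiftMat u')ᵀ * J + B) := by
    have h2 : α * (shiftMat u)ᵀ = (shiftMat u')ᵀ * J + B := by
      simpa [Matrix.transpose_mul] using congrArg Matrix.transpose h.shift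
    rw [e1, Matrix.mul_assoc _ α, h2]
  rw [show metricMat u = Matrix.fromBlocks (orbitMat u + shiftMat u * killMat u * (shiftMat u)ᵀ)
    (shiftMat u * killMat u) (killMat u * (shiftMat u)ᵀ) (killMat u) from rfl, e3, e1, e2, h.orbit,
    h.kill]
  simp only [metricMat, Matrix.fromBlocks_transpose, Matrix.fromBlocks_multiply,
    Matrix.transpose_zero, Matrix.zero_mul, Matrix.mul_zero, zero_add]
  congr 1 <;> noncomm_ring

/-- The leaf block is the law of h. Cancelling the invertible matrix h'α in the mixed block gives
the law of the shifts, and these two account for everything in the orbit block except g̃. -/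
theorem FibreLaw.of_metricMat {J B α : Matrix (Fin 2) (Fin 2) ℝ} {u u' : Fib}
    (hα : α.det ≠ 0) (hh : (killMat u').det ≠ 0)
    (h : metricMat u = (Matrix.fromBlocks J 0 B α)ᵀ * metricMat u' * Matrix.fromBlocks J 0 B α) :
    FibreLaw J B α u u' := by
  simp only [metricMat, Matrix.fromBlocks_transpose, Matrix.fromBlocks_multiply,
    Matrix.transpose_zero, Matrix.zero_mul, Matrix.mul_zero, zero_add, Matrix.fromBlocks_inj] at h
  obtain ⟨h11, h12, -, h22⟩ := h
  have e1 : (shiftMat u * αᵀ - (Jᵀ * shiftMat u' + Bᵀ)) * (killMat u' * α) = 0 := by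
    have : shiftMat u * αᵀ * (killMat u' * α) = (Jᵀ * shiftMat u' + Bᵀ) * (killMat u' * α) := by
      rw [h22] at h12
      calc _ = shiftMat u * (αᵀ * killMat u' * α) := by simp only [Matrix.mul_assoc]
        _ = _ := by rw [h12]; noncomm_ring
    rw [Matrix.sub_mul, this, sub_self]
  have hu : IsUnit (killMat u' * α) := by
    rw [Matrix.isUnit_iff_isUnit_det, Matrix.det_mul]
    exact (mul_ne_zero hh hα).isUnit
  have hs : shiftMat u * αᵀ = Jᵀ * shiftMat u' + Bᵀ :=
    sub_eq_zero.1 ((hu.mul_left_eq_zero).1 e1)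
  refine ⟨?_, hs, h22⟩
  have h2 : α * (shiftMat u)ᵀ = (shiftMat u')ᵀ * J + B := by
    simpa [Matrix.transpose_mul] using congrArg Matrix.transpose hs
  have e3 : shiftMat u * killMat u * (shiftMat u)ᵀ =
      (Jᵀ * shiftMat u' + Bᵀ) * killMat u' * ((shiftMat u')ᵀ * J + B) := by
    rw [h22, ← hs, ← h2]; simp only [Matrix.mul_assoc]
  rw [e3] at h11
  have := sub_eq_zero.2 h11
  rw [← sub_eq_zero, ← this]
  noncomm_ring

theorem FibreLaw.unique {J B α : Matrix (Fin 2) (Fin 2) ℝ} {u v u' : Fib} (hα : α.det ≠ 0)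
    (hu : FibreLaw J B α u u') (hv : FibreLaw J B α v u') : u = v := by
  have h1 : orbitMat u = orbitMat v := hu.orbit.trans hv.orbit.symm
  have h3 : killMat u = killMat v := hu.kill.trans hv.kill.symm
  have h2 : shiftMat u = shiftMat v := by
    have hunit : IsUnit αᵀ := by
      rw [Matrix.isUnit_iff_isUnit_det, Matrix.det_transpose]; exact hα.isUnit
    exact hunit.mul_left_injective (hu.shift.trans hv.shift.symm)
  refine fib_ext (fun m => ?_) (fun i k => congrFun (congrFun h2 i) k) (fun m => ?_)
  · obtain ⟨i, j, rfl⟩ := exists_symIdx m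
    exact congrFun (congrFun h1 i) j
  · obtain ⟨i, j, rfl⟩ := exists_symIdx m
    exact congrFun (congrFun h3 i) j

theorem FibreLaw.comp {J B α J' B' α' : Matrix (Fin 2) (Fin 2) ℝ} {u u' u'' : Fib}
    (h : FibreLaw J B α u u') (h' : FibreLaw J' B' α' u' u'') :
    FibreLaw (J' * J) (α' * B + B' * J) (α' * α) u u'' := by
  refine ⟨?_, ?_, ?_⟩
  · rw [h.orbit, h'.orbit, Matrix.transpose_mul]; simp only [Matrix.mul_assoc]
  · rw [Matrix.transpose_mul, ← Matrix.mul_assoc, h.shift, Matrix.add_mul, Matrix.mul_assoc, h'.shift]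
    simp only [Matrix.transpose_mul, Matrix.transpose_add, Matrix.mul_add, Matrix.mul_assoc]
    abel
  · rw [h.kill, h'.kill, Matrix.transpose_mul]; simp only [Matrix.mul_assoc]

/-- The entries `11, 12, 22` of a matrix. -/
def symTriple (M : Matrix (Fin 2) (Fin 2) ℝ) : Fin 3 → ℝ := ![M 0 0, M 0 1, M 1 1]

theorem symTriple_symIdx {M : Matrix (Fin 2) (Fin 2) ℝ} (hM : Mᵀ = M) (i j : Fin 2) :
    symTriple M (symIdx i j) = M i j := by
  fin_cases i <;> fin_cases j
  · rfl
  · rfl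
  · exact congrFun (congrFun hM 1) 0
  · rfl

/-- The Jacobian matrix of `ψ`. -/
def AdaptedChange.psiJac (P : AdaptedChange) (t : Plane) : Matrix (Fin 2) (Fin 2) ℝ :=
  Matrix.of fun k j => pd j P.psi t k

/-- The pullback of a section. -/
def AdaptedChange.pull (P : AdaptedChange) (τ : Plane → Fib) (t : Plane) : Fib :=
  (symTriple ((P.phiJac t)ᵀ * orbitMat (τ (P.phi t)) * P.phiJac t),
    fun i k => (((P.phiJac t)ᵀ * shiftMat (τ (P.phi t)) + (P.psiJac t)ᵀ) * (P.alpha⁻¹)ᵀ) i k,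
    symTriple (P.alphaᵀ * killMat (τ (P.phi t)) * P.alpha))

theorem AdaptedChange.fibreLaw_pull {P : AdaptedChange} (hα : P.alpha.det ≠ 0) (τ : Plane → Fib)
    (t : Plane) :
    FibreLaw (P.phiJac t) (P.psiJac t) P.alpha (P.pull τ t) (τ (P.phi t)) := by
  refine ⟨?_, ?_, ?_⟩
  · ext i j
    exact symTriple_symIdx (by simp [Matrix.transpose_mul, orbitMat_transpose, Matrix.mul_assoc]) i j
  · have : shiftMat (P.pull τ t) =
        ((P.phiJac t)ᵀ * shiftMat (τ (P.phi t)) + (P.psiJac t)ᵀ) * (P.alpha⁻¹)ᵀ := rfl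
    rw [this, Matrix.mul_assoc, ← Matrix.transpose_mul, Matrix.mul_nonsing_inv _ hα.isUnit]
    simp
  · ext i j
    exact symTriple_symIdx (by simp [Matrix.transpose_mul, killMat_transpose, Matrix.mul_assoc]) i j

theorem AdaptedChange.carries_pull {P : AdaptedChange} (hα : P.alpha.det ≠ 0) (τ : Plane → Fib)
    (t : Plane) : P.Carries (P.pull τ) τ t :=
  Filter.Eventually.of_forall fun s => (fibreLaw_pull hα τ s).metricMat_eq

theorem continuous_killDet : Continuous fun u : Fib => (killMat u).det := by
  simp only [Matrix.det_fin_two, killMat, Matrix.of_apply]; fun_prop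

/-- Nondegeneracy of h persists nearby, where the metric then determines the fibre coordinates.
Invariance thus has to be checked only on pullbacks. -/
theorem AdaptedChange.Carries.eventually_eq {P : AdaptedChange} {σ σ' : Plane → Fib} {t : Plane}
    (h : P.Carries σ σ' t) (hP : P.RegularAt t) (hσ' : ContinuousAt σ' (P.phi t))
    (hd : (killMat (σ' (P.phi t))).det ≠ 0) : σ =ᶠ[𝓝 t] P.pull σ' := by
  have h1 : ∀ᶠ s in 𝓝 t, (killMat (σ' (P.phi s))).det ≠ 0 := by
    have : ContinuousAt (fun s => (killMat (σ' (P.phi s))).det) t :=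
      continuous_killDet.continuousAt.comp (ContinuousAt.comp (g := σ') hσ' hP.1.continuousAt)
    exact this.eventually_ne hd
  filter_upwards [h, h1] with s hs h1
  exact (FibreLaw.of_metricMat hP.2.2.2 h1 hs).unique hP.2.2.2 (fibreLaw_pull hP.2.2.2 σ' s)

theorem AdaptedChange.contDiffAt_phiJac {P : AdaptedChange} {t : Plane} (hP : P.RegularAt t)
    (k i : Fin 2) : ContDiffAt ℝ ∞ (fun s => P.phiJac s k i) t :=
  contDiffAt_pi.1 (contDiffAt_pd hP.1 i) k

theorem AdaptedChange.contDiffAt_psiJac {P : AdaptedChange} {t : Plane} (hP : P.RegularAt t)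
    (k i : Fin 2) : ContDiffAt ℝ ∞ (fun s => P.psiJac s k i) t :=
  contDiffAt_pi.1 (contDiffAt_pd hP.2.1 i) k

theorem contDiffAt_comp_phi {P : AdaptedChange} {t : Plane} (hP : P.RegularAt t) {τ : Plane → Fib}
    (hτ : ContDiffAt ℝ ∞ τ (P.phi t)) (c : Fib →L[ℝ] ℝ) :
    ContDiffAt ℝ ∞ (fun s => c (τ (P.phi s))) t :=
  c.contDiff.contDiffAt.comp t (ContDiffAt.comp (g := τ) t hτ hP.1)

theorem compG_pull {P : AdaptedChange} (hα : P.alpha.det ≠ 0) (τ : Plane → Fib) (t : Plane)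
    (i j : Fin 2) : compG (symIdx i j) (P.pull τ t) =
      ∑ k, ∑ l, P.phiJac t k i * compG (symIdx k l) (τ (P.phi t)) * P.phiJac t l j := by
  have := congrFun (congrFun (P.fibreLaw_pull hα τ t).orbit i) j
  refine this.trans ?_
  simp only [Matrix.mul_apply, Matrix.transpose_apply, Finset.sum_mul]
  exact Finset.sum_comm

theorem compH_pull {P : AdaptedChange} (hα : P.alpha.det ≠ 0) (τ : Plane → Fib) (t : Plane)
    (i j : Fin 2) : compH (symIdx i j) (P.pull τ t) =
      ∑ k, ∑ l, (P.alpha k i * P.alpha l j) * compH (symIdx k l) (τ (P.phi t)) := by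
  have := congrFun (congrFun (P.fibreLaw_pull hα τ t).kill i) j
  refine this.trans ?_
  simp only [Matrix.mul_apply, Matrix.transpose_apply, Finset.sum_mul]
  rw [Finset.sum_comm]
  refine Finset.sum_congr rfl fun k _ => Finset.sum_congr rfl fun l _ => ?_
  simp [killMat]; ring

theorem compF_pull {P : AdaptedChange} (τ : Plane → Fib) (t : Plane)
    (i k : Fin 2) : compF i k (P.pull τ t) =
      ∑ l, P.alpha⁻¹ k l * (∑ j, P.phiJac t j i * compF j l (τ (P.phi t)) + P.psiJac t l i) := by
  simp only [compF_apply, AdaptedChange.pull, Matrix.mul_apply, Matrix.transpose_apply,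
    Matrix.add_apply]
  refine Finset.sum_congr rfl fun l _ => ?_
  rw [mul_comm]
  rfl

theorem contDiffAt_fib {σ : Plane → Fib} {t : Plane}
    (hg : ∀ i j, ContDiffAt ℝ ∞ (fun s => compG (symIdx i j) (σ s)) t)
    (hf : ∀ i k, ContDiffAt ℝ ∞ (fun s => compF i k (σ s)) t)
    (hh : ∀ i j, ContDiffAt ℝ ∞ (fun s => compH (symIdx i j) (σ s)) t) : ContDiffAt ℝ ∞ σ t := by
  refine ContDiffAt.prodMk (f := fun s => (σ s).1) (g := fun s => (σ s).2) ?_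
    (ContDiffAt.prodMk (f := fun s => (σ s).2.1) (g := fun s => (σ s).2.2) ?_ ?_)
  · refine contDiffAt_pi.2 fun m => ?_
    obtain ⟨i, j, rfl⟩ := exists_symIdx m
    exact hg i j
  · exact contDiffAt_pi.2 fun i => contDiffAt_pi.2 fun k => hf i k
  · refine contDiffAt_pi.2 fun m => ?_
    obtain ⟨i, j, rfl⟩ := exists_symIdx m
    exact hh i j

theorem AdaptedChange.contDiffAt_pull {P : AdaptedChange} {t : Plane} (hP : P.RegularAt t)
    {τ : Plane → Fib} (hτ : ContDiffAt ℝ ∞ τ (P.phi t)) : ContDiffAt ℝ ∞ (P.pull τ) t := by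
  have hJ := fun k i => P.contDiffAt_phiJac hP k i
  have hB := fun k i => P.contDiffAt_psiJac hP k i
  have hc := fun c => contDiffAt_comp_phi hP hτ c
  refine contDiffAt_fib (fun i j => ?_) (fun i k => ?_) fun i j => ?_
  · simp only [compG_pull hP.2.2.2]
    exact ContDiffAt.sum fun k _ => ContDiffAt.sum fun l _ => ((hJ k i).mul (hc _)).mul (hJ l j)
  · simp only [compF_pull]
    exact ContDiffAt.sum fun l _ => contDiffAt_const.mul
      ((ContDiffAt.sum fun j _ => (hJ j i).mul (hc _)).add (hB l i))
  · simp only [compH_pull hP.2.2.2]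
    exact ContDiffAt.sum fun k _ => ContDiffAt.sum fun l _ => contDiffAt_const.mul (hc _)

/-- The 2-jets of the entries of the Jacobian matrix of `φ`. -/
def AdaptedChange.phiJet (P : AdaptedChange) (t : Plane) (k i : Fin 2) : ScalarJet :=
  scalarJet (fun s => P.phiJac s k i) t

/-- The 2-jets of the entries of the Jacobian matrix of `ψ`. -/
def AdaptedChange.psiJet (P : AdaptedChange) (t : Plane) (k i : Fin 2) : ScalarJet :=
  scalarJet (fun s => P.psiJac s k i) t

theorem scalarJet_const_mul (c : ℝ) {w : Plane → ℝ} {t : Plane} (hw : ContDiffAt ℝ ∞ w t) :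
    scalarJet (fun s => c * w s) t = c • scalarJet w t := by
  rw [scalarJet_mul contDiffAt_const hw, scalarJet_const]
  refine Prod.ext rfl (Prod.ext ?_ ?_)
  · funext i; simp [jmul]
  · funext i j; simp [jmul]

section JetFormulas

variable {P : AdaptedChange} {x : Base} (hP : P.RegularAt x.1) {τ : Plane → Fib}
  (hτ : ContDiffAt ℝ ∞ τ (P.phi x.1))

include hP hτ

theorem scalarJet_comp_phi (c : Fib →L[ℝ] ℝ) : scalarJet (fun s => c (τ (P.phi s))) x.1 =
    jcomp (compJet c (jetAt τ (P.app x))) (P.phiJet x.1) := by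
  have : ContDiffAt ℝ ∞ τ (P.app x).1 := hτ
  rw [compJet_jetAt c this]
  exact scalarJet_comp (w := fun s => c (τ s)) (c.contDiff.contDiffAt.comp _ hτ) hP.1

theorem compJet_pull_G (i j : Fin 2) : compJet (compG (symIdx i j)) (jetAt (P.pull τ) x) =
    ∑ k, ∑ l, jmul (jmul (P.phiJet x.1 k i)
      (jcomp (compJet (compG (symIdx k l)) (jetAt τ (P.app x))) (P.phiJet x.1)))
        (P.phiJet x.1 l j) := by
  have hJ := fun k i => P.contDiffAt_phiJac hP k i
  have hc := fun c => contDiffAt_comp_phi hP hτ c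
  rw [compJet_jetAt _ (P.contDiffAt_pull hP hτ)]
  simp only [compG_pull hP.2.2.2]
  rw [scalarJet_sum _ fun k _ => ContDiffAt.sum fun l _ => ((hJ k i).mul (hc _)).mul (hJ l j)]
  refine Finset.sum_congr rfl fun k _ => ?_
  rw [scalarJet_sum _ fun l _ => ((hJ k i).mul (hc _)).mul (hJ l j)]
  refine Finset.sum_congr rfl fun l _ => ?_
  rw [scalarJet_mul ((hJ k i).mul (hc _)) (hJ l j), scalarJet_mul (hJ k i) (hc _),
    scalarJet_comp_phi hP hτ]
  rfl

theorem compJet_pull_H (i j : Fin 2) : compJet (compH (symIdx i j)) (jetAt (P.pull τ) x) =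
    ∑ k, ∑ l, (P.alpha k i * P.alpha l j) •
      jcomp (compJet (compH (symIdx k l)) (jetAt τ (P.app x))) (P.phiJet x.1) := by
  have hc := fun c => contDiffAt_comp_phi hP hτ c
  rw [compJet_jetAt _ (P.contDiffAt_pull hP hτ)]
  simp only [compH_pull hP.2.2.2]
  rw [scalarJet_sum _ fun k _ => ContDiffAt.sum fun l _ => contDiffAt_const.mul (hc _)]
  refine Finset.sum_congr rfl fun k _ => ?_
  rw [scalarJet_sum _ fun l _ => contDiffAt_const.mul (hc _)]
  refine Finset.sum_congr rfl fun l _ => ?_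
  rw [scalarJet_const_mul _ (hc _), scalarJet_comp_phi hP hτ]

theorem compJet_pull_F (i k : Fin 2) : compJet (compF i k) (jetAt (P.pull τ) x) =
    ∑ l, P.alpha⁻¹ k l • (∑ j, jmul (P.phiJet x.1 j i)
      (jcomp (compJet (compF j l) (jetAt τ (P.app x))) (P.phiJet x.1)) + P.psiJet x.1 l i) := by
  have hJ := fun k i => P.contDiffAt_phiJac hP k i
  have hB := fun k i => P.contDiffAt_psiJac hP k i
  have hc := fun c => contDiffAt_comp_phi hP hτ c
  have hS := fun l => ContDiffAt.sum (s := Finset.univ) fun j _ => (hJ j i).mul (hc (compF j l))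
  rw [compJet_jetAt _ (P.contDiffAt_pull hP hτ)]
  simp only [compF_pull]
  rw [scalarJet_sum _ fun l _ => contDiffAt_const.mul ((hS l).add (hB l i))]
  refine Finset.sum_congr rfl fun l _ => ?_
  rw [scalarJet_const_mul _ ((hS l).add (hB l i)), scalarJet_add (hS l) (hB l i),
    scalarJet_sum _ fun j _ => (hJ j i).mul (hc _)]
  congr 2
  refine Finset.sum_congr rfl fun j _ => ?_
  rw [scalarJet_mul (hJ j i) (hc _), scalarJet_comp_phi hP hτ]
  rfl

/-- The three preceding formulas involve the section only through its second jet. -/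
theorem jetAt_pull_congr {τ' : Plane → Fib} (hτ' : ContDiffAt ℝ ∞ τ' (P.phi x.1))
    (h : jetAt τ (P.app x) = jetAt τ' (P.app x)) : jetAt (P.pull τ) x = jetAt (P.pull τ') x := by
  refine jet_ext rfl (fun m => ?_) (fun i k => ?_) fun m => ?_
  · obtain ⟨i, j, rfl⟩ := exists_symIdx m
    rw [compJet_pull_G hP hτ, compJet_pull_G hP hτ', h]
  · rw [compJet_pull_F hP hτ, compJet_pull_F hP hτ', h]
  · obtain ⟨i, j, rfl⟩ := exists_symIdx m
    rw [compJet_pull_H hP hτ, compJet_pull_H hP hτ', h]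

end JetFormulas

/-! ### Equivalence of jets under the pseudogroup -/

theorem sign_real_mul (a b : ℝ) : Real.sign (a * b) = Real.sign a * Real.sign b := by
  rcases lt_trichotomy a 0 with ha | rfl | ha <;> rcases lt_trichotomy b 0 with hb | rfl | hb <;>
    simp [Real.sign_of_neg, Real.sign_of_pos, mul_pos_of_neg_of_neg, mul_neg_of_neg_of_pos,
      mul_neg_of_pos_of_neg, *]

/-- The transformation `P ∘ Q`. -/
def AdaptedChange.comp (P Q : AdaptedChange) : AdaptedChange where
  phi t := P.phi (Q.phi t)
  psi t := P.alpha *ᵥ Q.psi t + P.psi (Q.phi t)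
  alpha := P.alpha * Q.alpha

theorem AdaptedChange.app_comp (P Q : AdaptedChange) (x : Base) :
    (P.comp Q).app x = P.app (Q.app x) := by
  refine Prod.ext rfl ?_
  simp only [AdaptedChange.app, AdaptedChange.comp, Matrix.mulVec_add, Matrix.mulVec_mulVec]
  abel

theorem AdaptedChange.phiJac_comp {P Q : AdaptedChange} {t : Plane}
    (hP : DifferentiableAt ℝ P.phi (Q.phi t)) (hQ : DifferentiableAt ℝ Q.phi t) :
    (P.comp Q).phiJac t = P.phiJac (Q.phi t) * Q.phiJac t := by
  ext k i
  simp only [AdaptedChange.phiJac, AdaptedChange.comp, Matrix.of_apply, Matrix.mul_apply]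
  rw [pd_comp hP hQ]
  simp [mul_comm]

theorem pd_mulVec (A : Matrix (Fin 2) (Fin 2) ℝ) {w : Plane → Plane} {t : Plane}
    (hw : DifferentiableAt ℝ w t) (i : Fin 2) : pd i (fun s => A *ᵥ w s) t = A *ᵥ pd i w t :=
  pd_clm (Matrix.toLin' A).toContinuousLinearMap hw i

theorem differentiableAt_mulVec (A : Matrix (Fin 2) (Fin 2) ℝ) {w : Plane → Plane} {t : Plane}
    (hw : DifferentiableAt ℝ w t) : DifferentiableAt ℝ (fun s => A *ᵥ w s) t :=
  (Matrix.toLin' A).toContinuousLinearMap.differentiableAt.comp t hw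

theorem contDiffAt_mulVec (A : Matrix (Fin 2) (Fin 2) ℝ) {w : Plane → Plane} {t : Plane}
    (hw : ContDiffAt ℝ ∞ w t) : ContDiffAt ℝ ∞ (fun s => A *ᵥ w s) t :=
  (Matrix.toLin' A).toContinuousLinearMap.contDiff.contDiffAt.comp t hw

theorem AdaptedChange.psiJac_comp {P Q : AdaptedChange} {t : Plane}
    (hP : DifferentiableAt ℝ P.psi (Q.phi t)) (hQ : DifferentiableAt ℝ Q.phi t)
    (hQ' : DifferentiableAt ℝ Q.psi t) :
    (P.comp Q).psiJac t = P.alpha * Q.psiJac t + P.psiJac (Q.phi t) * Q.phiJac t := by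
  ext k i
  simp only [AdaptedChange.psiJac, AdaptedChange.phiJac, AdaptedChange.comp, Matrix.of_apply,
    Matrix.mul_apply, Matrix.add_apply]
  rw [pd_add (w := fun s => P.alpha *ᵥ Q.psi s) (v := fun s => P.psi (Q.phi s))
    (differentiableAt_mulVec _ hQ') (hP.comp t hQ), pd_mulVec _ hQ', pd_comp hP hQ]
  simp only [Pi.add_apply, Finset.sum_apply, Pi.smul_apply, smul_eq_mul, mul_comm]
  rfl

theorem AdaptedChange.RegularAt.comp {P Q : AdaptedChange} {t : Plane}
    (hP : P.RegularAt (Q.phi t)) (hQ : Q.RegularAt t) : (P.comp Q).RegularAt t := by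
  refine ⟨hP.1.comp t hQ.1, ?_, ?_, ?_⟩
  · exact (contDiffAt_mulVec _ hQ.2.1).add (ContDiffAt.comp (g := P.psi) t hP.2.1 hQ.1)
  · rw [phiJac_comp (differentiableAt_of_smooth hP.1) (differentiableAt_of_smooth hQ.1),
      Matrix.det_mul]
    exact mul_ne_zero hP.2.2.1 hQ.2.2.1
  · simp only [AdaptedChange.comp, Matrix.det_mul]
    exact mul_ne_zero hP.2.2.2 hQ.2.2.2

theorem AdaptedChange.pull_comp {P Q : AdaptedChange} {t : Plane}
    (hP : P.RegularAt (Q.phi t)) (hQ : Q.RegularAt t) (τ : Plane → Fib) :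
    (P.comp Q).pull τ =ᶠ[𝓝 t] Q.pull (P.pull τ) := by
  filter_upwards [eventually_differentiableAt hQ.1, eventually_differentiableAt hQ.2.1,
    hQ.1.continuousAt.eventually (eventually_differentiableAt hP.1),
    hQ.1.continuousAt.eventually (eventually_differentiableAt hP.2.1)] with s h1 h2 h3 h4
  have hα : (P.comp Q).alpha.det ≠ 0 := (hP.comp hQ).2.2.2
  have e1 := fibreLaw_pull hα τ s
  have e2 := (Q.fibreLaw_pull hQ.2.2.2 (P.pull τ) s).comp (P.fibreLaw_pull hP.2.2.2 τ (Q.phi s))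
  rw [← phiJac_comp h3 h1, ← psiJac_comp h4 h1 h2] at e2
  exact e1.unique hα e2

theorem AdaptedChange.pull_of_eventually_id {P : AdaptedChange} {t : Plane}
    (h1 : P.phi =ᶠ[𝓝 t] id) (h2 : P.psi =ᶠ[𝓝 t] fun _ => 0) (h3 : P.alpha = 1) (τ : Plane → Fib) :
    P.pull τ =ᶠ[𝓝 t] τ := by
  filter_upwards [h1, eventually_pd_congr h1 0, eventually_pd_congr h1 1, eventually_pd_congr h2 0,
    eventually_pd_congr h2 1] with s hs a0 a1 b0 b1
  have hJ : P.phiJac s = 1 := by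
    have hp : ∀ i, pd i (id : Plane → Plane) s = Pi.single i 1 := fun i => by simp [pd]
    ext k i
    fin_cases i
    · simp [AdaptedChange.phiJac, a0, hp, Matrix.one_apply, Pi.single_apply]
    · simp [AdaptedChange.phiJac, a1, hp, Matrix.one_apply, Pi.single_apply]
  have hB : P.psiJac s = 0 := by
    ext k i
    fin_cases i
    · simp [AdaptedChange.psiJac, b0]
    · simp [AdaptedChange.psiJac, b1]
  have hα : P.alpha.det ≠ 0 := by simp [h3]
  have e1 := P.fibreLaw_pull hα τ s
  rw [hJ, hB, h3, hs] at e1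
  exact e1.unique (by simp) ⟨by simp, by simp, by simp⟩

/-- The inverse function theorem inverts φ; the fibre part is affine in z and is inverted
explicitly. -/
theorem AdaptedChange.exists_inverse {P : AdaptedChange} {t : Plane} (hP : P.RegularAt t) :
    ∃ R : AdaptedChange, R.RegularAt (P.phi t) ∧ (∀ z, R.app (P.app (t, z)) = (t, z)) ∧
      (P.comp R).phi =ᶠ[𝓝 (P.phi t)] id ∧ (P.comp R).psi =ᶠ[𝓝 (P.phi t)] (fun _ => 0) ∧
      P.alpha * R.alpha = 1 := by
  have hd : (fderiv ℝ P.phi t : Plane →ₗ[ℝ] Plane).det ≠ 0 := by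
    have : LinearMap.toMatrix' (fderiv ℝ P.phi t : Plane →ₗ[ℝ] Plane) = P.phiJac t := by
      ext k i
      simp [LinearMap.toMatrix'_apply, AdaptedChange.phiJac, pd, Pi.single]
    rw [← LinearMap.det_toMatrix', this]
    exact hP.2.2.1
  let e : Plane ≃L[ℝ] Plane := (LinearMap.equivOfDetNeZero _ hd).toContinuousLinearEquiv
  have he : HasFDerivAt P.phi (e : Plane →L[ℝ] Plane) t := by
    have : (e : Plane →L[ℝ] Plane) = fderiv ℝ P.phi t := by
      ext v; rfl
    rw [this]
    exact (differentiableAt_of_smooth hP.1).hasFDerivAt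
  have hs := hP.1.hasStrictFDerivAt' he (by simp)
  let g := hP.1.localInverse he (by simp)
  have hg : ContDiffAt ℝ ∞ g (P.phi t) := hP.1.to_localInverse he (by simp)
  have hgt : g (P.phi t) = t := hP.1.localInverse_apply_image he (by simp)
  have hinv : ∀ᶠ y in 𝓝 (P.phi t), P.phi (g y) = y := hs.eventually_right_inverse
  have hα := hP.2.2.2
  -- Solving z̄ = αz + ψ(t) for z dictates this shift.
  let R : AdaptedChange := ⟨g, fun s => -(P.alpha⁻¹ *ᵥ P.psi (g s)), P.alpha⁻¹⟩
  have hphi : (P.comp R).phi =ᶠ[𝓝 (P.phi t)] id := hinv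
  have hJ : P.phiJac t * R.phiJac (P.phi t) = 1 := by
    have h1 : DifferentiableAt ℝ P.phi (R.phi (P.phi t)) := by
      change DifferentiableAt ℝ P.phi (g (P.phi t))
      rw [hgt]; exact differentiableAt_of_smooth hP.1
    have := P.phiJac_comp (Q := R) h1 (differentiableAt_of_smooth hg)
    have e2 : R.phi (P.phi t) = t := hgt
    rw [e2] at this
    rw [← this]
    ext k i
    simp only [AdaptedChange.phiJac, Matrix.of_apply]
    rw [pd_congr hphi]
    simp [pd, Matrix.one_apply, Pi.single_apply]
  refine ⟨R, ⟨hg, ?_, ?_, ?_⟩, fun z => ?_, hphi, ?_, ?_⟩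
  · refine (contDiffAt_mulVec _ (ContDiffAt.comp (g := P.psi) _ ?_ hg)).neg
    rw [hgt]; exact hP.2.1
  · intro h0
    have := congrArg Matrix.det hJ
    rw [Matrix.det_mul, h0] at this
    simp at this
  · simp [R, Matrix.det_nonsing_inv, hα]
  · simp only [AdaptedChange.app, R, hgt, Matrix.mulVec_add, Matrix.mulVec_mulVec,
      Matrix.nonsing_inv_mul _ hα.isUnit, Matrix.one_mulVec, add_neg_cancel_right]
  · refine Filter.Eventually.of_forall fun s => ?_
    simp only [AdaptedChange.comp, R, Matrix.mulVec_neg, Matrix.mulVec_mulVec,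
      Matrix.mul_nonsing_inv _ hα.isUnit, Matrix.one_mulVec, neg_add_cancel]
  · exact Matrix.mul_nonsing_inv _ hα.isUnit

/-- The jet `θ` is the pullback of the jet `θ'` under a transformation; `a` and `b` are the signs of
`J_φ` and of `det α`. -/
def Rel (a b : ℝ) (θ θ' : Jet2) : Prop :=
  ∃ P : AdaptedChange, P.RegularAt θ.1.1 ∧ P.app θ.1 = θ'.1 ∧
    Real.sign (P.phiJac θ.1.1).det = a ∧ Real.sign P.alpha.det = b ∧
    ∀ τ : Plane → Fib, ContDiffAt ℝ ∞ τ θ'.1.1 → jetAt τ θ'.1 = θ' → jetAt (P.pull τ) θ.1 = θ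

theorem Rel.trans {a b a' b' : ℝ} {θ θ' θ'' : Jet2} (h : Rel a b θ θ') (h' : Rel a' b' θ' θ'') :
    Rel (a' * a) (b' * b) θ θ'' := by
  obtain ⟨Q, hQ, hQx, hQa, hQb, hQj⟩ := h
  obtain ⟨P, hP, hPx, hPa, hPb, hPj⟩ := h'
  have e1 : Q.phi θ.1.1 = θ'.1.1 := congrArg Prod.fst hQx
  have e2 : P.phi θ'.1.1 = θ''.1.1 := congrArg Prod.fst hPx
  rw [← e1] at hP hPa
  refine ⟨P.comp Q, hP.comp hQ, ?_, ?_, ?_, fun τ hτ hj => ?_⟩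
  · rw [AdaptedChange.app_comp, hQx, hPx]
  · rw [AdaptedChange.phiJac_comp (differentiableAt_of_smooth hP.1)
      (differentiableAt_of_smooth hQ.1), Matrix.det_mul, sign_real_mul, hPa, hQa]
  · simp only [AdaptedChange.comp, Matrix.det_mul, sign_real_mul, hPb, hQb]
  · rw [jetAt_congr (AdaptedChange.pull_comp hP hQ τ)]
    refine hQj _ ?_ (hPj τ hτ hj)
    rw [← e1]
    refine P.contDiffAt_pull hP ?_
    rw [e1, e2]
    exact hτ

/-- By `jetAt_pull_congr` a single representative of `θ'` decides the matter. -/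
theorem rel_of_jet {P : AdaptedChange} {θ θ' : Jet2} (hP : P.RegularAt θ.1.1)
    (hx : P.app θ.1 = θ'.1) (hj : jetAt (P.pull (polySec θ')) θ.1 = θ) :
    Rel (Real.sign (P.phiJac θ.1.1).det) (Real.sign P.alpha.det) θ θ' := by
  refine ⟨P, hP, hx, rfl, rfl, fun τ hτ h => ?_⟩
  have e2 : P.phi θ.1.1 = θ'.1.1 := congrArg Prod.fst hx
  rw [← e2] at hτ
  rw [← hj]
  refine jetAt_pull_congr hP hτ (contDiff_polySec θ').contDiffAt ?_
  rw [hx, h, jetAt_polySec]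

/-- The local inverse does it; its two determinants are reciprocal to the original ones, so the
signs do not change. -/
theorem Rel.symm {a b : ℝ} {θ θ' : Jet2} (h : Rel a b θ θ') : Rel a b θ' θ := by
  obtain ⟨P, hP, hPx, hPa, hPb, hPj⟩ := h
  have e1 : P.phi θ.1.1 = θ'.1.1 := congrArg Prod.fst hPx
  obtain ⟨R, hR, hRx, h1, h2, h3⟩ := P.exists_inverse hP
  have hRP : R.phi (P.phi θ.1.1) = θ.1.1 := congrArg Prod.fst (hRx θ.1.2)
  rw [e1] at hR h1 h2
  have hRx' : R.app θ'.1 = θ.1 := by rw [← hPx]; exact hRx θ.1.2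
  have hRP' : R.phi θ'.1.1 = θ.1.1 := by rw [← e1, hRP]
  have hP' : P.RegularAt (R.phi θ'.1.1) := by rw [hRP']; exact hP
  have key : jetAt (R.pull (polySec θ)) θ'.1 = θ' := by
    have s1 : ContDiffAt ℝ ∞ (P.pull (polySec θ')) (R.phi θ'.1.1) :=
      P.contDiffAt_pull hP' (contDiff_polySec θ').contDiffAt
    -- `polySec θ` may be exchanged for the pullback of `polySec θ'` by `P`, which has the same jet.
    -- Pulling this back by `R` is pulling back by `P ∘ R`, which is the identity near the point.
    rw [jetAt_pull_congr hR (contDiff_polySec θ).contDiffAt s1,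
      ← jetAt_congr (AdaptedChange.pull_comp hP' hR _),
      jetAt_congr (AdaptedChange.pull_of_eventually_id h1 h2 h3 _), jetAt_polySec]
    rw [hRx', jetAt_polySec, hPj _ (contDiff_polySec θ').contDiffAt (jetAt_polySec θ')]
  have := rel_of_jet hR hRx' key
  have hdet : (P.phiJac θ.1.1).det * (R.phiJac θ'.1.1).det = 1 := by
    have := P.phiJac_comp (Q := R) (t := θ'.1.1) (differentiableAt_of_smooth hP'.1)
      (differentiableAt_of_smooth hR.1)
    rw [hRP'] at this
    rw [← Matrix.det_mul, ← this]
    have : (P.comp R).phiJac θ'.1.1 = 1 := by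
      ext k i
      simp only [AdaptedChange.phiJac, Matrix.of_apply]
      rw [pd_congr h1]
      simp [pd, Matrix.one_apply, Pi.single_apply]
    simp [this]
  have hdet2 : P.alpha.det * R.alpha.det = 1 := by rw [← Matrix.det_mul, h3]; simp
  rwa [eq_inv_of_mul_eq_one_right hdet, eq_inv_of_mul_eq_one_right hdet2, Real.sign_inv,
    Real.sign_inv, hPa, hPb] at this

/-- The form in which invariance is used from here on, free of sections. -/
theorem TransformsWith.rel {m n : ℕ} {F : Jet2 → ℝ} {D : Set Jet2} (hF : TransformsWith m n F D)
    {a b : ℝ} {θ θ' : Jet2} (h : Rel a b θ θ') (hθ : θ ∈ D) (hθ' : θ' ∈ D) :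
    F θ' = a ^ m * b ^ n * F θ := by
  obtain ⟨P, hP, hPx, hPa, hPb, hPj⟩ := h
  have e1 : P.phi θ.1.1 = θ'.1.1 := congrArg Prod.fst hPx
  have hj := hPj _ (contDiff_polySec θ').contDiffAt (jetAt_polySec θ')
  have := hF P (P.pull (polySec θ')) (polySec θ') θ.1 hP
    (P.contDiffAt_pull hP (contDiff_polySec θ').contDiffAt) (contDiff_polySec θ').contDiffAt
    (P.carries_pull hP.2.2.2 _ _) (by rwa [hj]) (by rwa [hPx, jetAt_polySec])
  rwa [hj, hPx, jetAt_polySec, hPa, hPb] at this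

/-! ### Smooth dependence of the transported jet on the jet. -/

theorem contDiff_jcomp (J : Fin 2 → Fin 2 → ScalarJet) : ContDiff ℝ ∞ fun a => jcomp a J := by
  unfold jcomp; fun_prop

theorem contDiff_jmul_left (a : ScalarJet) : ContDiff ℝ ∞ fun b => jmul a b := by
  unfold jmul; fun_prop

theorem contDiff_jmul_right (a : ScalarJet) : ContDiff ℝ ∞ fun b => jmul b a := by
  unfold jmul; fun_prop

theorem contDiff_compJet (c : Fib →L[ℝ] ℝ) : ContDiff ℝ ∞ (compJet c) := by
  unfold compJet; fun_prop

theorem contDiff_of_compJet {E : Type*} [NormedAddCommGroup E] [NormedSpace ℝ E] {f : E → Jet2}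
    (h0 : ContDiff ℝ ∞ fun e => (f e).1)
    (hg : ∀ i j, ContDiff ℝ ∞ fun e => compJet (compG (symIdx i j)) (f e))
    (hf : ∀ i k, ContDiff ℝ ∞ fun e => compJet (compF i k) (f e))
    (hh : ∀ i j, ContDiff ℝ ∞ fun e => compJet (compH (symIdx i j)) (f e)) : ContDiff ℝ ∞ f := by
  have p0 : ∀ {g : E → ScalarJet}, ContDiff ℝ ∞ g → ContDiff ℝ ∞ fun e => (g e).1 :=
    fun hg => contDiff_fst.comp hg
  have p1 : ∀ {g : E → ScalarJet} (i), ContDiff ℝ ∞ g → ContDiff ℝ ∞ fun e => (g e).2.1 i :=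
    fun i hg => contDiff_pi.1 (contDiff_fst.comp (contDiff_snd.comp hg)) i
  have p2 : ∀ {g : E → ScalarJet} (i j), ContDiff ℝ ∞ g → ContDiff ℝ ∞ fun e => (g e).2.2 i j :=
    fun i j hg => contDiff_pi.1 (contDiff_pi.1 (contDiff_snd.comp (contDiff_snd.comp hg)) i) j
  have fib : ∀ {g : E → Fib}, (∀ i j, ContDiff ℝ ∞ fun e => compG (symIdx i j) (g e)) →
      (∀ i k, ContDiff ℝ ∞ fun e => compF i k (g e)) →
      (∀ i j, ContDiff ℝ ∞ fun e => compH (symIdx i j) (g e)) → ContDiff ℝ ∞ g := by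
    intro g h1 h2 h3
    refine ContDiff.prodMk (f := fun s => (g s).1) (g := fun s => (g s).2) ?_
      (ContDiff.prodMk (f := fun s => (g s).2.1) (g := fun s => (g s).2.2) ?_ ?_)
    · refine contDiff_pi.2 fun m => ?_
      obtain ⟨i, j, rfl⟩ := exists_symIdx m
      exact h1 i j
    · exact contDiff_pi.2 fun i => contDiff_pi.2 fun k => h2 i k
    · refine contDiff_pi.2 fun m => ?_
      obtain ⟨i, j, rfl⟩ := exists_symIdx m
      exact h3 i j
  refine ContDiff.prodMk (f := fun e => (f e).1) (g := fun e => (f e).2) h0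
    (ContDiff.prodMk (f := fun e => (f e).2.1) (g := fun e => (f e).2.2) ?_
      (ContDiff.prodMk (f := fun e => (f e).2.2.1) (g := fun e => (f e).2.2.2) ?_ ?_))
  · exact fib (fun i j => p0 (hg i j)) (fun i j => p0 (hf i j)) fun i j => p0 (hh i j)
  · exact contDiff_pi.2 fun l => fib (fun i j => p1 l (hg i j)) (fun i j => p1 l (hf i j))
      fun i j => p1 l (hh i j)
  · refine contDiff_pi.2 fun m => ?_
    obtain ⟨k, l, rfl⟩ := exists_symIdx m
    exact fib (fun i j => p2 k l (hg i j)) (fun i j => p2 k l (hf i j)) fun i j => p2 k l (hh i j)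

/-- An equivalence between `θ` and `η` transports the jets at the base point of `η` smoothly to
jets at the base point of `θ`. -/
theorem Rel.exists_transport {a b : ℝ} {θ η : Jet2} (h : Rel a b θ η) :
    ∃ T : Jet2 → Jet2, ContDiff ℝ ∞ T ∧ T η = θ ∧ ∀ η', η'.1 = η.1 → Rel a b (T η') η' := by
  obtain ⟨P, hP, hPx, hPa, hPb, hPj⟩ := h
  have e1 : P.phi θ.1.1 = η.1.1 := congrArg Prod.fst hPx
  have hs : ∀ η', ContDiffAt ℝ ∞ (polySec η') (P.phi θ.1.1) := fun η' =>
    (contDiff_polySec η').contDiffAt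
  -- only the fibre coordinates of the argument matter
  have hbase : ∀ η' : Jet2, jetAt (polySec (η.1, η'.2)) (P.app θ.1) = (η.1, η'.2) := by
    intro η'
    rw [hPx]
    exact jetAt_polySec (η.1, η'.2)
  have hcomp : ∀ c (η' : Jet2), compJet c (jetAt (polySec (η.1, η'.2)) (P.app θ.1)) =
      compJet c η' := fun c η' => by rw [hbase]; rfl
  -- Overwriting the base point of the argument by that of `η` makes the map defined and smooth on
  -- the whole jet space; it is meaningful only over that base point.
  refine ⟨fun η' => jetAt (P.pull (polySec (η.1, η'.2))) θ.1, ?_, ?_, fun η' h' => ?_⟩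
  · refine contDiff_of_compJet contDiff_const (fun i j => ?_) (fun i k => ?_) fun i j => ?_
    · simp only [compJet_pull_G hP (hs _), hcomp]
      exact ContDiff.sum fun k _ => ContDiff.sum fun l _ => (contDiff_jmul_right _).comp
        ((contDiff_jmul_left _).comp ((contDiff_jcomp _).comp (contDiff_compJet _)))
    · simp only [compJet_pull_F hP (hs _), hcomp]
      exact ContDiff.sum fun k _ => ContDiff.const_smul _ ((ContDiff.sum fun l _ =>
        (contDiff_jmul_left _).comp ((contDiff_jcomp _).comp (contDiff_compJet _))).add
          contDiff_const)
    · simp only [compJet_pull_H hP (hs _), hcomp]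
      exact ContDiff.sum fun k _ => ContDiff.sum fun l _ => ContDiff.const_smul _
        ((contDiff_jcomp _).comp (contDiff_compJet _))
  · exact hPj _ (contDiff_polySec _).contDiffAt (jetAt_polySec η)
  · have e : ((η.1, η'.2) : Jet2) = η' := by rw [← h']
    simp only [e]
    have hx : P.app θ.1 = η'.1 := by rw [hPx, h']
    have := rel_of_jet (P := P) (θ := jetAt (P.pull (polySec η')) θ.1) (θ' := η') hP hx rfl
    rw [← hPa, ← hPb]
    exact this

/-! ### Smoothness of the coefficients of the field equations -/

section Smooth

variable {E : Type*} [NormedAddCommGroup E] [NormedSpace ℝ E]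

theorem contDiffAt_matrix_det {ι : Type*} [Fintype ι] [DecidableEq ι] {n : WithTop ℕ∞}
    {A : E → Matrix ι ι ℝ} {x : E} (hA : ∀ i j, ContDiffAt ℝ n (fun y => A y i j) x) :
    ContDiffAt ℝ n (fun y => (A y).det) x := by
  simp only [Matrix.det_apply']
  exact ContDiffAt.sum fun σ _ => contDiffAt_const.mul (contDiffAt_prod fun i _ => hA _ _)

/-- Cramer's rule: the entries are minors divided by the determinant. -/
theorem contDiffAt_matrix_inv {ι : Type*} [Fintype ι] [DecidableEq ι] {n : WithTop ℕ∞}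
    {A : E → Matrix ι ι ℝ} {x : E} (hA : ∀ i j, ContDiffAt ℝ n (fun y => A y i j) x)
    (hd : (A x).det ≠ 0) (i j : ι) : ContDiffAt ℝ n (fun y => (A y)⁻¹ i j) x := by
  simp only [Matrix.inv_def, Matrix.smul_apply, Matrix.adjugate_apply, Ring.inverse_eq_inv',
    smul_eq_mul]
  refine ((contDiffAt_matrix_det hA).inv hd).mul (contDiffAt_matrix_det fun k l => ?_)
  by_cases h : k = j
  · subst h
    simp only [Matrix.updateRow_self]
    exact contDiffAt_const
  · simp only [Matrix.updateRow_ne h]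
    exact hA k l

end Smooth

theorem contDiff_orbitMat (i j : Fin 2) : ContDiff ℝ ∞ fun u => orbitMat u i j :=
  (compG (symIdx i j)).contDiff

theorem contDiff_shiftMat (i j : Fin 2) : ContDiff ℝ ∞ fun u => shiftMat u i j :=
  (compF i j).contDiff

theorem contDiff_killMat (i j : Fin 2) : ContDiff ℝ ∞ fun u => killMat u i j :=
  (compH (symIdx i j)).contDiff

theorem contDiff_metricMat (a b : Idx) : ContDiff ℝ ∞ fun u => metricMat u a b := by
  have hg := contDiff_orbitMat
  have hf := contDiff_shiftMat
  have hh := contDiff_killMat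
  rcases a with i | i <;> rcases b with j | j <;>
    simp only [metricMat, Matrix.fromBlocks_apply₁₁, Matrix.fromBlocks_apply₁₂,
      Matrix.fromBlocks_apply₂₁, Matrix.fromBlocks_apply₂₂, Matrix.add_apply, Matrix.mul_apply,
      Matrix.transpose_apply]
  · exact (hg i j).add (ContDiff.sum fun k _ => (ContDiff.sum fun l _ => (hf i l).mul (hh l k)).mul
      (hf j k))
  · exact ContDiff.sum fun k _ => (hf _ _).mul (hh _ _)
  · exact ContDiff.sum fun k _ => (hh _ _).mul (hf _ _)
  · exact hh i j

/-- A unipotent change of frame, with the shifts as its off-diagonal block, makes the metric block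
diagonal. -/
theorem det_metricMat (u : Fib) : (metricMat u).det = (orbitMat u).det * (killMat u).det := by
  have h : FibreLaw 1 (shiftMat u)ᵀ 1 u (u.1, 0, u.2.2) := by
    refine ⟨by simp; rfl, ?_, by simp; rfl⟩
    have : shiftMat (u.1, 0, u.2.2) = 0 := rfl
    simp [this]
  rw [h.metricMat_eq, Matrix.det_mul, Matrix.det_mul, Matrix.det_transpose,
    Matrix.det_fromBlocks_zero₁₂]
  have : metricMat (u.1, 0, u.2.2) = Matrix.fromBlocks (orbitMat u) 0 0 (killMat u) := by
    have : shiftMat (u.1, 0, u.2.2) = 0 := rfl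
    simp only [metricMat, this]
    simp
    exact ⟨rfl, rfl⟩
  rw [this, Matrix.det_fromBlocks_zero₁₂]
  simp

theorem metricMat_transpose (u : Fib) : (metricMat u)ᵀ = metricMat u := by
  simp [metricMat, Matrix.fromBlocks_transpose, orbitMat_transpose, killMat_transpose,
    Matrix.transpose_mul, Matrix.mul_assoc]

theorem contDiff_fibCoord : ContDiff ℝ ∞ fun θ : Jet2 => θ.2.1 := by fun_prop

theorem contDiff_metric (a b : Idx) : ContDiff ℝ ∞ (metric a b) :=
  (contDiff_metricMat a b).comp contDiff_fibCoord

theorem contDiffAt_christoffel {θ : Jet2} (hθ : θ ∈ metricJets) (c a b : Idx) :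
    ContDiffAt ℝ ∞ (christoffel c a b) θ := by
  have hm : ∀ a b, ContDiffAt ℝ ∞ (metric a b) θ := fun a b => (contDiff_metric a b).contDiffAt
  have hd : (metricMat θ.2.1).det ≠ 0 := by
    rw [det_metricMat]; exact mul_ne_zero hθ.1 hθ.2
  exact contDiffAt_const.mul (ContDiffAt.sum fun d _ =>
    (contDiffAt_matrix_inv (A := fun θ : Jet2 => metricMat θ.2.1) hm hd c d).mul
      (((contDiffAt_totalD (hm _ _) _).add (contDiffAt_totalD (hm _ _) _)).sub
        (contDiffAt_totalD (hm _ _) _)))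

theorem isOpen_metricJets : IsOpen metricJets := by
  have h1 : Continuous fun θ : Jet2 => (orbitMat θ.2.1).det :=
    continuous_iff_continuousAt.2 fun θ => (contDiffAt_matrix_det (n := 0) fun i j =>
      (((contDiff_orbitMat i j).comp contDiff_fibCoord).of_le (by simp)).contDiffAt).continuousAt
  have h2 : Continuous fun θ : Jet2 => (killMat θ.2.1).det :=
    continuous_killDet.comp contDiff_fibCoord.continuous
  exact (isOpen_ne_fun h1 continuous_const).inter (isOpen_ne_fun h2 continuous_const)

theorem totalD_of_fib {f : Fib → ℝ} {θ : Jet2} (hf : DifferentiableAt ℝ f θ.2.1) (i : Fin 2) :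
    totalD (Sum.inl i) (fun η => f η.2.1) θ = fderiv ℝ f θ.2.1 (θ.2.2.1 i) := by
  have h : HasFDerivAt (fun η : Jet2 => f η.2.1) ((fderiv ℝ f θ.2.1).comp
      ((ContinuousLinearMap.fst ℝ Fib _).comp (ContinuousLinearMap.snd ℝ Base _))) θ :=
    HasFDerivAt.comp (g := f) (f := fun η : Jet2 => η.2.1) θ hf.hasFDerivAt
      ((ContinuousLinearMap.fst ℝ Fib ((Fin 2 → Fib) × (Fin 3 → Fib))).comp
        (ContinuousLinearMap.snd ℝ Base _)).hasFDerivAt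
  rw [totalD, h.fderiv]
  rfl

theorem totalD_of_fib_inr {f : Fib → ℝ} {θ : Jet2} (hf : DifferentiableAt ℝ f θ.2.1) (k : Fin 2) :
    totalD (Sum.inr k) (fun η => f η.2.1) θ = 0 := by
  have : DifferentiableAt ℝ (fun η : Jet2 => f η.2.1) θ :=
    DifferentiableAt.comp (g := f) (f := fun η : Jet2 => η.2.1) θ hf
      (differentiableAt_of_smooth contDiff_fibCoord.contDiffAt)
  exact totalD_inr (fun θ x w => rfl) this k

theorem firstOrder_totalD {f : Fib → ℝ} (hf : Differentiable ℝ f) (a : Idx) :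
    FirstOrder (totalD a fun η => f η.2.1) := by
  intro θ x w
  rcases a with i | k
  · rw [totalD_of_fib (hf _), totalD_of_fib (hf _)]
  · rw [totalD_of_fib_inr (hf _), totalD_of_fib_inr (hf _)]

theorem firstOrder_christoffel (c a b : Idx) : FirstOrder (christoffel c a b) := by
  intro θ x w
  have h := fun e a b => firstOrder_totalD
    ((contDiff_metricMat a b).differentiable (by simp)) e θ x w
  have h' : ∀ e a b, totalD e (metric a b) (x, θ.2.1, θ.2.2.1, w) = totalD e (metric a b) θ := h
  simp only [christoffel, h']

/-! ### The Ricci tensor of a metric depending on two coordinates -/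

/-- The partial derivative with respect to one of the four coordinates. -/
def coordD (a : Idx) (w : Plane → ℝ) (t : Plane) : ℝ :=
  match a with
  | Sum.inl i => pd i w t
  | Sum.inr _ => 0

/-- The Christoffel symbols of a matrix-valued function. -/
def chrSym (G : Plane → Matrix Idx Idx ℝ) (c a b : Idx) (s : Plane) : ℝ :=
  (1 / 2) * ∑ d, (G s)⁻¹ c d *
    (coordD a (fun r => G r d b) s + coordD b (fun r => G r a d) s - coordD d (fun r => G r a b) s)

/-- The Ricci tensor of a matrix-valued function. -/
def ricciMat (G : Plane → Matrix Idx Idx ℝ) (s : Plane) : Matrix Idx Idx ℝ :=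
  Matrix.of fun a b => (∑ c, (coordD c (chrSym G c a b) s - coordD b (chrSym G c a c) s)) +
    ∑ c, ∑ d, (chrSym G c c d s * chrSym G d a b s - chrSym G c b d s * chrSym G d a c s)

theorem totalD_eq_coordD {F : Jet2 → ℝ} (hF : FirstOrder F) {σ : Plane → Fib} {x : Base}
    (hσ : ContDiffAt ℝ 3 σ x.1) (hd : DifferentiableAt ℝ F (jetAt σ x)) (a : Idx) :
    totalD a F (jetAt σ x) = coordD a (fun t => F (jetAt σ (t, x.2))) x.1 := by
  rcases a with i | k
  · exact totalD_jetAt hF hσ hd i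
  · exact totalD_inr hF hd k

theorem christoffel_jetAt {σ : Plane → Fib} {x : Base} (hσ : ContDiffAt ℝ 3 σ x.1) (c a b : Idx) :
    christoffel c a b (jetAt σ x) = chrSym (fun s => metricMat (σ s)) c a b x.1 := by
  have h : ∀ e a b, totalD e (metric a b) (jetAt σ x) =
      coordD e (fun r => metricMat (σ r) a b) x.1 := fun e a b =>
    totalD_eq_coordD (fun _ _ _ => rfl) hσ
      (differentiableAt_of_smooth (contDiff_metric a b).contDiffAt) e
  simp only [christoffel, chrSym, h]
  rfl

theorem coordD_congr {w v : Plane → ℝ} {t : Plane} (h : w =ᶠ[𝓝 t] v) (a : Idx) :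
    coordD a w t = coordD a v t := by
  rcases a with i | k
  · exact pd_congr h i
  · rfl

/-- Christoffel symbols are first-order functions, so their total derivatives are honest derivatives
along the section. Tensoriality can then be proved for matrix functions on the plane. -/
theorem ricci_jetAt {σ : Plane → Fib} {x : Base} (hσ : ContDiffAt ℝ ∞ σ x.1)
    (hx : jetAt σ x ∈ metricJets) (a b : Idx) :
    ricci a b (jetAt σ x) = ricciMat (fun s => metricMat (σ s)) x.1 a b := by
  have h3 : ∀ᶠ s in 𝓝 x.1, ContDiffAt ℝ 3 σ s := eventually_contDiffAt hσ 3
  have h0 := fun c a b => christoffel_jetAt h3.self_of_nhds c a b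
  have h : ∀ e c a b, totalD e (christoffel c a b) (jetAt σ x) =
      coordD e (chrSym (fun s => metricMat (σ s)) c a b) x.1 := by
    intro e c a b
    rw [totalD_eq_coordD (firstOrder_christoffel c a b) h3.self_of_nhds
      (differentiableAt_of_smooth (contDiffAt_christoffel hx c a b))]
    refine coordD_congr ?_ e
    filter_upwards [h3] with s hs
    exact christoffel_jetAt (x := (s, x.2)) hs c a b
  simp only [ricci, ricciMat, h, h0, Matrix.of_apply]

/-! ### Tensoriality of the Ricci tensor -/

/-- The entrywise coordinate derivative of a matrix-valued function. -/
def matD (a : Idx) (M : Plane → Matrix Idx Idx ℝ) (s : Plane) : Matrix Idx Idx ℝ :=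
  Matrix.of fun c b => coordD a (fun r => M r c b) s

/-- Entrywise differentiability. -/
def MatDiff (M : Plane → Matrix Idx Idx ℝ) (s : Plane) : Prop :=
  ∀ c b, DifferentiableAt ℝ (fun r => M r c b) s

theorem matD_congr {M N : Plane → Matrix Idx Idx ℝ} {t : Plane} (h : M =ᶠ[𝓝 t] N) (a : Idx) :
    matD a M t = matD a N t := by
  ext c b
  exact coordD_congr (h.mono fun s hs => by simp only [hs]) a

theorem coordD_add {w v : Plane → ℝ} {t : Plane} (hw : DifferentiableAt ℝ w t)
    (hv : DifferentiableAt ℝ v t) (a : Idx) :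
    coordD a (fun s => w s + v s) t = coordD a w t + coordD a v t := by
  rcases a with i | k
  · exact pd_add hw hv i
  · simp [coordD]

theorem coordD_mul {w v : Plane → ℝ} {t : Plane} (hw : DifferentiableAt ℝ w t)
    (hv : DifferentiableAt ℝ v t) (a : Idx) :
    coordD a (fun s => w s * v s) t = coordD a w t * v t + w t * coordD a v t := by
  rcases a with i | k
  · exact pd_mul hw hv i
  · simp [coordD]

theorem coordD_sum {ι : Type*} (u : Finset ι) {w : ι → Plane → ℝ} {t : Plane}
    (hw : ∀ k ∈ u, DifferentiableAt ℝ (w k) t) (a : Idx) :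
    coordD a (fun s => ∑ k ∈ u, w k s) t = ∑ k ∈ u, coordD a (w k) t := by
  rcases a with i | k
  · exact pd_sum u hw i
  · simp [coordD]

theorem coordD_comm {w : Plane → ℝ} {t : Plane} (hw : ContDiffAt ℝ 2 w t) (a b : Idx) :
    coordD a (coordD b w) t = coordD b (coordD a w) t := by
  have h0 : ∀ k : Fin 2, coordD (Sum.inr k) w = fun _ => 0 := fun k => rfl
  have h1 : ∀ i : Fin 2, coordD (Sum.inl i) w = pd i w := fun i => rfl
  rcases a with i | k <;> rcases b with j | l
  · exact pd_comm hw i j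
  · simp only [h0, coordD, pd_const]
  · simp only [h0, coordD, pd_const]
  · rfl

/-- For an index of z type both sides vanish: nothing depends on z, and the corresponding block of
the Jacobian matrix is zero. -/
theorem coordD_comp {P : AdaptedChange} {s : Plane} (hP : DifferentiableAt ℝ P.phi s)
    {w : Plane → ℝ} (hw : DifferentiableAt ℝ w (P.phi s)) (a : Idx) :
    coordD a (fun r => w (P.phi r)) s = ∑ b, P.jac s b a * coordD b w (P.phi s) := by
  rcases a with i | k
  · refine (pd_comp hw hP i).trans ?_
    simp [Fintype.sum_sum_type, AdaptedChange.jac, AdaptedChange.phiJac, coordD]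
  · simp [Fintype.sum_sum_type, AdaptedChange.jac, coordD]

theorem MatDiff.mul {M N : Plane → Matrix Idx Idx ℝ} {s : Plane} (hM : MatDiff M s)
    (hN : MatDiff N s) : MatDiff (fun r => M r * N r) s := by
  intro c b
  simp only [Matrix.mul_apply]
  exact DifferentiableAt.fun_sum fun d _ => (hM c d).fun_mul (hN d b)

theorem MatDiff.transpose {M : Plane → Matrix Idx Idx ℝ} {s : Plane} (hM : MatDiff M s) :
    MatDiff (fun r => (M r)ᵀ) s := fun c b => hM b c

theorem MatDiff.smul {f : Plane → ℝ} {M : Plane → Matrix Idx Idx ℝ} {s : Plane}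
    (hf : DifferentiableAt ℝ f s) (hM : MatDiff M s) : MatDiff (fun r => f r • M r) s :=
  fun c b => hf.fun_mul (hM c b)

theorem MatDiff.sum {M : Idx → Plane → Matrix Idx Idx ℝ} {s : Plane}
    (hM : ∀ d, MatDiff (M d) s) : MatDiff (fun r => ∑ d, M d r) s := by
  intro c b
  simp only [Matrix.sum_apply]
  exact DifferentiableAt.fun_sum fun d _ => hM d c b

theorem MatDiff.comp {P : AdaptedChange} {M : Plane → Matrix Idx Idx ℝ} {s : Plane}
    (hM : MatDiff M (P.phi s)) (hP : DifferentiableAt ℝ P.phi s) :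
    MatDiff (fun r => M (P.phi r)) s :=
  fun c b => DifferentiableAt.comp (g := fun r => M r c b) s (hM c b) hP

theorem matD_mul {M N : Plane → Matrix Idx Idx ℝ} {s : Plane} (hM : MatDiff M s)
    (hN : MatDiff N s) (a : Idx) :
    matD a (fun r => M r * N r) s = matD a M s * N s + M s * matD a N s := by
  ext c b
  simp only [matD, Matrix.of_apply, Matrix.mul_apply, Matrix.add_apply]
  rw [coordD_sum _ fun d _ => (hM c d).fun_mul (hN d b), ← Finset.sum_add_distrib]
  exact Finset.sum_congr rfl fun d _ => coordD_mul (hM c d) (hN d b) a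

theorem matD_add {M N : Plane → Matrix Idx Idx ℝ} {s : Plane} (hM : MatDiff M s)
    (hN : MatDiff N s) (a : Idx) :
    matD a (fun r => M r + N r) s = matD a M s + matD a N s := by
  ext c b
  exact coordD_add (hM c b) (hN c b) a

theorem matD_smul {f : Plane → ℝ} {M : Plane → Matrix Idx Idx ℝ} {s : Plane}
    (hf : DifferentiableAt ℝ f s) (hM : MatDiff M s) (a : Idx) :
    matD a (fun r => f r • M r) s = coordD a f s • M s + f s • matD a M s := by
  ext c b
  exact coordD_mul hf (hM c b) a

theorem matD_sum {M : Idx → Plane → Matrix Idx Idx ℝ} {s : Plane}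
    (hM : ∀ d, MatDiff (M d) s) (a : Idx) :
    matD a (fun r => ∑ d, M d r) s = ∑ d, matD a (M d) s := by
  ext c b
  simp only [matD, Matrix.of_apply, Matrix.sum_apply]
  exact coordD_sum _ (fun d _ => hM d c b) a

theorem matD_comp {P : AdaptedChange} {M : Plane → Matrix Idx Idx ℝ} {s : Plane}
    (hM : MatDiff M (P.phi s)) (hP : DifferentiableAt ℝ P.phi s) (a : Idx) :
    matD a (fun r => M (P.phi r)) s = ∑ b, P.jac s b a • matD b M (P.phi s) := by
  ext c b
  simp only [matD, Matrix.of_apply, Matrix.sum_apply, Matrix.smul_apply, smul_eq_mul]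
  exact coordD_comp hP (hM c b) a

theorem matD_transpose (M : Plane → Matrix Idx Idx ℝ) (s : Plane) (a : Idx) :
    matD a (fun r => (M r)ᵀ) s = (matD a M s)ᵀ := rfl

/-- The connection matrices. -/
def connMat (G : Plane → Matrix Idx Idx ℝ) (a : Idx) (s : Plane) : Matrix Idx Idx ℝ :=
  Matrix.of fun c b => chrSym G c a b s

/-- The connection matrices with lowered first index. -/
def lowConn (G : Plane → Matrix Idx Idx ℝ) (a : Idx) (s : Plane) : Matrix Idx Idx ℝ :=
  Matrix.of fun e b => (1 / 2) * (matD a G s e b + matD b G s a e - matD e G s a b)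

theorem connMat_eq (G : Plane → Matrix Idx Idx ℝ) (a : Idx) (s : Plane) :
    connMat G a s = (G s)⁻¹ * lowConn G a s := by
  ext c b
  simp only [connMat, lowConn, chrSym, Matrix.of_apply, Matrix.mul_apply, Finset.mul_sum, matD]
  refine Finset.sum_congr rfl fun d _ => ?_
  ring

/-- The curvature matrices. -/
def curvMat (G : Plane → Matrix Idx Idx ℝ) (a b : Idx) (s : Plane) : Matrix Idx Idx ℝ :=
  matD a (connMat G b) s - matD b (connMat G a) s + connMat G a s * connMat G b s -
    connMat G b s * connMat G a s

theorem chrSym_symm {G : Plane → Matrix Idx Idx ℝ} (hG : ∀ s, (G s)ᵀ = G s) (c a b : Idx) :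
    chrSym G c a b = chrSym G c b a := by
  have h : ∀ a b, (fun r => G r a b) = fun r => G r b a := fun a b =>
    funext fun r => (congrFun (congrFun (hG r) b) a : _)
  funext s
  simp only [chrSym]
  congr 1
  refine Finset.sum_congr rfl fun d _ => ?_
  rw [h d b, h a d, h a b]
  ring

theorem ricciMat_eq_curvMat {G : Plane → Matrix Idx Idx ℝ} (hG : ∀ s, (G s)ᵀ = G s) (a b : Idx)
    (s : Plane) : ricciMat G s a b = ∑ c, curvMat G c b s c a := by
  simp only [ricciMat, curvMat, connMat, matD, Matrix.of_apply, Matrix.add_apply, Matrix.sub_apply,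
    Matrix.mul_apply, chrSym_symm hG _ a, ← Finset.sum_add_distrib]
  refine Finset.sum_congr rfl fun c _ => ?_
  rw [add_sub_assoc, ← Finset.sum_sub_distrib]

theorem AdaptedChange.matDiff_jac {P : AdaptedChange} {s : Plane} (h1 : ContDiffAt ℝ 2 P.phi s)
    (h2 : ContDiffAt ℝ 2 P.psi s) : MatDiff P.jac s := by
  have hp : ∀ {w : Plane → Plane}, ContDiffAt ℝ 2 w s → ∀ i k,
      DifferentiableAt ℝ (fun r => pd i w r k) s := fun hw i k =>
    differentiableAt_pi.1 ((((hw.fderiv_right (m := 1) (by norm_num)).clm_apply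
      contDiffAt_const).differentiableAt (by simp) : DifferentiableAt ℝ (pd i _) s)) k
  intro c b
  rcases c with i | i <;> rcases b with j | j
  · exact hp h1 j i
  · exact differentiableAt_const _
  · exact hp h2 j i
  · exact differentiableAt_const _

theorem AdaptedChange.matD_jac_symm {P : AdaptedChange} {s : Plane} (h1 : ContDiffAt ℝ 2 P.phi s)
    (h2 : ContDiffAt ℝ 2 P.psi s) (a b c : Idx) :
    matD a P.jac s c b = matD b P.jac s c a := by
  have hp : ∀ {w : Plane → Plane}, ContDiffAt ℝ 2 w s → ∀ i j k,
      pd i (fun r => pd j w r k) s = pd j (fun r => pd i w r k) s := by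
    intro w hw i j k
    have hd : ∀ j, DifferentiableAt ℝ (pd j w) s := fun j =>
      ((hw.fderiv_right (m := 1) (by norm_num)).clm_apply contDiffAt_const).differentiableAt
        (by simp)
    rw [← pd_apply (hd j), ← pd_apply (hd i), pd_comm hw]
  rcases a with i | i <;> rcases b with j | j <;> rcases c with k | k
  · exact hp h1 i j k
  · exact hp h2 i j k
  all_goals simp [matD, coordD, AdaptedChange.jac]

theorem triple_sum_apply (J : Matrix Idx Idx ℝ) (M : Idx → Matrix Idx Idx ℝ) (a e b : Idx) :
    (Jᵀ * (∑ a', J a' a • M a') * J) e b =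
      ∑ x, ∑ y, ∑ z, J x a * J y e * J z b * M x y z := by
  simp only [Matrix.sum_apply, Matrix.smul_apply, Matrix.mul_apply, Finset.sum_mul, Finset.mul_sum,
    Matrix.transpose_apply, smul_eq_mul]
  calc _ = ∑ z, ∑ x, ∑ y, J x a * J y e * J z b * M x y z :=
        Finset.sum_congr rfl fun z _ => Finset.sum_congr rfl fun x _ =>
          Finset.sum_congr rfl fun y _ => by ring
    _ = ∑ x, ∑ z, ∑ y, J x a * J y e * J z b * M x y z := Finset.sum_comm
    _ = _ := Finset.sum_congr rfl fun x _ => Finset.sum_comm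

/-- Each `D` contributes two terms containing `dJ`. By the symmetry `hs`, four of the six cancel in
the alternating combination and the other two coincide, giving `Jᵀ * g * dJ a`. The `dG` terms agree
after renaming summation indices (`s1`, `s2`). -/
theorem lowConn_algebra {J g : Matrix Idx Idx ℝ} {dJ dG D : Idx → Matrix Idx Idx ℝ} (hg : gᵀ = g)
    (hs : ∀ a b c, dJ a c b = dJ b c a)
    (hD : ∀ a, D a = (dJ a)ᵀ * g * J + Jᵀ * (∑ a', J a' a • dG a') * J + Jᵀ * g * dJ a)
    (e b a : Idx) :
    (1 / 2) * (D a e b + D b a e - D e a b) = (Jᵀ * (∑ a', J a' a •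
      Matrix.of fun e b => (1 / 2) * (dG a' e b + dG b a' e - dG e a' b)) * J + Jᵀ * g * dJ a) e b := by
  have hU : ∀ a e b, ((dJ a)ᵀ * g * J) e b = (Jᵀ * g * dJ a) b e := by
    intro a e b
    have : (dJ a)ᵀ * g * J = (Jᵀ * g * dJ a)ᵀ := by
      simp [Matrix.transpose_mul, hg, Matrix.mul_assoc]
    rw [this]; rfl
  have hU2 : ∀ e a b, (Jᵀ * g * dJ a) e b = (Jᵀ * g * dJ b) e a := by
    intro e a b
    simp only [Matrix.mul_apply (M := Jᵀ * g), hs a b]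
  have hD' : ∀ a e b, D a e b = (Jᵀ * g * dJ a) b e +
      (∑ x, ∑ y, ∑ z, J x a * J y e * J z b * dG x y z) + (Jᵀ * g * dJ a) e b := by
    intro a e b
    rw [hD, Matrix.add_apply, Matrix.add_apply, triple_sum_apply, hU]
  have s1 : ∑ x, ∑ y, ∑ z, J x b * J y a * J z e * dG x y z =
      ∑ x, ∑ y, ∑ z, J x a * J y e * J z b * dG z x y := by
    calc _ = ∑ z, ∑ x, ∑ y, J x a * J y e * J z b * dG z x y :=
          Finset.sum_congr rfl fun z _ => Finset.sum_congr rfl fun y _ =>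
            Finset.sum_congr rfl fun x _ => by ring
      _ = ∑ x, ∑ z, ∑ y, J x a * J y e * J z b * dG z x y := Finset.sum_comm
      _ = _ := Finset.sum_congr rfl fun x _ => Finset.sum_comm
  have s2 : ∑ x, ∑ y, ∑ z, J x e * J y a * J z b * dG x y z =
      ∑ x, ∑ y, ∑ z, J x a * J y e * J z b * dG y x z := by
    rw [Finset.sum_comm]
    refine Finset.sum_congr rfl fun x _ => Finset.sum_congr rfl fun y _ =>
      Finset.sum_congr rfl fun z _ => ?_
    ring
  have s3 : ∑ x, ∑ y, ∑ z, J x a * J y e * J z b *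
      ((1 / 2) * (dG x y z + dG z x y - dG y x z)) =
      (1 / 2) * (∑ x, ∑ y, ∑ z, J x a * J y e * J z b * dG x y z +
        ∑ x, ∑ y, ∑ z, J x a * J y e * J z b * dG z x y -
        ∑ x, ∑ y, ∑ z, J x a * J y e * J z b * dG y x z) := by
    simp only [← Finset.sum_add_distrib, ← Finset.sum_sub_distrib, Finset.mul_sum]
    refine Finset.sum_congr rfl fun x _ => Finset.sum_congr rfl fun y _ =>
      Finset.sum_congr rfl fun z _ => ?_
    ring
  rw [Matrix.add_apply, triple_sum_apply, hD', hD', hD']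
  simp only [Matrix.of_apply]
  rw [s3, s1, s2, hU2 e b a, hU2 b a e, hU2 a b e]
  ring

section Transformation

variable {P : AdaptedChange} {G G' : Plane → Matrix Idx Idx ℝ} {s : Plane}

theorem lowConn_pullback (hG' : ∀ s, (G' s)ᵀ = G' s) (h1 : ContDiffAt ℝ 2 P.phi s)
    (h2 : ContDiffAt ℝ 2 P.psi s) (hd : MatDiff G' (P.phi s))
    (h : G =ᶠ[𝓝 s] fun r => (P.jac r)ᵀ * G' (P.phi r) * P.jac r) (a : Idx) :
    lowConn G a s = (P.jac s)ᵀ * (∑ a', P.jac s a' a • lowConn G' a' (P.phi s)) * P.jac s +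
      (P.jac s)ᵀ * G' (P.phi s) * matD a P.jac s := by
  have hφ : DifferentiableAt ℝ P.phi s := h1.differentiableAt (by simp)
  have hJ := P.matDiff_jac h1 h2
  have hD : ∀ a, matD a G s = (matD a P.jac s)ᵀ * G' (P.phi s) * P.jac s +
      (P.jac s)ᵀ * (∑ a', P.jac s a' a • matD a' G' (P.phi s)) * P.jac s +
      (P.jac s)ᵀ * G' (P.phi s) * matD a P.jac s := by
    intro a
    rw [matD_congr h, matD_mul (hJ.transpose.mul (hd.comp hφ)) hJ,
      matD_mul hJ.transpose (hd.comp hφ), matD_transpose, matD_comp hd hφ]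
    simp only [Matrix.add_mul]
  have hs : ∀ a b c, matD a P.jac s c b = matD b P.jac s c a := P.matD_jac_symm h1 h2
  ext e b
  exact lowConn_algebra (hG' (P.phi s)) hs hD e b a

/-- The inhomogeneous law of the connection, kept in the form J·Γ so that differentiating it
involves no derivative of J⁻¹. -/
theorem connMat_pullback (hG' : ∀ s, (G' s)ᵀ = G' s) (h1 : ContDiffAt ℝ 2 P.phi s)
    (h2 : ContDiffAt ℝ 2 P.psi s) (hd : MatDiff G' (P.phi s))
    (h : G =ᶠ[𝓝 s] fun r => (P.jac r)ᵀ * G' (P.phi r) * P.jac r)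
    (hJ : (P.jac s).det ≠ 0) (hdet : (G' (P.phi s)).det ≠ 0) (a : Idx) :
    P.jac s * connMat G a s =
      (∑ a', P.jac s a' a • connMat G' a' (P.phi s)) * P.jac s + matD a P.jac s := by
  have e1 : ∑ a', P.jac s a' a • connMat G' a' (P.phi s) =
      (G' (P.phi s))⁻¹ * ∑ a', P.jac s a' a • lowConn G' a' (P.phi s) := by
    simp only [connMat_eq, Matrix.mul_sum, Matrix.mul_smul]
  rw [connMat_eq, lowConn_pullback hG' h1 h2 hd h, h.eq_of_nhds, e1, Matrix.mul_inv_rev,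
    Matrix.mul_inv_rev]
  set J := P.jac s
  set g := G' (P.phi s)
  set S := ∑ a', P.jac s a' a • lowConn G' a' (P.phi s)
  have hJ1 : J * J⁻¹ = 1 := Matrix.mul_nonsing_inv _ hJ.isUnit
  have hJ2 : Jᵀ⁻¹ * Jᵀ = 1 :=
    Matrix.nonsing_inv_mul _ (by rw [Matrix.det_transpose]; exact hJ.isUnit)
  have hg1 : g⁻¹ * g = 1 := Matrix.nonsing_inv_mul _ hdet.isUnit
  calc J * (J⁻¹ * (g⁻¹ * Jᵀ⁻¹) * (Jᵀ * S * J + Jᵀ * g * matD a P.jac s))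
      = (J * J⁻¹) * g⁻¹ * (Jᵀ⁻¹ * Jᵀ) * (S * J + g * matD a P.jac s) := by noncomm_ring
    _ = g⁻¹ * S * J + (g⁻¹ * g) * matD a P.jac s := by rw [hJ1, hJ2]; noncomm_ring
    _ = _ := by rw [hg1]; simp

theorem contDiffAt_coordD {w : Plane → ℝ} {t : Plane} (hw : ContDiffAt ℝ ∞ w t) (a : Idx) :
    ContDiffAt ℝ ∞ (coordD a w) t := by
  rcases a with i | k
  · exact contDiffAt_pd hw i
  · exact contDiffAt_const

theorem matDiff_connMat (hG : ∀ c b, ContDiffAt ℝ ∞ (fun r => G r c b) s) (hdet : (G s).det ≠ 0)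
    (a : Idx) : MatDiff (connMat G a) s := by
  intro c b
  refine differentiableAt_of_smooth ?_
  exact contDiffAt_const.mul (ContDiffAt.sum fun d _ => (contDiffAt_matrix_inv hG hdet c d).mul
    (((contDiffAt_coordD (hG _ _) _).add (contDiffAt_coordD (hG _ _) _)).sub
      (contDiffAt_coordD (hG _ _) _)))

/-- Differentiate the law of the connection and antisymmetrize in `a`, `b`. The second derivatives
of J drop out by symmetry, and so do the terms in which ∂J contracts the direction index of Γ'
(`k3`). The remaining products of Γ' and ∂J cancel against the commutator of the connection
matrices. -/
theorem curvMat_pullback (hP : P.RegularAt s) (hG : ∀ c b, ContDiffAt ℝ ∞ (fun r => G r c b) s)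
    (hG' : ∀ s, (G' s)ᵀ = G' s) (hs' : ∀ c b, ContDiffAt ℝ ∞ (fun r => G' r c b) (P.phi s))
    (h : ∀ᶠ r in 𝓝 s, G r = (P.jac r)ᵀ * G' (P.phi r) * P.jac r)
    (hJ : (P.jac s).det ≠ 0) (hdet : (G' (P.phi s)).det ≠ 0) (a b : Idx) :
    P.jac s * curvMat G a b s =
      (∑ a', ∑ b', (P.jac s a' a * P.jac s b' b) • curvMat G' a' b' (P.phi s)) * P.jac s := by
  have e1 : ∀ᶠ r in 𝓝 s, ContDiffAt ℝ 2 P.phi r := eventually_contDiffAt hP.1 2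
  have e2 : ∀ᶠ r in 𝓝 s, ContDiffAt ℝ 2 P.psi r := eventually_contDiffAt hP.2.1 2
  have hφ := differentiableAt_of_smooth hP.1
  have e3 : ∀ᶠ r in 𝓝 s, MatDiff G' (P.phi r) := by
    have : ∀ᶠ r in 𝓝 (P.phi s), MatDiff G' r := by
      simp only [MatDiff, Filter.eventually_all]
      exact fun c b => eventually_differentiableAt (hs' c b)
    exact hP.1.continuousAt.eventually this
  have hJd : MatDiff P.jac s := P.matDiff_jac e1.self_of_nhds e2.self_of_nhds
  have e4 : ∀ᶠ r in 𝓝 s, (P.jac r).det ≠ 0 := by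
    have : ContinuousAt (fun r => (P.jac r).det) s := by
      simp only [Matrix.det_apply']
      exact tendsto_finsetSum _ fun σ _ => tendsto_const_nhds.mul
        (tendsto_finsetProd _ fun i _ => (hJd _ _).continuousAt)
    exact this.eventually_ne hJ
  have e5 : ∀ᶠ r in 𝓝 s, (G' (P.phi r)).det ≠ 0 := by
    have := (contDiffAt_matrix_det hs').continuousAt
    exact hP.1.continuousAt.eventually (this.eventually_ne hdet)
  have hconn : ∀ a, (fun r => P.jac r * connMat G a r) =ᶠ[𝓝 s] fun r =>
      (∑ a', P.jac r a' a • connMat G' a' (P.phi r)) * P.jac r + matD a P.jac r := by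
    intro a
    filter_upwards [e1, e2, e3, e4, e5, h.eventually_nhds] with r h1 h2 h3 h4 h5 h6
    exact connMat_pullback hG' h1 h2 h3 h6 h4 h5 a
  have hGdet : (G s).det ≠ 0 := by
    rw [h.self_of_nhds, Matrix.det_mul, Matrix.det_mul, Matrix.det_transpose]
    exact mul_ne_zero (mul_ne_zero hJ hdet) hJ
  have hΓ := matDiff_connMat hG hGdet
  have hΓ' := matDiff_connMat hs' hdet
  have hS : ∀ b, MatDiff (fun r => ∑ b', P.jac r b' b • connMat G' b' (P.phi r)) s := fun b =>
    MatDiff.sum fun b' => MatDiff.smul (hJd b' b) ((hΓ' b').comp hφ)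
  have hJJ : ∀ b, MatDiff (matD b P.jac) s := by
    intro b c d
    refine differentiableAt_of_smooth (contDiffAt_coordD ?_ b)
    rcases c with i | i <;> rcases d with j | j
    · exact contDiffAt_pi.1 (contDiffAt_pd hP.1 j) i
    · exact contDiffAt_const
    · exact contDiffAt_pi.1 (contDiffAt_pd hP.2.1 j) i
    · exact contDiffAt_const
  -- the derivative of the transformation law of the connection
  have key : ∀ a b, matD a P.jac s * connMat G b s + P.jac s * matD a (connMat G b) s =
      (∑ b', (matD a P.jac s b' b • connMat G' b' (P.phi s) +
        P.jac s b' b • ∑ a', P.jac s a' a • matD a' (connMat G' b') (P.phi s))) * P.jac s +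
      (∑ b', P.jac s b' b • connMat G' b' (P.phi s)) * matD a P.jac s +
      matD a (matD b P.jac) s := by
    intro a b
    rw [← matD_mul hJd (hΓ b), matD_congr (hconn b), matD_add ((hS b).mul hJd) (hJJ b),
      matD_mul (hS b) hJd, matD_sum fun b' => MatDiff.smul (hJd b' b) ((hΓ' b').comp hφ)]
    congr 4
    funext b'
    rw [matD_smul (hJd b' b) ((hΓ' b').comp hφ), matD_comp (hΓ' b') hφ]
    rfl
  have hsym : ∀ a b c, matD a P.jac s c b = matD b P.jac s c a :=
    P.matD_jac_symm e1.self_of_nhds e2.self_of_nhds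
  have hsym2 : matD a (matD b P.jac) s = matD b (matD a P.jac) s := by
    ext c d
    refine coordD_comm (w := fun r => P.jac r c d) (ContDiffAt.of_le (n := ∞) ?_ (by norm_cast)) a b
    rcases c with i | i <;> rcases d with j | j
    · exact contDiffAt_pi.1 (contDiffAt_pd hP.1 j) i
    · exact contDiffAt_const
    · exact contDiffAt_pi.1 (contDiffAt_pd hP.2.1 j) i
    · exact contDiffAt_const
  have c1 := (hconn a).eq_of_nhds
  have c2 := (hconn b).eq_of_nhds
  have k1 := key a b
  have k2 := key b a
  simp only [Finset.sum_add_distrib] at k1 k2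
  have k3 : ∑ b', matD b P.jac s b' a • connMat G' b' (P.phi s) =
      ∑ b', matD a P.jac s b' b • connMat G' b' (P.phi s) :=
    Finset.sum_congr rfl fun b' _ => by rw [hsym b a]
  rw [k3, ← hsym2] at k2
  set J := P.jac s
  set A := connMat G a s
  set B := connMat G b s
  set A' := ∑ a', J a' a • connMat G' a' (P.phi s) with hA'
  set B' := ∑ a', J a' b • connMat G' a' (P.phi s) with hB'
  have hfin : (∑ a', ∑ b', (J a' a * J b' b) • curvMat G' a' b' (P.phi s)) =
      (∑ b', J b' b • ∑ a', J a' a • matD a' (connMat G' b') (P.phi s)) -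
      (∑ a', J a' a • ∑ b', J b' b • matD b' (connMat G' a') (P.phi s)) + A' * B' - B' * A' := by
    simp only [hA', hB', curvMat, smul_sub, smul_add, Finset.sum_add_distrib,
      Finset.sum_sub_distrib, Finset.smul_sum, Finset.sum_mul, Finset.mul_sum, Matrix.smul_mul,
      Matrix.mul_smul, smul_smul]
    congr 1
    · congr 1
      · congr 1
        rw [Finset.sum_comm]
        simp only [mul_comm]
      · rw [Finset.sum_comm]
        simp only [mul_comm]
  rw [hfin]
  have m1 : J * (A * B) = A' * (B' * J + matD b P.jac s) + matD a P.jac s * B := by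
    rw [← Matrix.mul_assoc, c1, Matrix.add_mul, Matrix.mul_assoc, c2]
  have m2 : J * (B * A) = B' * (A' * J + matD a P.jac s) + matD b P.jac s * A := by
    rw [← Matrix.mul_assoc, c2, Matrix.add_mul, Matrix.mul_assoc, c1]
  have m3 : J * curvMat G a b s = J * matD a (connMat G b) s - J * matD b (connMat G a) s +
      J * (A * B) - J * (B * A) := by
    simp only [curvMat, Matrix.mul_sub, Matrix.mul_add]
    rfl
  rw [m3, m1, m2, eq_sub_of_add_eq' k1, eq_sub_of_add_eq' k2]
  noncomm_ring

/-- The curvature law is contracted over its upper and first lower index, where J meets J⁻¹ and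
gives the Kronecker delta `hδ`. -/
theorem ricciMat_pullback (hP : P.RegularAt s) (hGs : ∀ s, (G s)ᵀ = G s)
    (hG : ∀ c b, ContDiffAt ℝ ∞ (fun r => G r c b) s)
    (hG' : ∀ s, (G' s)ᵀ = G' s) (hs' : ∀ c b, ContDiffAt ℝ ∞ (fun r => G' r c b) (P.phi s))
    (h : ∀ᶠ r in 𝓝 s, G r = (P.jac r)ᵀ * G' (P.phi r) * P.jac r)
    (hJ : (P.jac s).det ≠ 0) (hdet : (G' (P.phi s)).det ≠ 0) :
    ricciMat G s = (P.jac s)ᵀ * ricciMat G' (P.phi s) * P.jac s := by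
  set J := P.jac s with hJdef
  have hQ : J⁻¹ * J = 1 := Matrix.nonsing_inv_mul _ hJ.isUnit
  have hQ' : J * J⁻¹ = 1 := Matrix.mul_nonsing_inv _ hJ.isUnit
  have hK : ∀ c b, curvMat G c b s =
      J⁻¹ * (∑ a', ∑ b', (J a' c * J b' b) • curvMat G' a' b' (P.phi s)) * J := by
    intro c b
    rw [Matrix.mul_assoc, ← curvMat_pullback hP hG hG' hs' h hJ hdet c b, ← Matrix.mul_assoc, hQ,
      Matrix.one_mul]
  have hδ : ∀ x y, ∑ c, J x c * J⁻¹ c y = if x = y then 1 else 0 := fun x y => by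
    rw [← Matrix.mul_apply, hQ', Matrix.one_apply]
  have hK2 : ∀ c b a, curvMat G c b s c a = ∑ y, ∑ z, ∑ x, ∑ b', (J x c * J⁻¹ c y) * (J b' b *
      (curvMat G' x b' (P.phi s) y z * J z a)) := by
    intro c b a
    rw [hK, Matrix.mul_assoc, Matrix.mul_apply]
    refine Finset.sum_congr rfl fun y _ => ?_
    rw [Matrix.mul_apply, Finset.mul_sum]
    refine Finset.sum_congr rfl fun z _ => ?_
    simp only [Matrix.sum_apply, Finset.mul_sum, Finset.sum_mul, Matrix.smul_apply, smul_eq_mul]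
    refine Finset.sum_congr rfl fun x _ => Finset.sum_congr rfl fun b' _ => ?_
    ring
  ext a b
  rw [ricciMat_eq_curvMat hGs]
  simp only [hK2]
  calc _ = ∑ y, ∑ z, ∑ x, ∑ b', (∑ c, J x c * J⁻¹ c y) * (J b' b *
      (curvMat G' x b' (P.phi s) y z * J z a)) := by
        simp only [Finset.sum_mul]
        rw [Finset.sum_comm]
        refine Finset.sum_congr rfl fun y _ => ?_
        rw [Finset.sum_comm]
        refine Finset.sum_congr rfl fun z _ => ?_
        rw [Finset.sum_comm]
        refine Finset.sum_congr rfl fun x _ => ?_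
        rw [Finset.sum_comm]
    _ = ∑ y, ∑ z, ∑ b', J b' b * (curvMat G' y b' (P.phi s) y z * J z a) := by
        refine Finset.sum_congr rfl fun y _ => Finset.sum_congr rfl fun z _ => ?_
        rw [Finset.sum_comm]
        refine Finset.sum_congr rfl fun b' _ => ?_
        simp only [hδ]
        simp
    _ = _ := by
        have hR : ∀ R : Matrix Idx Idx ℝ, (Jᵀ * R * J) a b =
            ∑ z, ∑ b', J z a * R z b' * J b' b := by
          intro R
          simp only [Matrix.mul_apply, Matrix.transpose_apply, Finset.sum_mul]
          exact Finset.sum_comm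
        rw [hR, Finset.sum_comm]
        refine Finset.sum_congr rfl fun z _ => ?_
        rw [Finset.sum_comm]
        refine Finset.sum_congr rfl fun b' _ => ?_
        rw [ricciMat_eq_curvMat hG', Finset.mul_sum, Finset.sum_mul]
        refine Finset.sum_congr rfl fun y _ => ?_
        ring

end Transformation

/-! ### Invariance of the field equations -/

theorem Rel.exists_section {a b : ℝ} {θ θ' : Jet2} (h : Rel a b θ θ') :
    ∃ P : AdaptedChange, P.RegularAt θ.1.1 ∧ P.app θ.1 = θ'.1 ∧
      jetAt (P.pull (polySec θ')) θ.1 = θ := by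
  obtain ⟨P, hP, hPx, -, -, hPj⟩ := h
  exact ⟨P, hP, hPx, hPj _ (contDiff_polySec θ').contDiffAt (jetAt_polySec θ')⟩

theorem metricJets_of_rel {a b : ℝ} {θ θ' : Jet2} (h : Rel a b θ θ') (hθ' : θ' ∈ metricJets) :
    θ ∈ metricJets := by
  obtain ⟨P, hP, hPx, hj⟩ := h.exists_section
  have hl := P.fibreLaw_pull hP.2.2.2 (polySec θ') θ.1.1
  have e1 : P.pull (polySec θ') θ.1.1 = θ.2.1 := congrArg (·.2.1) hj
  have e2 : polySec θ' (P.phi θ.1.1) = θ'.2.1 := by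
    have : P.phi θ.1.1 = θ'.1.1 := congrArg Prod.fst hPx
    rw [this]
    exact congrArg (·.2.1) (jetAt_polySec θ')
  rw [e1, e2] at hl
  refine ⟨?_, ?_⟩
  · rw [hl.orbit, Matrix.det_mul, Matrix.det_mul, Matrix.det_transpose]
    exact mul_ne_zero (mul_ne_zero hP.2.2.1 hθ'.1) hP.2.2.1
  · rw [hl.kill, Matrix.det_mul, Matrix.det_mul, Matrix.det_transpose]
    exact mul_ne_zero (mul_ne_zero hP.2.2.2 hθ'.2) hP.2.2.2

/-- The Ricci tensor and the metric undergo the same congruence, so R = Λg is preserved. -/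
theorem einsteinJets_of_rel {a b Λ : ℝ} {θ θ' : Jet2} (h : Rel a b θ θ')
    (hθ' : θ' ∈ einsteinJets Λ) : θ ∈ einsteinJets Λ := by
  have hθ := metricJets_of_rel h hθ'.1
  obtain ⟨P, hP, hPx, hj⟩ := h.exists_section
  have hτ : ContDiff ℝ ∞ (polySec θ') := contDiff_polySec θ'
  have hσ : ContDiffAt ℝ ∞ (P.pull (polySec θ')) θ.1.1 := P.contDiffAt_pull hP hτ.contDiffAt
  have e0 : P.phi θ.1.1 = θ'.1.1 := congrArg Prod.fst hPx
  have e1 : P.pull (polySec θ') θ.1.1 = θ.2.1 := congrArg (·.2.1) hj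
  have e2 : polySec θ' θ'.1.1 = θ'.2.1 := congrArg (·.2.1) (jetAt_polySec θ')
  set J := P.jac θ.1.1 with hJ
  have hr := ricciMat_pullback (P := P) (s := θ.1.1)
    (G := fun s => metricMat (P.pull (polySec θ') s)) (G' := fun s => metricMat (polySec θ' s)) hP
    (fun s => metricMat_transpose _)
    (fun c b => (contDiff_metricMat c b).contDiffAt.comp _ hσ)
    (fun s => metricMat_transpose _)
    (fun c b => ((contDiff_metricMat c b).comp hτ).contDiffAt)
    (P.carries_pull hP.2.2.2 _ _) (by
      simp only [AdaptedChange.jac, Matrix.det_fromBlocks_zero₁₂]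
      exact mul_ne_zero hP.2.2.1 hP.2.2.2) (by
      rw [e0, e2, det_metricMat]; exact mul_ne_zero hθ'.1.1 hθ'.1.2)
  have hg : metricMat θ.2.1 = Jᵀ * metricMat θ'.2.1 * J := by
    have := (P.carries_pull hP.2.2.2 (polySec θ') θ.1.1).self_of_nhds
    rwa [e1, e0, e2] at this
  have hr1 : ∀ a b, ricci a b θ = ricciMat (fun s => metricMat (P.pull (polySec θ') s)) θ.1.1 a b := by
    intro a b
    rw [← ricci_jetAt hσ (by rwa [hj]), hj]
  have hr2 : ∀ a b, ricci a b θ' = ricciMat (fun s => metricMat (polySec θ' s)) θ'.1.1 a b := by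
    intro a b
    rw [← ricci_jetAt hτ.contDiffAt (by rw [jetAt_polySec]; exact hθ'.1), jetAt_polySec]
  have hE : ricciMat (fun s => metricMat (polySec θ' s)) θ'.1.1 = Λ • metricMat θ'.2.1 := by
    ext a b
    rw [← hr2]
    have := sub_eq_zero.1 (hθ'.2 a b)
    exact this
  refine ⟨hθ, fun a b => ?_⟩
  rw [hr1, hr, e0, hE, metric, hg, ← hJ]
  simp

/-! ### Components of the tensors entering the invariants -/

theorem orbitMat_eq (u : Fib) : orbitMat u = !![u.1 0, u.1 1; u.1 1, u.1 2] := by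
  ext i j; fin_cases i <;> fin_cases j <;> rfl

theorem killMat_eq (u : Fib) : killMat u = !![u.2.2 0, u.2.2 1; u.2.2 1, u.2.2 2] := by
  ext i j; fin_cases i <;> fin_cases j <;> rfl

theorem detG_eq (θ : Jet2) : detG θ = θ.2.1.1 0 * θ.2.1.1 2 - θ.2.1.1 1 ^ 2 := by
  simp [detG, orbitMat_eq, Matrix.det_fin_two]; ring

theorem detH_eq (θ : Jet2) : detH θ = θ.2.1.2.2 0 * θ.2.1.2.2 2 - θ.2.1.2.2 1 ^ 2 := by
  simp [detH, killMat_eq, Matrix.det_fin_two]; ring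

theorem dh_eq (k l i : Fin 2) (θ : Jet2) : dh k l i θ = (θ.2.2.1 i).2.2 (symIdx k l) := by
  have := totalD_of_fib (f := fun u => killMat u k l) (θ := θ)
    ((compH (symIdx k l)).differentiableAt) i
  refine this.trans ?_
  exact congrFun (congrArg DFunLike.coe ((compH (symIdx k l)).fderiv (x := θ.2.1))) (θ.2.2.1 i)

theorem totalD_shift (i j k : Fin 2) (θ : Jet2) :
    totalD (Sum.inl j) (fun η => shiftMat η.2.1 i k) θ = (θ.2.2.1 j).2.1 i k := by
  have := totalD_of_fib (f := fun u => shiftMat u i k) (θ := θ) ((compF i k).differentiableAt) j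
  refine this.trans ?_
  exact congrFun (congrArg DFunLike.coe ((compF i k).fderiv (x := θ.2.1))) (θ.2.2.1 j)

/-- The derivative of `det h`. -/
def detHDeriv (i : Fin 2) (θ : Jet2) : ℝ :=
  (θ.2.2.1 i).2.2 0 * θ.2.1.2.2 2 + θ.2.1.2.2 0 * (θ.2.2.1 i).2.2 2 -
    2 * (θ.2.1.2.2 1 * (θ.2.2.1 i).2.2 1)

theorem sig_eq (i : Fin 2) (θ : Jet2) : sig i θ = detHDeriv i θ / detH θ := by
  have h0 := (compH 0).hasFDerivAt (x := θ.2.1)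
  have h1 := (compH 1).hasFDerivAt (x := θ.2.1)
  have h2 := (compH 2).hasFDerivAt (x := θ.2.1)
  have hd := (h0.mul h2).sub (h1.mul h1)
  have e : (fun u => (killMat u).det) = fun u => compH 0 u * compH 2 u - compH 1 u * compH 1 u := by
    funext u
    simp [killMat_eq, Matrix.det_fin_two]
  have h3 := totalD_of_fib (f := fun u => (killMat u).det) (θ := θ)
    (by rw [e]; exact hd.differentiableAt) i
  have h4 : totalD (Sum.inl i) detH θ = detHDeriv i θ := by
    refine h3.trans ?_
    rw [e]
    erw [hd.fderiv]
    simp [detHDeriv]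
    ring
  rw [sig, h4]

/-- The undensitized curvature `f_1ᵏ,2 - f_2ᵏ,1`. -/
def curvF (k : Fin 2) (θ : Jet2) : ℝ := (θ.2.2.1 1).2.1 0 k - (θ.2.2.1 0).2.1 1 k

theorem curv_eq (k : Fin 2) (θ : Jet2) : curv k θ = curvF k θ / √|detG θ| := by
  rw [curv, totalD_shift, totalD_shift, curvF]

/-- The symmetric form obtained by polarizing `det`, on triples `11, 12, 22`. -/
def polarDet (p q : Fin 3 → ℝ) : ℝ := p 0 * q 2 + q 0 * p 2 - 2 * (p 1 * q 1)

theorem chi_eq (i j : Fin 2) (θ : Jet2) :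
    chi θ i j = polarDet (θ.2.2.1 i).2.2 (θ.2.2.1 j).2.2 / (2 * detH θ) := by
  simp only [chi, Matrix.of_apply, dh_eq, polarDet]
  rfl

/-- The action of a matrix on triples of entries of symmetric matrices. -/
def congrTriple (α : Matrix (Fin 2) (Fin 2) ℝ) (p : Fin 3 → ℝ) : Fin 3 → ℝ :=
  ![α 0 0 ^ 2 * p 0 + 2 * (α 0 0 * α 1 0 * p 1) + α 1 0 ^ 2 * p 2,
    α 0 0 * α 0 1 * p 0 + (α 0 0 * α 1 1 + α 1 0 * α 0 1) * p 1 + α 1 0 * α 1 1 * p 2,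
    α 0 1 ^ 2 * p 0 + 2 * (α 0 1 * α 1 1 * p 1) + α 1 1 ^ 2 * p 2]

/-- The transformation law of the first-order tensors. -/
structure TensorLaw (J α : Matrix (Fin 2) (Fin 2) ℝ) (θ θ' : Jet2) : Prop where
  orbit : θ.2.1.1 = congrTriple J θ'.2.1.1
  kill : θ.2.1.2.2 = congrTriple α θ'.2.1.2.2
  killDeriv : ∀ i, (θ.2.2.1 i).2.2 =
    J 0 i • congrTriple α (θ'.2.2.1 0).2.2 + J 1 i • congrTriple α (θ'.2.2.1 1).2.2
  curvature : ∀ k, α k 0 * curvF 0 θ + α k 1 * curvF 1 θ = J.det * curvF k θ'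

theorem triple_of_sum {α : Matrix (Fin 2) (Fin 2) ℝ} {p q : Fin 3 → ℝ}
    (h : ∀ i j, p (symIdx i j) = ∑ k, ∑ l, α k i * α l j * q (symIdx k l)) :
    p = congrTriple α q := by
  funext m
  obtain ⟨i, j, rfl⟩ := exists_symIdx m
  rw [h]
  fin_cases i <;> fin_cases j <;> simp [Fin.sum_univ_two, symIdx, congrTriple] <;> ring

/-- The laws are needed on a neighbourhood, so that invariant functions can be differentiated along
the section. In the curvature law, antisymmetrization removes the second derivatives of φ and ψ. -/
theorem eventually_tensorLaw {P : AdaptedChange} {t : Plane} (hP : P.RegularAt t) {τ : Plane → Fib}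
    (hτ : ContDiffAt ℝ ∞ τ (P.phi t)) : ∀ᶠ s in 𝓝 t, ∀ z,
      TensorLaw (P.phiJac s) P.alpha (jetAt (P.pull τ) (s, z)) (jetAt τ (P.app (s, z))) := by
  have e1 : ∀ᶠ r in 𝓝 t, ContDiffAt ℝ 2 P.phi r := eventually_contDiffAt hP.1 2
  have e2 : ∀ᶠ r in 𝓝 t, ContDiffAt ℝ 2 P.psi r := eventually_contDiffAt hP.2.1 2
  filter_upwards [e1, e2, hP.1.continuousAt.eventually (eventually_differentiableAt hτ),
    eventually_differentiableAt (P.contDiffAt_pull hP hτ)] with s h1 h2 h3 h4 z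
  have hα := hP.2.2.2
  have hφ : DifferentiableAt ℝ P.phi s := h1.differentiableAt (by simp)
  have hc : ∀ c : Fib →L[ℝ] ℝ, DifferentiableAt ℝ (fun r => c (τ r)) (P.phi s) := fun c =>
    c.differentiableAt.comp _ h3
  have hcφ : ∀ c : Fib →L[ℝ] ℝ, DifferentiableAt ℝ (fun r => c (τ (P.phi r))) s := fun c =>
    DifferentiableAt.comp (g := fun r => c (τ r)) s (hc c) hφ
  have hcp : ∀ (c : Fib →L[ℝ] ℝ) i, pd i (fun r => c (τ (P.phi r))) s =
      P.phiJac s 0 i * c (pd 0 τ (P.phi s)) + P.phiJac s 1 i * c (pd 1 τ (P.phi s)) := by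
    intro c i
    refine (pd_comp (w := fun r => c (τ r)) (hc c) hφ i).trans ?_
    simp [Fin.sum_univ_two, AdaptedChange.phiJac, pd_clm c h3]
  refine ⟨?_, ?_, fun i => ?_, fun k => ?_⟩
  · refine triple_of_sum fun i j => ?_
    refine (compG_pull hα τ s i j).trans ?_
    refine Finset.sum_congr rfl fun k _ => Finset.sum_congr rfl fun l _ => ?_
    simp only [compG_apply, jetAt, AdaptedChange.app]
    ring
  · exact triple_of_sum fun i j => compH_pull hα τ s i j
  · have : (pd i (P.pull τ) s).2.2 = congrTriple P.alpha
        (P.phiJac s 0 i • (pd 0 τ (P.phi s)).2.2 + P.phiJac s 1 i • (pd 1 τ (P.phi s)).2.2) := by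
      refine triple_of_sum fun j k => ?_
      have h5 := pd_clm (compH (symIdx j k)) h4 i
      refine h5.symm.trans ?_
      simp only [compH_pull hα]
      rw [pd_sum _ fun k _ => DifferentiableAt.fun_sum fun l _ =>
        (differentiableAt_const _).fun_mul (hcφ _)]
      refine Finset.sum_congr rfl fun k _ => ?_
      rw [pd_sum _ fun l _ => (differentiableAt_const _).fun_mul (hcφ _)]
      refine Finset.sum_congr rfl fun l _ => ?_
      rw [pd_const_mul _ (hcφ _), hcp]
      simp
    refine this.trans ?_
    funext m
    fin_cases m <;> simp [congrTriple, jetAt, AdaptedChange.app] <;> ring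
  · -- the linear relation between the shifts, differentiated and antisymmetrized
    have hrel : ∀ i, (fun r => P.alpha k 0 * compF i 0 (P.pull τ r) +
        P.alpha k 1 * compF i 1 (P.pull τ r)) = fun r => (P.phiJac r 0 i * compF 0 k (τ (P.phi r)) +
          P.phiJac r 1 i * compF 1 k (τ (P.phi r))) + P.psiJac r k i := by
      intro i
      funext r
      have := congrFun (congrFun (P.fibreLaw_pull hα τ r).shift i) k
      simp only [Matrix.mul_apply, Fin.sum_univ_two, Matrix.transpose_apply, Matrix.add_apply,
        shiftMat, Matrix.of_apply] at this
      simp only [compF_apply]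
      linear_combination this
    have hJd : ∀ {w : Plane → Plane}, ContDiffAt ℝ 2 w s → ∀ i l,
        DifferentiableAt ℝ (fun r => pd i w r l) s := fun hw i l =>
      differentiableAt_pi.1 ((((hw.fderiv_right (m := 1) (by norm_num)).clm_apply
        contDiffAt_const).differentiableAt (by simp) : DifferentiableAt ℝ (pd i _) s)) l
    have hsym : ∀ {w : Plane → Plane}, ContDiffAt ℝ 2 w s → ∀ i j l,
        pd i (fun r => pd j w r l) s = pd j (fun r => pd i w r l) s := by
      intro w hw i j l
      have hd : ∀ j, DifferentiableAt ℝ (pd j w) s := fun j =>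
        ((hw.fderiv_right (m := 1) (by norm_num)).clm_apply contDiffAt_const).differentiableAt
          (by simp)
      rw [← pd_apply (hd j), ← pd_apply (hd i), pd_comm hw]
    have hpull : ∀ c : Fib →L[ℝ] ℝ, DifferentiableAt ℝ (fun r => c (P.pull τ r)) s := fun c =>
      c.differentiableAt.comp _ h4
    have hJ' : ∀ l i, DifferentiableAt ℝ (fun r => P.phiJac r l i) s := fun l i => hJd h1 i l
    have hB' : ∀ l i, DifferentiableAt ℝ (fun r => P.psiJac r l i) s := fun l i => hJd h2 i l
    have key : ∀ i j, P.alpha k 0 * compF i 0 (pd j (P.pull τ) s) +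
        P.alpha k 1 * compF i 1 (pd j (P.pull τ) s) =
        (pd j (fun r => P.phiJac r 0 i) s * compF 0 k (τ (P.phi s)) + P.phiJac s 0 i *
          (P.phiJac s 0 j * compF 0 k (pd 0 τ (P.phi s)) +
            P.phiJac s 1 j * compF 0 k (pd 1 τ (P.phi s))) +
        (pd j (fun r => P.phiJac r 1 i) s * compF 1 k (τ (P.phi s)) + P.phiJac s 1 i *
          (P.phiJac s 0 j * compF 1 k (pd 0 τ (P.phi s)) +
            P.phiJac s 1 j * compF 1 k (pd 1 τ (P.phi s))))) + pd j (fun r => P.psiJac r k i) s := by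
      intro i j
      have : pd j (fun r => P.alpha k 0 * compF i 0 (P.pull τ r) +
          P.alpha k 1 * compF i 1 (P.pull τ r)) s = pd j (fun r => (P.phiJac r 0 i *
            compF 0 k (τ (P.phi r)) + P.phiJac r 1 i * compF 1 k (τ (P.phi r))) +
              P.psiJac r k i) s := congrArg (fun w => pd j w s) (hrel i)
      rw [pd_add ((differentiableAt_const _).fun_mul (hpull _))
        ((differentiableAt_const _).fun_mul (hpull _)), pd_const_mul _ (hpull _),
        pd_const_mul _ (hpull _), pd_clm _ h4, pd_clm _ h4,
        pd_add (((hJ' 0 i).fun_mul (hcφ _)).fun_add ((hJ' 1 i).fun_mul (hcφ _))) (hB' k i),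
        pd_add ((hJ' 0 i).fun_mul (hcφ _)) ((hJ' 1 i).fun_mul (hcφ _)),
        pd_mul (hJ' 0 i) (hcφ _), pd_mul (hJ' 1 i) (hcφ _), hcp, hcp] at this
      exact this
    have k01 := key 0 1
    have k10 := key 1 0
    have s0 : pd 1 (fun r => P.phiJac r 0 0) s = pd 0 (fun r => P.phiJac r 0 1) s := hsym h1 1 0 0
    have s1 : pd 1 (fun r => P.phiJac r 1 0) s = pd 0 (fun r => P.phiJac r 1 1) s := hsym h1 1 0 1
    have s2 : pd 1 (fun r => P.psiJac r k 0) s = pd 0 (fun r => P.psiJac r k 1) s := hsym h2 1 0 k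
    simp only [compF_apply] at k01 k10
    simp only [curvF, jetAt, AdaptedChange.app, Matrix.det_fin_two]
    rw [s0, s1, s2] at k01
    linear_combination k01 - k10

/-! ### Smoothness of the invariants -/

theorem contDiff_hcoord (m : Fin 3) : ContDiff ℝ ∞ fun θ : Jet2 => θ.2.1.2.2 m :=
  (compH m).contDiff.comp contDiff_fibCoord

theorem contDiff_gcoord (m : Fin 3) : ContDiff ℝ ∞ fun θ : Jet2 => θ.2.1.1 m :=
  (compG m).contDiff.comp contDiff_fibCoord

theorem contDiff_deriv (c : Fib →L[ℝ] ℝ) (i : Fin 2) : ContDiff ℝ ∞ fun θ : Jet2 => c (θ.2.2.1 i) :=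
  c.contDiff.comp (by fun_prop)

theorem contDiff_detG : ContDiff ℝ ∞ detG := by
  rw [show detG = fun θ => _ from funext detG_eq]
  exact ((contDiff_gcoord 0).mul (contDiff_gcoord 2)).sub ((contDiff_gcoord 1).pow 2)

theorem contDiff_detH : ContDiff ℝ ∞ detH := by
  rw [show detH = fun θ => _ from funext detH_eq]
  exact ((contDiff_hcoord 0).mul (contDiff_hcoord 2)).sub ((contDiff_hcoord 1).pow 2)

theorem contDiff_detHDeriv (i : Fin 2) : ContDiff ℝ ∞ (detHDeriv i) := by
  have h := fun m => contDiff_deriv (compH m) i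
  exact (((h 0).mul (contDiff_hcoord 2)).add ((contDiff_hcoord 0).mul (h 2))).sub
    (contDiff_const.mul ((contDiff_hcoord 1).mul (h 1)))

theorem contDiff_curvF (k : Fin 2) : ContDiff ℝ ∞ (curvF k) :=
  (contDiff_deriv (compF 0 k) 1).sub (contDiff_deriv (compF 1 k) 0)

theorem contDiffAt_sqrt_abs {E : Type*} [NormedAddCommGroup E] [NormedSpace ℝ E] {f : E → ℝ}
    {x : E} (hf : ContDiffAt ℝ ∞ f x) (h : f x ≠ 0) : ContDiffAt ℝ ∞ (fun y => √|f y|) x :=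
  (hf.abs h).sqrt (abs_ne_zero.2 h)

theorem contDiffAt_dh (θ : Jet2) (k l i : Fin 2) : ContDiffAt ℝ ∞ (dh k l i) θ :=
  contDiffAt_totalD ((contDiff_killMat k l).comp contDiff_fibCoord).contDiffAt _

section AtMetricJet

variable {θ : Jet2} (hθ : θ ∈ metricJets)

include hθ

theorem detG_ne_zero : detG θ ≠ 0 := hθ.1

theorem detH_ne_zero : detH θ ≠ 0 := hθ.2

theorem contDiffAt_sig (i : Fin 2) : ContDiffAt ℝ ∞ (sig i) θ := by
  rw [show sig i = fun θ => _ from funext (sig_eq i)]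
  exact (contDiff_detHDeriv i).contDiffAt.div contDiff_detH.contDiffAt hθ.2

theorem contDiffAt_curv (k : Fin 2) : ContDiffAt ℝ ∞ (curv k) θ := by
  rw [show curv k = fun θ => _ from funext (curv_eq k)]
  refine (contDiff_curvF k).contDiffAt.div (contDiffAt_sqrt_abs contDiff_detG.contDiffAt hθ.1) ?_
  exact (Real.sqrt_pos.2 (abs_pos.2 hθ.1)).ne'

theorem contDiffAt_chi (i j : Fin 2) : ContDiffAt ℝ ∞ (fun θ => chi θ i j) θ := by
  simp only [chi_eq]
  refine ContDiffAt.div ?_ (contDiff_const.mul contDiff_detH).contDiffAt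
    (mul_ne_zero two_ne_zero hθ.2)
  have h := fun m i => (contDiff_deriv (compH m) i).contDiffAt (x := θ)
  exact (((h 0 i).mul (h 2 j)).add ((h 0 j).mul (h 2 i))).sub
    (contDiffAt_const.mul ((h 1 i).mul (h 1 j)))

theorem contDiffAt_rho (i j : Fin 2) : ContDiffAt ℝ ∞ (fun θ => rho θ i j) θ :=
  (contDiffAt_sig hθ i).mul (contDiffAt_sig hθ j)

theorem contDiffAt_gam (i j : Fin 2) : ContDiffAt ℝ ∞ (fun θ => gam θ i j) θ :=
  (contDiffAt_chi hθ i j).sub (contDiffAt_const.mul (contDiffAt_rho hθ i j))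

theorem contDiffAt_orbitInv (i j : Fin 2) :
    ContDiffAt ℝ ∞ (fun θ : Jet2 => (orbitMat θ.2.1)⁻¹ i j) θ :=
  contDiffAt_matrix_inv (fun i j => ((contDiff_orbitMat i j).comp contDiff_fibCoord).contDiffAt)
    hθ.1 i j

theorem contDiffAt_traceInv {μ : Jet2 → Matrix (Fin 2) (Fin 2) ℝ}
    (hμ : ∀ i j, ContDiffAt ℝ ∞ (fun θ => μ θ i j) θ) : ContDiffAt ℝ ∞ (traceInv μ) θ :=
  ContDiffAt.sum fun i _ => ContDiffAt.sum fun j _ => (hμ i j).mul (contDiffAt_orbitInv hθ i j)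

theorem contDiffAt_detInv {μ : Jet2 → Matrix (Fin 2) (Fin 2) ℝ}
    (hμ : ∀ i j, ContDiffAt ℝ ∞ (fun θ => μ θ i j) θ) : ContDiffAt ℝ ∞ (detInv μ) θ :=
  (contDiffAt_matrix_det hμ).div contDiff_detG.contDiffAt hθ.1

theorem contDiffAt_diffX {F : Jet2 → ℝ} (hF : ContDiffAt ℝ ∞ F θ) : ContDiffAt ℝ ∞ (diffX F) θ :=
  ContDiffAt.sum fun i _ => ContDiffAt.sum fun s _ =>
    ((contDiffAt_orbitInv hθ i s).mul (contDiffAt_sig hθ s)).mul (contDiffAt_totalD hF _)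

theorem contDiffAt_diffXperp {F : Jet2 → ℝ} (hF : ContDiffAt ℝ ∞ F θ) :
    ContDiffAt ℝ ∞ (diffXperp F) θ := by
  have hq := contDiffAt_sqrt_abs contDiff_detG.contDiffAt (detG_ne_zero hθ)
  have hq0 : √|detG θ| ≠ 0 := (Real.sqrt_pos.2 (abs_pos.2 hθ.1)).ne'
  exact (((contDiffAt_sig hθ 1).div hq hq0).mul (contDiffAt_totalD hF _)).sub
    (((contDiffAt_sig hθ 0).div hq hq0).mul (contDiffAt_totalD hF _))

theorem contDiffAt_ellC : ContDiffAt ℝ ∞ ellC θ :=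
  ContDiffAt.sum fun k _ => ContDiffAt.sum fun l _ =>
    ((((contDiff_killMat k l).comp contDiff_fibCoord).contDiffAt).mul (contDiffAt_curv hθ k)).mul
      (contDiffAt_curv hθ l)

theorem contDiffAt_thetaI : ContDiffAt ℝ ∞ thetaI θ := by
  have hg := contDiffAt_sqrt_abs contDiff_detG.contDiffAt (detG_ne_zero hθ)
  have hh := contDiffAt_sqrt_abs contDiff_detH.contDiffAt (detH_ne_zero hθ)
  have hg0 : √|detG θ| ≠ 0 := (Real.sqrt_pos.2 (abs_pos.2 hθ.1)).ne'
  have hh0 : √|detH θ| ≠ 0 := (Real.sqrt_pos.2 (abs_pos.2 hθ.2)).ne'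
  refine (contDiffAt_const.div (hh.mul hg) (mul_ne_zero hh0 hg0)).mul
    (contDiffAt_matrix_det fun i j => ?_)
  have hd := contDiffAt_dh θ
  have hc := contDiffAt_curv hθ
  fin_cases i <;> fin_cases j
  exacts [hd _ _ _, hd _ _ _, hd _ _ _, hd _ _ _, hd _ _ _, hd _ _ _, (hc 1).pow 2,
    ((hc 0).mul (hc 1)).neg, (hc 0).pow 2]

theorem contDiffAt_tenInv (i : Fin 10) : ContDiffAt ℝ ∞ (tenInv i) θ := by
  have h1 := contDiffAt_traceInv hθ (contDiffAt_chi hθ)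
  have h2 := contDiffAt_detInv hθ (contDiffAt_gam hθ)
  fin_cases i
  exacts [contDiffAt_traceInv hθ (contDiffAt_rho hθ), h1, contDiffAt_detInv hθ (contDiffAt_chi hθ),
    h2, contDiffAt_ellC hθ, contDiffAt_thetaI hθ, contDiffAt_diffX hθ h1, contDiffAt_diffX hθ h2,
    contDiffAt_diffXperp hθ h1, contDiffAt_diffXperp hθ h2]

end AtMetricJet

/-! ### Transformation of first-order functions -/

/-- Semi-invariance of a first-order function, read off from the law of the tensors. -/
def TensorSemi (m n : ℕ) (F : Jet2 → ℝ) : Prop :=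
  ∀ (J α : Matrix (Fin 2) (Fin 2) ℝ) (θ θ' : Jet2), TensorLaw J α θ θ' → J.det ≠ 0 → α.det ≠ 0 →
    θ' ∈ metricJets → F θ' = Real.sign J.det ^ m * Real.sign α.det ^ n * F θ

namespace TensorLaw

variable {J α : Matrix (Fin 2) (Fin 2) ℝ} {θ θ' : Jet2} (h : TensorLaw J α θ θ')

include h

theorem detG_law : detG θ = J.det ^ 2 * detG θ' := by
  simp only [detG_eq, h.orbit, congrTriple, Matrix.det_fin_two]
  simp
  ring

theorem detH_law : detH θ = α.det ^ 2 * detH θ' := by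
  simp only [detH_eq, h.kill, congrTriple, Matrix.det_fin_two]
  simp
  ring

theorem mem_metricJets (hJ : J.det ≠ 0) (hα : α.det ≠ 0) (hθ' : θ' ∈ metricJets) :
    θ ∈ metricJets := by
  refine ⟨?_, ?_⟩
  · change detG θ ≠ 0
    rw [h.detG_law]; exact mul_ne_zero (pow_ne_zero _ hJ) hθ'.1
  · change detH θ ≠ 0
    rw [h.detH_law]; exact mul_ne_zero (pow_ne_zero _ hα) hθ'.2

theorem orbitMat_law : orbitMat θ.2.1 = Jᵀ * orbitMat θ'.2.1 * J := by
  ext i j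
  rw [orbitMat_eq, orbitMat_eq, h.orbit]
  fin_cases i <;> fin_cases j <;> simp [congrTriple, Matrix.mul_apply, Fin.sum_univ_two] <;> ring

theorem sig_law (hα : α.det ≠ 0) (i : Fin 2) :
    sig i θ = J 0 i * sig 0 θ' + J 1 i * sig 1 θ' := by
  have e : detHDeriv i θ = α.det ^ 2 * (J 0 i * detHDeriv 0 θ' + J 1 i * detHDeriv 1 θ') := by
    simp only [detHDeriv, h.kill, h.killDeriv, congrTriple, Matrix.det_fin_two]
    simp
    ring
  rw [sig_eq, sig_eq, sig_eq, e, h.detH_law, mul_div_mul_left _ _ (pow_ne_zero 2 hα)]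
  ring

theorem chi_law (hα : α.det ≠ 0) : chi θ = Jᵀ * chi θ' * J := by
  have e : ∀ i j, polarDet (θ.2.2.1 i).2.2 (θ.2.2.1 j).2.2 = α.det ^ 2 *
      (J 0 i * J 0 j * polarDet (θ'.2.2.1 0).2.2 (θ'.2.2.1 0).2.2 +
       J 0 i * J 1 j * polarDet (θ'.2.2.1 0).2.2 (θ'.2.2.1 1).2.2 +
       J 1 i * J 0 j * polarDet (θ'.2.2.1 1).2.2 (θ'.2.2.1 0).2.2 +
       J 1 i * J 1 j * polarDet (θ'.2.2.1 1).2.2 (θ'.2.2.1 1).2.2) := by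
    intro i j
    simp only [polarDet, h.killDeriv, congrTriple, Matrix.det_fin_two]
    simp
    ring
  ext i j
  simp only [Matrix.mul_apply, Fin.sum_univ_two, chi_eq, e, h.detH_law, Matrix.transpose_apply]
  rw [mul_left_comm 2, mul_div_mul_left _ _ (pow_ne_zero 2 hα)]
  ring

theorem rho_law (hα : α.det ≠ 0) : rho θ = Jᵀ * rho θ' * J := by
  ext i j
  simp only [Matrix.mul_apply, Fin.sum_univ_two, rho, Matrix.of_apply, h.sig_law hα,
    Matrix.transpose_apply]
  ring

theorem gam_law (hα : α.det ≠ 0) : gam θ = Jᵀ * gam θ' * J := by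
  rw [gam, gam, h.chi_law hα, h.rho_law hα]
  simp [Matrix.mul_sub, Matrix.sub_mul]

/-- Inside the trace the factors J and J⁻¹ meet, once directly and once by cyclicity. -/
theorem traceInv_law {μ : Jet2 → Matrix (Fin 2) (Fin 2) ℝ} (hJ : J.det ≠ 0)
    (hμ : μ θ = Jᵀ * μ θ' * J) : traceInv μ θ' = traceInv μ θ := by
  have e : ∀ η : Jet2, traceInv μ η = (μ η * ((orbitMat η.2.1)⁻¹)ᵀ).trace := fun η => by
    simp [traceInv, Matrix.trace, Matrix.mul_apply]
  have hJ1 : J * J⁻¹ = 1 := Matrix.mul_nonsing_inv _ hJ.isUnit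
  rw [e, e, hμ, h.orbitMat_law, Matrix.mul_inv_rev, Matrix.mul_inv_rev, Matrix.transpose_mul,
    Matrix.transpose_mul, ← Matrix.transpose_nonsing_inv, Matrix.transpose_transpose,
    Matrix.mul_assoc (J⁻¹)]
  have : Jᵀ * μ θ' * J * (J⁻¹ * (((orbitMat θ'.2.1)⁻¹)ᵀ * (J⁻¹)ᵀ)) =
      Jᵀ * (μ θ' * (J * J⁻¹) * ((orbitMat θ'.2.1)⁻¹)ᵀ * (J⁻¹)ᵀ) := by noncomm_ring
  rw [this, hJ1, Matrix.trace_mul_comm Jᵀ, Matrix.mul_assoc _ (J⁻¹)ᵀ, ← Matrix.transpose_mul, hJ1]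
  simp

theorem detInv_law {μ : Jet2 → Matrix (Fin 2) (Fin 2) ℝ} (hJ : J.det ≠ 0)
    (hμ : μ θ = Jᵀ * μ θ' * J) : detInv μ θ' = detInv μ θ := by
  rw [detInv, detInv, hμ, h.detG_law, Matrix.det_mul, Matrix.det_mul, Matrix.det_transpose,
    mul_right_comm, ← pow_two, mul_div_mul_left _ _ (pow_ne_zero 2 hJ)]

theorem sqrt_detG : √|detG θ| = |J.det| * √|detG θ'| := by
  rw [h.detG_law, abs_mul, abs_pow, Real.sqrt_mul (by positivity), Real.sqrt_sq (abs_nonneg _)]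

theorem sqrt_detH : √|detH θ| = |α.det| * √|detH θ'| := by
  rw [h.detH_law, abs_mul, abs_pow, Real.sqrt_mul (by positivity), Real.sqrt_sq (abs_nonneg _)]

end TensorLaw

theorem sign_mul_abs_self (a : ℝ) : Real.sign a * |a| = a := by
  rcases lt_trichotomy a 0 with h | rfl | h
  · rw [Real.sign_of_neg h, abs_of_neg h]; ring
  · simp
  · rw [Real.sign_of_pos h, abs_of_pos h]; ring

theorem sign_sq {a : ℝ} (h : a ≠ 0) : Real.sign a ^ 2 = 1 := by
  rcases lt_or_gt_of_ne h with h | h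
  · rw [Real.sign_of_neg h]; norm_num
  · rw [Real.sign_of_pos h]; norm_num

theorem sign_mul_self_abs {a : ℝ} (h : a ≠ 0) : Real.sign a * a = |a| := by
  rcases lt_or_gt_of_ne h with h | h
  · rw [Real.sign_of_neg h, abs_of_neg h]; ring
  · rw [Real.sign_of_pos h, abs_of_pos h]; ring

/-- The undensitized curvature scales with det J but √|det g̃| with |det J|, which leaves a sign. -/
theorem TensorLaw.curv_law {J α : Matrix (Fin 2) (Fin 2) ℝ} {θ θ' : Jet2}
    (h : TensorLaw J α θ θ') (hJ : J.det ≠ 0) (k : Fin 2) :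
    curv k θ' = Real.sign J.det * (α k 0 * curv 0 θ + α k 1 * curv 1 θ) := by
  have h1 := h.curvature k
  have hJ' : |J.det| ≠ 0 := abs_ne_zero.2 hJ
  rw [curv_eq, curv_eq, curv_eq, h.sqrt_detG]
  have h2 : J.det * curvF k θ' / (|J.det| * √|detG θ'|) =
      Real.sign J.det * (curvF k θ' / √|detG θ'|) := by
    have := sign_mul_abs_self J.det
    rw [mul_div_mul_comm]
    congr 1
    field_simp
    linarith
  have h3 := sign_sq hJ
  rw [← mul_div_assoc, ← mul_div_assoc, ← add_div, h1, h2, ← mul_assoc, ← pow_two, h3, one_mul]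

/-- The trilinear expression `(σ₂ h_kl,1 - σ₁ h_kl,2) 𝒞ᵏ 𝒞ˡ / √|det g̃|`. -/
def transCurv (θ : Jet2) : ℝ :=
  ((sig 1 θ * (θ.2.2.1 0).2.2 0 - sig 0 θ * (θ.2.2.1 1).2.2 0) * curv 0 θ ^ 2 +
    2 * ((sig 1 θ * (θ.2.2.1 0).2.2 1 - sig 0 θ * (θ.2.2.1 1).2.2 1) * (curv 0 θ * curv 1 θ)) +
    (sig 1 θ * (θ.2.2.1 0).2.2 2 - sig 0 θ * (θ.2.2.1 1).2.2 2) * curv 1 θ ^ 2) / √|detG θ|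

theorem tensorSemi_traceInv_rho : TensorSemi 0 0 (traceInv rho) := fun _ _ _ _ h hJ hα _ => by
  simpa using h.traceInv_law hJ (h.rho_law hα)

theorem tensorSemi_traceInv_chi : TensorSemi 0 0 (traceInv chi) := fun _ _ _ _ h hJ hα _ => by
  simpa using h.traceInv_law hJ (h.chi_law hα)

theorem tensorSemi_detInv_chi : TensorSemi 0 0 (detInv chi) := fun _ _ _ _ h hJ hα _ => by
  simpa using h.detInv_law hJ (h.chi_law hα)

theorem tensorSemi_detInv_gam : TensorSemi 0 0 (detInv gam) := fun _ _ _ _ h hJ hα _ => by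
  simpa using h.detInv_law hJ (h.gam_law hα)

theorem ellC_eq (θ : Jet2) : ellC θ = θ.2.1.2.2 0 * curv 0 θ ^ 2 +
    2 * (θ.2.1.2.2 1 * (curv 0 θ * curv 1 θ)) + θ.2.1.2.2 2 * curv 1 θ ^ 2 := by
  simp [ellC, Fin.sum_univ_two, killMat_eq]; ring

theorem tensorSemi_ellC : TensorSemi 0 0 ellC := fun J α θ θ' h hJ _ _ => by
  rw [ellC_eq, ellC_eq, h.curv_law hJ, h.curv_law hJ, h.kill]
  have := sign_sq hJ
  simp [congrTriple]
  linear_combination (θ'.2.1.2.2 0 * (α 0 0 * curv 0 θ + α 0 1 * curv 1 θ) ^ 2 +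
    2 * (θ'.2.1.2.2 1 * ((α 0 0 * curv 0 θ + α 0 1 * curv 1 θ) *
      (α 1 0 * curv 0 θ + α 1 1 * curv 1 θ))) +
    θ'.2.1.2.2 2 * (α 1 0 * curv 0 θ + α 1 1 * curv 1 θ) ^ 2) * this

theorem thetaI_eq (θ : Jet2) : thetaI θ =
    ((θ.2.2.1 0).2.2 0 * ((θ.2.2.1 1).2.2 1 * curv 0 θ ^ 2 +
        (θ.2.2.1 1).2.2 2 * (curv 0 θ * curv 1 θ)) -
      (θ.2.2.1 0).2.2 1 * ((θ.2.2.1 1).2.2 0 * curv 0 θ ^ 2 - (θ.2.2.1 1).2.2 2 * curv 1 θ ^ 2) -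
      (θ.2.2.1 0).2.2 2 * ((θ.2.2.1 1).2.2 0 * (curv 0 θ * curv 1 θ) +
        (θ.2.2.1 1).2.2 1 * curv 1 θ ^ 2)) / (√|detH θ| * √|detG θ|) := by
  simp [thetaI, Matrix.det_fin_three, dh_eq, symIdx]
  ring

/-- The numerator has weight det J · det α, while the two square roots supply the absolute values.
It is quadratic in 𝒞, so the sign in the law of 𝒞 does not matter. -/
theorem tensorSemi_thetaI : TensorSemi 1 1 thetaI := fun J α θ θ' h hJ hα hθ' => by
  have s1 := sign_sq hJ
  have s2 := sign_sq hα
  have a1 := sign_mul_abs_self J.det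
  have a2 := sign_mul_abs_self α.det
  have hJ' : |J.det| ≠ 0 := abs_ne_zero.2 hJ
  have hα' : |α.det| ≠ 0 := abs_ne_zero.2 hα
  have hg0 : √|detG θ'| ≠ 0 := (Real.sqrt_pos.2 (abs_pos.2 hθ'.1)).ne'
  have hh0 : √|detH θ'| ≠ 0 := (Real.sqrt_pos.2 (abs_pos.2 hθ'.2)).ne'
  rw [thetaI_eq, thetaI_eq, h.curv_law hJ, h.curv_law hJ, h.sqrt_detG, h.sqrt_detH, h.killDeriv,
    h.killDeriv]
  set s := Real.sign J.det
  set r := Real.sign α.det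
  set x := curv 0 θ
  set y := curv 1 θ
  set p := (θ'.2.2.1 0).2.2
  set q := (θ'.2.2.1 1).2.2
  rw [eq_comm, pow_one, pow_one, ← mul_div_assoc, div_eq_div_iff (by positivity) (by positivity)]
  have key : ∀ u v : ℝ, u = s * (α 0 0 * x + α 0 1 * y) → v = s * (α 1 0 * x + α 1 1 * y) →
      (J 0 0 • congrTriple α p + J 1 0 • congrTriple α q) 0 *
        ((J 0 1 • congrTriple α p + J 1 1 • congrTriple α q) 1 * x ^ 2 +
          (J 0 1 • congrTriple α p + J 1 1 • congrTriple α q) 2 * (x * y)) -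
      (J 0 0 • congrTriple α p + J 1 0 • congrTriple α q) 1 *
        ((J 0 1 • congrTriple α p + J 1 1 • congrTriple α q) 0 * x ^ 2 -
          (J 0 1 • congrTriple α p + J 1 1 • congrTriple α q) 2 * y ^ 2) -
      (J 0 0 • congrTriple α p + J 1 0 • congrTriple α q) 2 *
        ((J 0 1 • congrTriple α p + J 1 1 • congrTriple α q) 0 * (x * y) +
          (J 0 1 • congrTriple α p + J 1 1 • congrTriple α q) 1 * y ^ 2) =
      J.det * α.det * (p 0 * (q 1 * u ^ 2 + q 2 * (u * v)) - p 1 * (q 0 * u ^ 2 - q 2 * v ^ 2) -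
        p 2 * (q 0 * (u * v) + q 1 * v ^ 2)) := by
    intro u v hu hv
    have e1 : u ^ 2 = (α 0 0 * x + α 0 1 * y) ^ 2 := by rw [hu, mul_pow, s1, one_mul]
    have e2 : v ^ 2 = (α 1 0 * x + α 1 1 * y) ^ 2 := by rw [hv, mul_pow, s1, one_mul]
    have e3 : u * v = (α 0 0 * x + α 0 1 * y) * (α 1 0 * x + α 1 1 * y) := by
      rw [hu, hv]; linear_combination (α 0 0 * x + α 0 1 * y) * (α 1 0 * x + α 1 1 * y) * s1
    rw [e1, e2, e3]
    simp [congrTriple, Matrix.det_fin_two]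
    ring
  rw [key _ _ rfl rfl]
  set T := p 0 * (q 1 * (s * (α 0 0 * x + α 0 1 * y)) ^ 2 +
    q 2 * (s * (α 0 0 * x + α 0 1 * y) * (s * (α 1 0 * x + α 1 1 * y)))) -
    p 1 * (q 0 * (s * (α 0 0 * x + α 0 1 * y)) ^ 2 - q 2 * (s * (α 1 0 * x + α 1 1 * y)) ^ 2) -
    p 2 * (q 0 * (s * (α 0 0 * x + α 0 1 * y) * (s * (α 1 0 * x + α 1 1 * y))) +
      q 1 * (s * (α 1 0 * x + α 1 1 * y)) ^ 2)
  have e5 : s * r * (J.det * α.det) = |J.det| * |α.det| := by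
    rw [← sign_mul_self_abs hJ, ← sign_mul_self_abs hα]; ring
  linear_combination T * √|detH θ'| * √|detG θ'| * e5

/-- `transCurv` serves as a genericity condition: on the slice it is a nonzero multiple of the
coordinate `s 3`, and semi-invariance makes its nonvanishing independent of the representative. -/
theorem tensorSemi_transCurv : TensorSemi 1 0 transCurv := fun J α θ θ' h hJ hα hθ' => by
  have s1 := sign_sq hJ
  have a1 := sign_mul_abs_self J.det
  have hJ' : |J.det| ≠ 0 := abs_ne_zero.2 hJ
  have hg0 : √|detG θ'| ≠ 0 := (Real.sqrt_pos.2 (abs_pos.2 hθ'.1)).ne'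
  rw [transCurv, transCurv, h.curv_law hJ, h.curv_law hJ, h.sqrt_detG, h.killDeriv, h.killDeriv,
    h.sig_law hα, h.sig_law hα]
  set s := Real.sign J.det
  set x := curv 0 θ
  set y := curv 1 θ
  set p := (θ'.2.2.1 0).2.2
  set q := (θ'.2.2.1 1).2.2
  rw [pow_one, pow_zero, mul_one, ← mul_div_assoc, div_eq_div_iff hg0 (mul_ne_zero hJ' hg0)]
  have key : ∀ u v : ℝ, u = s * (α 0 0 * x + α 0 1 * y) → v = s * (α 1 0 * x + α 1 1 * y) →
      (((J 0 1 * sig 0 θ' + J 1 1 * sig 1 θ') *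
          (J 0 0 • congrTriple α p + J 1 0 • congrTriple α q) 0 -
        (J 0 0 * sig 0 θ' + J 1 0 * sig 1 θ') *
          (J 0 1 • congrTriple α p + J 1 1 • congrTriple α q) 0) * x ^ 2 +
        2 * (((J 0 1 * sig 0 θ' + J 1 1 * sig 1 θ') *
          (J 0 0 • congrTriple α p + J 1 0 • congrTriple α q) 1 -
        (J 0 0 * sig 0 θ' + J 1 0 * sig 1 θ') *
          (J 0 1 • congrTriple α p + J 1 1 • congrTriple α q) 1) * (x * y)) +
        ((J 0 1 * sig 0 θ' + J 1 1 * sig 1 θ') *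
          (J 0 0 • congrTriple α p + J 1 0 • congrTriple α q) 2 -
        (J 0 0 * sig 0 θ' + J 1 0 * sig 1 θ') *
          (J 0 1 • congrTriple α p + J 1 1 • congrTriple α q) 2) * y ^ 2) =
      J.det * ((sig 1 θ' * p 0 - sig 0 θ' * q 0) * u ^ 2 +
        2 * ((sig 1 θ' * p 1 - sig 0 θ' * q 1) * (u * v)) +
        (sig 1 θ' * p 2 - sig 0 θ' * q 2) * v ^ 2) := by
    intro u v hu hv
    have e1 : u ^ 2 = (α 0 0 * x + α 0 1 * y) ^ 2 := by rw [hu, mul_pow, s1, one_mul]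
    have e2 : v ^ 2 = (α 1 0 * x + α 1 1 * y) ^ 2 := by rw [hv, mul_pow, s1, one_mul]
    have e3 : u * v = (α 0 0 * x + α 0 1 * y) * (α 1 0 * x + α 1 1 * y) := by
      rw [hu, hv]; linear_combination (α 0 0 * x + α 0 1 * y) * (α 1 0 * x + α 1 1 * y) * s1
    rw [e1, e2, e3]
    simp [congrTriple, Matrix.det_fin_two]
    ring
  rw [key _ _ rfl rfl]
  set T := (sig 1 θ' * p 0 - sig 0 θ' * q 0) * (s * (α 0 0 * x + α 0 1 * y)) ^ 2 +
    2 * ((sig 1 θ' * p 1 - sig 0 θ' * q 1) *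
      (s * (α 0 0 * x + α 0 1 * y) * (s * (α 1 0 * x + α 1 1 * y)))) +
    (sig 1 θ' * p 2 - sig 0 θ' * q 2) * (s * (α 1 0 * x + α 1 1 * y)) ^ 2
  have e5 : s * J.det = |J.det| := sign_mul_self_abs hJ
  rw [← e5]
  ring

/-! ### From first-order laws to invariance -/

theorem AdaptedChange.Carries.jetAt_eq {P : AdaptedChange} {σ σ' : Plane → Fib} {x : Base}
    (h : P.Carries σ σ' x.1) (hP : P.RegularAt x.1) (hσ' : ContDiffAt ℝ ∞ σ' (P.phi x.1))
    (hd : jetAt σ' (P.app x) ∈ metricJets) : jetAt σ x = jetAt (P.pull σ') x :=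
  jetAt_congr (h.eventually_eq hP hσ'.continuousAt hd.2)

theorem TensorSemi.transformsWith {m n : ℕ} {F : Jet2 → ℝ} (hF : TensorSemi m n F) :
    TransformsWith m n F metricJets := by
  intro P σ σ' x hP _ hσ' hc _ hd'
  rw [hc.jetAt_eq hP hσ' hd']
  exact hF _ _ _ _ ((eventually_tensorLaw hP hσ').self_of_nhds x.2) hP.2.2.1 hP.2.2.2 hd'

/-- The transformation law of the gradient of an invariant function of the first order. -/
theorem TensorSemi.totalD_law {F : Jet2 → ℝ} (hF : TensorSemi 0 0 F) (h1 : FirstOrder F)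
    (hs : ∀ θ ∈ metricJets, ContDiffAt ℝ ∞ F θ) {P : AdaptedChange} {x : Base}
    (hP : P.RegularAt x.1) {τ : Plane → Fib} (hτ : ContDiffAt ℝ ∞ τ (P.phi x.1))
    (hd : jetAt τ (P.app x) ∈ metricJets) (i : Fin 2) :
    totalD (Sum.inl i) F (jetAt (P.pull τ) x) =
      P.phiJac x.1 0 i * totalD (Sum.inl 0) F (jetAt τ (P.app x)) +
      P.phiJac x.1 1 i * totalD (Sum.inl 1) F (jetAt τ (P.app x)) := by
  have hl := (eventually_tensorLaw hP hτ).self_of_nhds x.2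
  have hd0 := hl.mem_metricJets hP.2.2.1 hP.2.2.2 hd
  have hτ' : ContDiffAt ℝ ∞ τ (P.app x).1 := hτ
  have hσ3 : ContDiffAt ℝ 3 (P.pull τ) x.1 := (P.contDiffAt_pull hP hτ).of_le (by norm_cast)
  have hτ3 : ContDiffAt ℝ 3 τ (P.app x).1 := hτ'.of_le (by norm_cast)
  have hFd := differentiableAt_of_smooth (hs _ hd)
  rw [totalD_jetAt h1 hσ3 (differentiableAt_of_smooth (hs _ hd0)),
    totalD_jetAt h1 hτ3 hFd, totalD_jetAt h1 hτ3 hFd]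
  have hmem : ∀ᶠ s in 𝓝 (P.phi x.1), ∀ z, jetAt τ (s, z) ∈ metricJets := by
    have h1 : ∀ᶠ s in 𝓝 (P.phi x.1), (orbitMat (τ s)).det ≠ 0 := by
      have : ContinuousAt (fun s => (orbitMat (τ s)).det) (P.phi x.1) :=
        (contDiffAt_matrix_det (n := ∞) fun i j =>
          (contDiff_orbitMat i j).contDiffAt.comp _ hτ).continuousAt
      exact this.eventually_ne hd.1
    have h2 : ∀ᶠ s in 𝓝 (P.phi x.1), (killMat (τ s)).det ≠ 0 := by
      have : ContinuousAt (fun s => (killMat (τ s)).det) (P.phi x.1) :=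
        continuous_killDet.continuousAt.comp hτ.continuousAt
      exact this.eventually_ne hd.2
    filter_upwards [h1, h2] with s h1 h2 z
    exact ⟨h1, h2⟩
  have hJ : ∀ᶠ s in 𝓝 x.1, (P.phiJac s).det ≠ 0 :=
    (contDiffAt_matrix_det (n := ∞) fun i j =>
      P.contDiffAt_phiJac hP i j).continuousAt.eventually_ne hP.2.2.1
  -- Invariance holds at all nearby points, so along the pulled-back section `F` is a composite with
  -- φ. The z part of the base point moves with ψ, which is harmless because `F` ignores base
  -- points.
  have heq : (fun s => F (jetAt (P.pull τ) (s, x.2))) =ᶠ[𝓝 x.1]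
      fun s => (fun r => F (jetAt τ (r, (P.app x).2))) (P.phi s) := by
    filter_upwards [eventually_tensorLaw hP hτ, hP.1.continuousAt.eventually hmem, hJ] with s h2 h3 h4
    have := hF _ _ _ _ (h2 x.2) h4 hP.2.2.2 (h3 _)
    rw [pow_zero, pow_zero, one_mul, one_mul] at this
    rw [← this]
    exact (h1 _ _ _).symm
  rw [pd_congr heq]
  have hdiff : DifferentiableAt ℝ (fun r => F (jetAt τ (r, (P.app x).2))) (P.phi x.1) := by
    have h5 : DifferentiableAt ℝ (jetAt τ) ((fun r : Plane => ((r, (P.app x).2) : Base))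
      (P.phi x.1)) := differentiableAt_jetAt hτ3
    have h6 : DifferentiableAt ℝ (fun r => jetAt τ (r, (P.app x).2)) (P.phi x.1) :=
      DifferentiableAt.comp (g := jetAt τ) (P.phi x.1) h5 (by fun_prop)
    exact DifferentiableAt.comp (g := F) (f := fun r => jetAt τ (r, (P.app x).2)) (P.phi x.1) hFd h6
  rw [pd_comp hdiff (differentiableAt_of_smooth hP.1), Fin.sum_univ_two]
  rfl

theorem diffX_eq (F : Jet2 → ℝ) (θ : Jet2) : diffX F θ =
    (fun s => sig s θ) ⬝ᵥ ((orbitMat θ.2.1)⁻¹ᵀ *ᵥ fun i => totalD (Sum.inl i) F θ) := by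
  simp [diffX, dotProduct, Matrix.mulVec, Fin.sum_univ_two]
  ring

theorem TensorSemi.diffX {F : Jet2 → ℝ} (hF : TensorSemi 0 0 F) (h1 : FirstOrder F)
    (hs : ∀ θ ∈ metricJets, ContDiffAt ℝ ∞ F θ) : TransformsWith 0 0 (diffX F) metricJets := by
  intro P σ τ x hP _ hτ hc _ hd
  have hl := (eventually_tensorLaw hP hτ).self_of_nhds x.2
  have hg := hF.totalD_law h1 hs hP hτ hd
  rw [hc.jetAt_eq hP hτ hd, diffX_eq, diffX_eq, hl.orbitMat_law]
  set J := P.phiJac x.1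
  have hJ1 : J * J⁻¹ = 1 := Matrix.mul_nonsing_inv _ hP.2.2.1.isUnit
  have e1 : (fun s => sig s (jetAt (P.pull τ) x)) = Jᵀ *ᵥ fun s => sig s (jetAt τ (P.app x)) := by
    funext i
    rw [hl.sig_law hP.2.2.2]
    simp [Matrix.mulVec, dotProduct, Fin.sum_univ_two]
  have e2 : (fun i => totalD (Sum.inl i) F (jetAt (P.pull τ) x)) =
      Jᵀ *ᵥ fun i => totalD (Sum.inl i) F (jetAt τ (P.app x)) := by
    funext i
    rw [hg]
    simp [Matrix.mulVec, dotProduct, Fin.sum_univ_two]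
  change _ = _ * ((fun s => sig s (jetAt (P.pull τ) x)) ⬝ᵥ (_ *ᵥ
    fun i => totalD (Sum.inl i) F (jetAt (P.pull τ) x)))
  have key : ∀ (M : Matrix (Fin 2) (Fin 2) ℝ) (a b : Fin 2 → ℝ),
      (Jᵀ *ᵥ a) ⬝ᵥ (M *ᵥ (Jᵀ *ᵥ b)) = a ⬝ᵥ ((J * (M * Jᵀ)) *ᵥ b) := by
    intro M a b
    rw [Matrix.mulVec_mulVec, Matrix.mulVec_transpose, ← Matrix.dotProduct_mulVec,
      Matrix.mulVec_mulVec]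
  rw [e1, e2, key, Matrix.mul_inv_rev, Matrix.mul_inv_rev]
  have : J * ((J⁻¹ * ((orbitMat (jetAt τ (P.app x)).2.1)⁻¹ * (Jᵀ)⁻¹))ᵀ * Jᵀ) =
      (orbitMat (jetAt τ (P.app x)).2.1)⁻¹ᵀ := by
    rw [Matrix.transpose_mul, Matrix.transpose_mul, Matrix.transpose_nonsing_inv,
      Matrix.transpose_transpose, Matrix.mul_assoc, Matrix.mul_assoc, ← Matrix.transpose_mul, hJ1,
      Matrix.transpose_one, Matrix.mul_one, ← Matrix.mul_assoc, hJ1, Matrix.one_mul]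
  have hx : P.app (x.1, x.2) = P.app x := rfl
  rw [hx, this]
  simp

theorem TensorSemi.diffXperp {F : Jet2 → ℝ} (hF : TensorSemi 0 0 F) (h1 : FirstOrder F)
    (hs : ∀ θ ∈ metricJets, ContDiffAt ℝ ∞ F θ) : TransformsWith 1 0 (diffXperp F) metricJets := by
  intro P σ τ x hP _ hτ hc _ hd
  have hl := (eventually_tensorLaw hP hτ).self_of_nhds x.2
  have hg := hF.totalD_law h1 hs hP hτ hd
  rw [hc.jetAt_eq hP hτ hd]
  simp only [KillingJet.diffXperp, hg, hl.sig_law hP.2.2.2, hl.sqrt_detG]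
  have hJ := hP.2.2.1
  set J := P.phiJac x.1
  have hJ' : |J.det| ≠ 0 := abs_ne_zero.2 hJ
  have e5 : Real.sign J.det * J.det = |J.det| := sign_mul_self_abs hJ
  have hx : P.app (x.1, x.2) = P.app x := rfl
  rw [hx]
  set D0 := totalD (Sum.inl 0) F (jetAt τ (P.app x))
  set D1 := totalD (Sum.inl 1) F (jetAt τ (P.app x))
  set s0 := sig 0 (jetAt τ (P.app x))
  set s1 := sig 1 (jetAt τ (P.app x))
  set q := √|detG (jetAt τ (P.app x))|
  have e6 : (J 0 1 * s0 + J 1 1 * s1) / (|J.det| * q) * (J 0 0 * D0 + J 1 0 * D1) -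
      (J 0 0 * s0 + J 1 0 * s1) / (|J.det| * q) * (J 0 1 * D0 + J 1 1 * D1) =
      J.det * (s1 * D0 - s0 * D1) / (|J.det| * q) := by
    rw [Matrix.det_fin_two]; ring
  rw [pow_one, pow_zero, mul_one]
  refine Eq.trans ?_ (congrArg (Real.sign J.det * ·) e6).symm
  rw [← mul_div_assoc, ← mul_assoc, e5, mul_div_mul_left _ _ hJ']
  ring

/-! ### Polynomial transformations -/

/-- A cubic polynomial, given by its derivatives at the origin. -/
def cubicPoly (x : ℝ) (L : Fin 2 → ℝ) (q : Fin 3 → ℝ) (c : Fin 4 → ℝ) (y : Plane) : ℝ :=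
  x + (L 0 * y 0 + L 1 * y 1) + (q 0 * (y 0 ^ 2 / 2) + q 1 * (y 0 * y 1) + q 2 * (y 1 ^ 2 / 2)) +
    (c 0 * (y 0 ^ 3 / 6) + c 1 * (y 0 ^ 2 * y 1 / 2) + c 2 * (y 0 * y 1 ^ 2 / 2) +
      c 3 * (y 1 ^ 3 / 6))

/-- The position of the symmetric triple `(i, m)` in the list `111, 112, 122, 222`. -/
def cubIdx (i : Fin 2) (m : Fin 3) : Fin 4 := ⟨i.1 + m.1, by omega⟩

theorem contDiff_cubicPoly (x : ℝ) (L : Fin 2 → ℝ) (q : Fin 3 → ℝ) (c : Fin 4 → ℝ) :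
    ContDiff ℝ ∞ (cubicPoly x L q c) := by
  unfold cubicPoly; fun_prop

/-- The terms `t 0 - 0` and `t 1 - 0` are left unsimplified so that `pd_poly` applies to the result.
-/
theorem pd_cubicPoly (x : ℝ) (L : Fin 2 → ℝ) (q : Fin 3 → ℝ) (c : Fin 4 → ℝ) (i : Fin 2) :
    pd i (cubicPoly x L q c) = fun t : Plane => L i + ((t 0 - 0) * q (symIdx i 0) +
      (t 1 - 0) * q (symIdx i 1)) + ((t 0 - 0) ^ 2 / 2 * c (cubIdx i 0) +
        (t 0 - 0) * (t 1 - 0) * c (cubIdx i 1) + (t 1 - 0) ^ 2 / 2 * c (cubIdx i 2)) := by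
  have h0 : ∀ t : Plane, HasFDerivAt (fun t : Plane => t 0)
      (ContinuousLinearMap.proj (R := ℝ) (φ := fun _ : Fin 2 => ℝ) 0) t := fun t =>
    (ContinuousLinearMap.proj (R := ℝ) (φ := fun _ : Fin 2 => ℝ) 0).hasFDerivAt
  have h1 : ∀ t : Plane, HasFDerivAt (fun t : Plane => t 1)
      (ContinuousLinearMap.proj (R := ℝ) (φ := fun _ : Fin 2 => ℝ) 1) t := fun t =>
    (ContinuousLinearMap.proj (R := ℝ) (φ := fun _ : Fin 2 => ℝ) 1).hasFDerivAt
  funext t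
  have a0 := h0 t
  have a1 := h1 t
  have := ((((a0.const_mul (L 0)).add (a1.const_mul (L 1))).const_add x).add
    ((((a0.pow 2).const_mul (q 0 / 2)).add ((a0.mul a1).const_mul (q 1))).add
      ((a1.pow 2).const_mul (q 2 / 2)))).add
    (((((a0.pow 3).const_mul (c 0 / 6)).add (((a0.pow 2).mul a1).const_mul (c 1 / 2))).add
      ((a0.mul (a1.pow 2)).const_mul (c 2 / 2))).add ((a1.pow 3).const_mul (c 3 / 6)))
  have e := this.fderiv
  have e2 : cubicPoly x L q c = fun y => x + (L 0 * y 0 + L 1 * y 1) +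
      (q 0 / 2 * y 0 ^ 2 + q 1 * (y 0 * y 1) + q 2 / 2 * y 1 ^ 2) +
      (c 0 / 6 * y 0 ^ 3 + c 1 / 2 * (y 0 ^ 2 * y 1) + c 2 / 2 * (y 0 * y 1 ^ 2) +
      c 3 / 6 * y 1 ^ 3) := by
    funext y; unfold cubicPoly; ring
  rw [e2]
  simp only [pd]
  erw [e]
  fin_cases i <;> simp [symIdx, cubIdx] <;> ring

theorem scalarJet_pd_cubicPoly (x : ℝ) (L : Fin 2 → ℝ) (q : Fin 3 → ℝ) (c : Fin 4 → ℝ)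
    (i : Fin 2) : scalarJet (pd i (cubicPoly x L q c)) 0 =
      (L i, fun j => q (symIdx i j), fun j l => c (cubIdx i (symIdx j l))) := by
  have p := pd_poly (L i) (fun j => q (symIdx i j)) (fun m => c (cubIdx i m)) 0
  have p2 := fun j => pd_poly (q (symIdx i j)) (fun l => c (cubIdx i (symIdx j l))) 0 0
  simp only [Pi.zero_apply, mul_zero, add_zero] at p p2
  rw [pd_cubicPoly]
  refine Prod.ext ?_ (Prod.ext ?_ ?_)
  · simp [scalarJet]
  · funext j
    simp only [scalarJet, p]
    simp
  · funext j l
    simp only [scalarJet, p, p2, symIdx_comm j l]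

/-- The transformation with `φ` and `ψ` cubic polynomials. -/
def polyChange (x : Base) (L α : Matrix (Fin 2) (Fin 2) ℝ) (q : Fin 2 → Fin 3 → ℝ)
    (c : Fin 2 → Fin 4 → ℝ) (M : Fin 2 → Fin 2 → ℝ) (N : Fin 2 → Fin 3 → ℝ)
    (O : Fin 2 → Fin 4 → ℝ) : AdaptedChange where
  phi y k := cubicPoly (x.1 k) (L k) (q k) (c k) y
  psi y k := cubicPoly (x.2 k) (M k) (N k) (O k) y
  alpha := α

section PolyChange

variable (θ : Jet2) (L α : Matrix (Fin 2) (Fin 2) ℝ) (q : Fin 2 → Fin 3 → ℝ)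
  (c : Fin 2 → Fin 4 → ℝ) (M : Fin 2 → Fin 2 → ℝ) (N : Fin 2 → Fin 3 → ℝ) (O : Fin 2 → Fin 4 → ℝ)

theorem phi_polyChange (x : Base) : (polyChange x L α q c M N O).phi 0 = x.1 := by
  funext k; simp [polyChange, cubicPoly]

theorem app_polyChange (x : Base) : (polyChange x L α q c M N O).app 0 = x := by
  refine Prod.ext (phi_polyChange L α q c M N O x) ?_
  funext k; simp [AdaptedChange.app, polyChange, cubicPoly]

theorem contDiff_polyChange_phi (x : Base) : ContDiff ℝ ∞ (polyChange x L α q c M N O).phi :=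
  contDiff_pi.2 fun _ => contDiff_cubicPoly _ _ _ _

theorem contDiff_polyChange_psi (x : Base) : ContDiff ℝ ∞ (polyChange x L α q c M N O).psi :=
  contDiff_pi.2 fun _ => contDiff_cubicPoly _ _ _ _

theorem phiJet_polyChange (x : Base) (k i : Fin 2) :
    (polyChange x L α q c M N O).phiJet 0 k i =
      (L k i, fun j => q k (symIdx i j), fun j l => c k (cubIdx i (symIdx j l))) := by
  rw [← scalarJet_pd_cubicPoly (x.1 k)]
  refine congrArg (fun w => scalarJet w 0) (funext fun s => ?_)
  exact pd_apply ((contDiff_polyChange_phi L α q c M N O x).contDiffAt.differentiableAt (by simp))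
    i k

theorem psiJet_polyChange (x : Base) (k i : Fin 2) :
    (polyChange x L α q c M N O).psiJet 0 k i =
      (M k i, fun j => N k (symIdx i j), fun j l => O k (cubIdx i (symIdx j l))) := by
  rw [← scalarJet_pd_cubicPoly (x.2 k)]
  refine congrArg (fun w => scalarJet w 0) (funext fun s => ?_)
  exact pd_apply ((contDiff_polyChange_psi L α q c M N O x).contDiffAt.differentiableAt (by simp))
    i k

theorem phiJac_polyChange (x : Base) : (polyChange x L α q c M N O).phiJac 0 = L := by
  ext k i
  exact congrArg Prod.fst (phiJet_polyChange L α q c M N O x k i)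

variable {L α}

theorem regularAt_polyChange (x : Base) (hL : L.det ≠ 0) (hα : α.det ≠ 0) :
    (polyChange x L α q c M N O).RegularAt 0 :=
  ⟨(contDiff_polyChange_phi L α q c M N O x).contDiffAt,
    (contDiff_polyChange_psi L α q c M N O x).contDiffAt, by rwa [phiJac_polyChange], hα⟩

/-- The pullback of a jet under a polynomial transformation of the origin to its base point. -/
def polyPull (L α : Matrix (Fin 2) (Fin 2) ℝ) (q : Fin 2 → Fin 3 → ℝ)
    (c : Fin 2 → Fin 4 → ℝ) (M : Fin 2 → Fin 2 → ℝ) (N : Fin 2 → Fin 3 → ℝ) (O : Fin 2 → Fin 4 → ℝ)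
    (θ : Jet2) : Jet2 :=
  jetAt ((polyChange θ.1 L α q c M N O).pull (polySec θ)) 0

theorem rel_polyPull (hL : L.det ≠ 0) (hα : α.det ≠ 0) :
    Rel (Real.sign L.det) (Real.sign α.det) (polyPull L α q c M N O θ) θ := by
  have := rel_of_jet (P := polyChange θ.1 L α q c M N O) (θ := polyPull L α q c M N O θ) (θ' := θ)
    (regularAt_polyChange q c M N O θ.1 hL hα) (app_polyChange L α q c M N O θ.1) rfl
  have e : (polyPull L α q c M N O θ).1.1 = 0 := rfl
  rwa [e, phiJac_polyChange] at this

theorem tensorLaw_polyPull (hL : L.det ≠ 0) (hα : α.det ≠ 0) :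
    TensorLaw L α (polyPull L α q c M N O θ) θ := by
  have h := (eventually_tensorLaw (regularAt_polyChange q c M N O θ.1 hL hα)
    (contDiff_polySec θ).contDiffAt).self_of_nhds 0
  rw [phiJac_polyChange] at h
  have e : (polyChange θ.1 L α q c M N O).app (0, 0) = θ.1 := app_polyChange L α q c M N O θ.1
  rw [e, jetAt_polySec] at h
  exact h

theorem compJet_polyPull_G (hL : L.det ≠ 0) (hα : α.det ≠ 0) (i j : Fin 2) :
    compJet (compG (symIdx i j)) (polyPull L α q c M N O θ) = ∑ k, ∑ l, jmul (jmul
      (L k i, fun j => q k (symIdx i j), fun j l => c k (cubIdx i (symIdx j l)))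
      (jcomp (compJet (compG (symIdx k l)) θ)
        fun k i => (L k i, fun j => q k (symIdx i j), fun j l => c k (cubIdx i (symIdx j l)))))
      (L l j, fun i => q l (symIdx j i), fun i k => c l (cubIdx j (symIdx i k))) := by
  have hR := regularAt_polyChange q c M N O θ.1 hL hα
  have := compJet_pull_G (x := 0) hR (contDiff_polySec θ).contDiffAt i j
  rw [app_polyChange, jetAt_polySec] at this
  refine this.trans ?_
  have e : (polyChange θ.1 L α q c M N O).phiJet (0 : Base).1 = fun k i =>
    (L k i, fun j => q k (symIdx i j), fun j l => c k (cubIdx i (symIdx j l))) :=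
    funext fun k => funext fun i => phiJet_polyChange L α q c M N O θ.1 k i
  rw [e]

theorem compJet_polyPull_H (hL : L.det ≠ 0) (hα : α.det ≠ 0) (i j : Fin 2) :
    compJet (compH (symIdx i j)) (polyPull L α q c M N O θ) = ∑ k, ∑ l, (α k i * α l j) •
      (jcomp (compJet (compH (symIdx k l)) θ)
        fun k i => (L k i, fun j => q k (symIdx i j), fun j l => c k (cubIdx i (symIdx j l)))) := by
  have hR := regularAt_polyChange q c M N O θ.1 hL hα
  have := compJet_pull_H (x := 0) hR (contDiff_polySec θ).contDiffAt i j
  rw [app_polyChange, jetAt_polySec] at this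
  refine this.trans ?_
  have e : (polyChange θ.1 L α q c M N O).phiJet (0 : Base).1 = fun k i =>
    (L k i, fun j => q k (symIdx i j), fun j l => c k (cubIdx i (symIdx j l))) :=
    funext fun k => funext fun i => phiJet_polyChange L α q c M N O θ.1 k i
  rw [e]
  rfl

theorem compJet_polyPull_F (hL : L.det ≠ 0) (hα : α.det ≠ 0) (i k : Fin 2) :
    compJet (compF i k) (polyPull L α q c M N O θ) = ∑ l, α⁻¹ k l • (∑ j, jmul
      (L j i, fun m => q j (symIdx i m), fun m n => c j (cubIdx i (symIdx m n)))
      (jcomp (compJet (compF j l) θ)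
        fun k i => (L k i, fun j => q k (symIdx i j), fun j l => c k (cubIdx i (symIdx j l)))) +
      (M l i, fun j => N l (symIdx i j), fun j m => O l (cubIdx i (symIdx j m)))) := by
  have hR := regularAt_polyChange q c M N O θ.1 hL hα
  have := compJet_pull_F (x := 0) hR (contDiff_polySec θ).contDiffAt i k
  rw [app_polyChange, jetAt_polySec] at this
  refine this.trans ?_
  have e : (polyChange θ.1 L α q c M N O).phiJet (0 : Base).1 = fun k i =>
    (L k i, fun j => q k (symIdx i j), fun j l => c k (cubIdx i (symIdx j l))) :=
    funext fun k => funext fun i => phiJet_polyChange L α q c M N O θ.1 k i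
  have e' : (polyChange θ.1 L α q c M N O).psiJet (0 : Base).1 = fun k i =>
    (M k i, fun j => N k (symIdx i j), fun j l => O k (cubIdx i (symIdx j l))) :=
    funext fun k => funext fun i => psiJet_polyChange L α q c M N O θ.1 k i
  rw [e, e']
  rfl

end PolyChange

/-! ### Normal forms -/

/-- Jets at the origin in normal form. -/
def normalJet (c₁ c₂ κ : ℝ) (h : Fin 3 → ℝ) (H : Fin 2 → Fin 3 → ℝ) (K : Fin 3 → Fin 3 → ℝ)
    (c d e : Fin 2 → ℝ) : Jet2 :=
  (0, (![c₁, 0, c₂], 0, h), ![(0, 0, H 0), (0, ![c, 0], H 1)],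
    ![(0, 0, K 0), (![0, κ, 0], ![d, 0], K 1), (0, ![e, 0], K 2)])

/-- The first derivatives of `g̃` after a linear change of coordinates. -/
def linG (L : Matrix (Fin 2) (Fin 2) ℝ) (θ : Jet2) (i : Fin 2) : Fin 3 → ℝ :=
  L 0 i • congrTriple L (θ.2.2.1 0).1 + L 1 i • congrTriple L (θ.2.2.1 1).1

/-- The first derivatives of `h` after a linear change of coordinates. -/
def linH (L α : Matrix (Fin 2) (Fin 2) ℝ) (θ : Jet2) (i : Fin 2) : Fin 3 → ℝ :=
  L 0 i • congrTriple α (θ.2.2.1 0).2.2 + L 1 i • congrTriple α (θ.2.2.1 1).2.2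

/-- The second derivatives of `h` after a linear change of coordinates. -/
def linHH (L α : Matrix (Fin 2) (Fin 2) ℝ) (θ : Jet2) (m : Fin 3) : Fin 3 → ℝ :=
  congrTriple α (![L 0 0 ^ 2 • (θ.2.2.2 0).2.2 + (2 * (L 0 0 * L 1 0)) • (θ.2.2.2 1).2.2 +
      L 1 0 ^ 2 • (θ.2.2.2 2).2.2,
    (L 0 0 * L 0 1) • (θ.2.2.2 0).2.2 + (L 0 0 * L 1 1 + L 1 0 * L 0 1) • (θ.2.2.2 1).2.2 +
      (L 1 0 * L 1 1) • (θ.2.2.2 2).2.2,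
    L 0 1 ^ 2 • (θ.2.2.2 0).2.2 + (2 * (L 0 1 * L 1 1)) • (θ.2.2.2 1).2.2 +
      L 1 1 ^ 2 • (θ.2.2.2 2).2.2] m)

/-- The negatives of the Christoffel symbols of a diagonal metric with given first derivatives. -/
def geodCoef (c₁ c₂ : ℝ) (G : Fin 2 → Fin 3 → ℝ) : Fin 2 → Fin 3 → ℝ :=
  ![![-G 0 0 / (2 * c₁), -G 1 0 / (2 * c₁), -(G 1 1 - G 0 2 / 2) / c₁],
    ![-(G 0 1 - G 1 0 / 2) / c₂, -G 0 2 / (2 * c₂), -G 1 2 / (2 * c₂)]]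

/-- The second covariant derivatives of `h` in the given frames. -/
def covHess (L α : Matrix (Fin 2) (Fin 2) ℝ) (c₁ c₂ : ℝ) (θ : Jet2) (m : Fin 3) : Fin 3 → ℝ :=
  linHH L α θ m + (geodCoef c₁ c₂ (linG L θ) 0 m • linH L α θ 0 +
    geodCoef c₁ c₂ (linG L θ) 1 m • linH L α θ 1)

theorem congrTriple_one (p : Fin 3 → ℝ) : congrTriple 1 p = p := by
  funext m; fin_cases m <;> simp [congrTriple]

theorem firstG_polyPull_linear (θ : Jet2) {L α : Matrix (Fin 2) (Fin 2) ℝ} (hL : L.det ≠ 0)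
    (hα : α.det ≠ 0) (i : Fin 2) :
    ((polyPull L α 0 0 0 0 0 θ).2.2.1 i).1 = linG L θ i := by
  have h := fun a b => congrArg (·.2.1 i) (compJet_polyPull_G θ 0 0 0 0 0 hL hα a b)
  simp only [compJet, compG_apply] at h
  funext m
  obtain ⟨a, b, rfl⟩ := exists_symIdx m
  rw [h]
  fin_cases a <;> fin_cases b <;>
    simp [Fin.sum_univ_two, jmul, jcomp, linG, congrTriple, symIdx] <;> ring

theorem secondH_polyPull_linear (θ : Jet2) {L α : Matrix (Fin 2) (Fin 2) ℝ} (hL : L.det ≠ 0)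
    (hα : α.det ≠ 0) (m : Fin 3) :
    ((polyPull L α 0 0 0 0 0 θ).2.2.2 m).2.2 = linHH L α θ m := by
  obtain ⟨i, j, rfl⟩ := exists_symIdx m
  have h := fun a b => congrArg (·.2.2 i j) (compJet_polyPull_H θ 0 0 0 0 0 hL hα a b)
  simp only [compJet, compH_apply] at h
  funext m
  obtain ⟨a, b, rfl⟩ := exists_symIdx m
  rw [h]
  fin_cases a <;> fin_cases b <;> fin_cases i <;> fin_cases j <;>
    simp [Fin.sum_univ_two, jcomp, linHH, congrTriple, symIdx] <;> ring

theorem eq_zero_or_one : ∀ i : Fin 2, i = 0 ∨ i = 1 := by decide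

theorem curvF_one {θ θ' : Jet2} (h : TensorLaw 1 1 θ θ') (k : Fin 2) : curvF k θ = curvF k θ' := by
  have := h.curvature k
  rcases eq_zero_or_one k with rfl | rfl <;> simpa using this

theorem killDeriv_one {θ θ' : Jet2} (h : TensorLaw 1 1 θ θ') (i : Fin 2) :
    (θ.2.2.1 i).2.2 = (θ'.2.2.1 i).2.2 := by
  have := h.killDeriv i
  rw [congrTriple_one, congrTriple_one] at this
  rcases eq_zero_or_one i with rfl | rfl <;> simpa using this

section Quadratic

variable (θ : Jet2) (q : Fin 2 → Fin 3 → ℝ)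

/-- Passage to coordinates in which the Christoffel symbols of g̃ vanish at the point. -/
theorem firstG_polyPull_quadratic {c₁ c₂ : ℝ} (hc₁ : c₁ ≠ 0) (hc₂ : c₂ ≠ 0)
    (hθ : θ.2.1.1 = ![c₁, 0, c₂]) (i : Fin 2) :
    ((polyPull 1 1 (geodCoef c₁ c₂ fun i => (θ.2.2.1 i).1) 0 0 0 0 θ).2.2.1 i).1 = 0 := by
  have h := fun a b => congrArg (·.2.1 i) (compJet_polyPull_G θ
    (geodCoef c₁ c₂ fun i => (θ.2.2.1 i).1) 0 0 0 0 (L := 1) (α := 1) (by simp) (by simp) a b)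
  simp only [compJet, compG_apply] at h
  have g0 : θ.2.1.1 0 = c₁ := by rw [hθ]; rfl
  have g1 : θ.2.1.1 1 = 0 := by rw [hθ]; rfl
  have g2 : θ.2.1.1 2 = c₂ := by rw [hθ]; rfl
  funext m
  obtain ⟨a, b, rfl⟩ := exists_symIdx m
  rw [h]
  rcases eq_zero_or_one a with rfl | rfl <;> rcases eq_zero_or_one b with rfl | rfl <;> rcases eq_zero_or_one i with rfl | rfl <;>
    simp [Fin.sum_univ_two, jmul, jcomp, symIdx, g0, g1, g2, geodCoef] <;> field_simp <;> ring

/-- With `q` the negative of the Christoffel symbols, the right side is the second covariant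
derivative of h. -/
theorem secondH_polyPull_quadratic (m : Fin 3) :
    ((polyPull 1 1 q 0 0 0 0 θ).2.2.2 m).2.2 =
      (θ.2.2.2 m).2.2 + (q 0 m • (θ.2.2.1 0).2.2 + q 1 m • (θ.2.2.1 1).2.2) := by
  obtain ⟨i, j, rfl⟩ := exists_symIdx m
  have h := fun a b => congrArg (·.2.2 i j) (compJet_polyPull_H θ q 0 0 0 0 (L := 1) (α := 1)
    (by simp) (by simp) a b)
  simp only [compJet, compH_apply] at h
  funext m
  obtain ⟨a, b, rfl⟩ := exists_symIdx m
  rw [h]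
  rcases eq_zero_or_one a with rfl | rfl <;> rcases eq_zero_or_one b with rfl | rfl <;> rcases eq_zero_or_one i with rfl | rfl <;> rcases eq_zero_or_one j with rfl | rfl <;>
    simp [Fin.sum_univ_two, jcomp, symIdx] <;> ring

end Quadratic

section Cubic

variable (θ : Jet2) (c : Fin 2 → Fin 4 → ℝ)

/-- The cubic coefficients that remove the second derivatives of `g̃_11` and `g̃_22`, and two of the
three second derivatives of `g̃_12`. -/
def cubicCoef (c₁ c₂ : ℝ) (G : Fin 3 → Fin 3 → ℝ) : Fin 2 → Fin 4 → ℝ :=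
  ![![-G 0 0 / (2 * c₁), -G 1 0 / (2 * c₁), -G 2 0 / (2 * c₁), -(G 2 1 - G 1 2 / 2) / c₁],
    ![-(G 0 1 - G 1 0 / 2) / c₂, -G 0 2 / (2 * c₂), -G 1 2 / (2 * c₂), -G 2 2 / (2 * c₂)]]

theorem firstG_polyPull_cubic (i : Fin 2) :
    ((polyPull 1 1 0 c 0 0 0 θ).2.2.1 i).1 = (θ.2.2.1 i).1 := by
  have h := fun a b => congrArg (·.2.1 i) (compJet_polyPull_G θ 0 c 0 0 0 (L := 1) (α := 1)
    (by simp) (by simp) a b)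
  simp only [compJet, compG_apply] at h
  funext m
  obtain ⟨a, b, rfl⟩ := exists_symIdx m
  rw [h]
  rcases eq_zero_or_one a with rfl | rfl <;> rcases eq_zero_or_one b with rfl | rfl <;> rcases eq_zero_or_one i with rfl | rfl <;>
    simp [Fin.sum_univ_two, jmul, jcomp, symIdx]

/-- The eight cubic coefficients are set against nine second derivatives of g̃. One number survives;
when the first derivatives vanish it is, up to sign, the curvature component R_1212. -/
theorem secondG_polyPull_cubic {c₁ c₂ : ℝ} (hc₁ : c₁ ≠ 0) (hc₂ : c₂ ≠ 0)
    (hθ : θ.2.1.1 = ![c₁, 0, c₂]) :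
    ∃ κ, ∀ m, ((polyPull 1 1 0 (cubicCoef c₁ c₂ fun m => (θ.2.2.2 m).1) 0 0 0 θ).2.2.2 m).1 =
      ![0, ![0, κ, 0], 0] m := by
  refine ⟨((polyPull 1 1 0 (cubicCoef c₁ c₂ fun m => (θ.2.2.2 m).1) 0 0 0 θ).2.2.2 1).1 1, ?_⟩
  intro m
  obtain ⟨i, j, rfl⟩ := exists_symIdx m
  have h := fun i j a b => congrArg (·.2.2 i j) (compJet_polyPull_G θ 0
    (cubicCoef c₁ c₂ fun m => (θ.2.2.2 m).1) 0 0 0 (L := 1) (α := 1) (by simp) (by simp) a b)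
  simp only [compJet, compG_apply] at h
  have g0 : θ.2.1.1 0 = c₁ := by rw [hθ]; rfl
  have g1 : θ.2.1.1 1 = 0 := by rw [hθ]; rfl
  have g2 : θ.2.1.1 2 = c₂ := by rw [hθ]; rfl
  funext m
  obtain ⟨a, b, rfl⟩ := exists_symIdx m
  rcases eq_zero_or_one a with rfl | rfl <;> rcases eq_zero_or_one b with rfl | rfl <;> rcases eq_zero_or_one i with rfl | rfl <;> rcases eq_zero_or_one j with rfl | rfl <;> first | rfl | skip
  all_goals
    refine (h _ _ _ _).trans ?_
    simp [Fin.sum_univ_two, jmul, jcomp, symIdx, cubIdx, g0, g1, g2, cubicCoef]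
    try field_simp
    try ring

theorem secondH_polyPull_cubic (m : Fin 3) :
    ((polyPull 1 1 0 c 0 0 0 θ).2.2.2 m).2.2 = (θ.2.2.2 m).2.2 := by
  obtain ⟨i, j, rfl⟩ := exists_symIdx m
  have h := fun a b => congrArg (·.2.2 i j) (compJet_polyPull_H θ 0 c 0 0 0 (L := 1) (α := 1)
    (by simp) (by simp) a b)
  simp only [compJet, compH_apply] at h
  funext m
  obtain ⟨a, b, rfl⟩ := exists_symIdx m
  rw [h]
  rcases eq_zero_or_one a with rfl | rfl <;> rcases eq_zero_or_one b with rfl | rfl <;> rcases eq_zero_or_one i with rfl | rfl <;> rcases eq_zero_or_one j with rfl | rfl <;>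
    simp [Fin.sum_univ_two, jcomp, symIdx]

end Cubic

section Shift

variable (θ : Jet2) (M : Fin 2 → Fin 2 → ℝ) (N : Fin 2 → Fin 3 → ℝ) (O : Fin 2 → Fin 4 → ℝ)

theorem compJet_G_polyPull_shift (m : Fin 3) :
    compJet (compG m) (polyPull 1 1 0 0 M N O θ) = compJet (compG m) θ := by
  obtain ⟨a, b, rfl⟩ := exists_symIdx m
  rw [compJet_polyPull_G θ 0 0 M N O (by simp) (by simp)]
  rcases eq_zero_or_one a with rfl | rfl <;> rcases eq_zero_or_one b with rfl | rfl <;>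
    refine Prod.ext ?_ (Prod.ext (funext fun i => ?_) (funext fun i => funext fun j => ?_)) <;>
    (try rcases eq_zero_or_one i with rfl | rfl) <;> (try rcases eq_zero_or_one j with rfl | rfl) <;>
    simp [Fin.sum_univ_two, jmul, jcomp, symIdx]

theorem compJet_H_polyPull_shift (m : Fin 3) :
    compJet (compH m) (polyPull 1 1 0 0 M N O θ) = compJet (compH m) θ := by
  obtain ⟨a, b, rfl⟩ := exists_symIdx m
  rw [compJet_polyPull_H θ 0 0 M N O (by simp) (by simp)]
  rcases eq_zero_or_one a with rfl | rfl <;> rcases eq_zero_or_one b with rfl | rfl <;>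
    refine Prod.ext ?_ (Prod.ext (funext fun i => ?_) (funext fun i => funext fun j => ?_)) <;>
    (try rcases eq_zero_or_one i with rfl | rfl) <;> (try rcases eq_zero_or_one j with rfl | rfl) <;>
    simp [Fin.sum_univ_two, jcomp]

/-- The 1-form fᵏ changes by the exact form dψᵏ, so its curvature is untouched. -/
theorem compJet_F_polyPull_shift (i k : Fin 2) :
    compJet (compF i k) (polyPull 1 1 0 0 M N O θ) = compJet (compF i k) θ +
      (M k i, fun j => N k (symIdx i j), fun j m => O k (cubIdx i (symIdx j m))) := by
  rw [compJet_polyPull_F θ 0 0 M N O (by simp) (by simp)]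
  rcases eq_zero_or_one i with rfl | rfl <;> rcases eq_zero_or_one k with rfl | rfl <;>
    refine Prod.ext ?_ (Prod.ext (funext fun a => ?_) (funext fun a => funext fun b => ?_)) <;>
    (try rcases eq_zero_or_one a with rfl | rfl) <;> (try rcases eq_zero_or_one b with rfl | rfl) <;>
    simp [Fin.sum_univ_two, jmul, jcomp]

end Shift

/-- Every jet of a metric is brought to normal form by a transformation with prescribed linear part,
provided that this linear part diagonalizes the orbit metric. -/
theorem exists_rel_normalJet {θ : Jet2} {L α : Matrix (Fin 2) (Fin 2) ℝ} (hL : L.det ≠ 0)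
    (hα : α.det ≠ 0) {c₁ c₂ : ℝ} (hc₁ : c₁ ≠ 0) (hc₂ : c₂ ≠ 0)
    (hθ : congrTriple L θ.2.1.1 = ![c₁, 0, c₂]) (c : Fin 2 → ℝ)
    (hc : ∀ k, α k 0 * c 0 + α k 1 * c 1 = L.det * curvF k θ) :
    ∃ κ d e, Rel (Real.sign L.det) (Real.sign α.det)
      (normalJet c₁ c₂ κ (congrTriple α θ.2.1.2.2) (linH L α θ) (covHess L α c₁ c₂ θ) c d e) θ := by
  have one : (1 : Matrix (Fin 2) (Fin 2) ℝ).det ≠ 0 := by simp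
  -- Four successive transformations: the linear part, a quadratic one for the first derivatives of
  -- g̃, a cubic one for its second derivatives, and a shift along the fibres. Each preserves what
  -- the previous ones achieved.
  set θ₁ := polyPull L α 0 0 0 0 0 θ with h₁
  have T₁ : TensorLaw L α θ₁ θ := tensorLaw_polyPull θ 0 0 0 0 0 hL hα
  have G₁ : θ₁.2.1.1 = ![c₁, 0, c₂] := T₁.orbit.trans hθ
  set q := geodCoef c₁ c₂ fun i => (θ₁.2.2.1 i).1 with hq
  set θ₂ := polyPull 1 1 q 0 0 0 0 θ₁ with h₂
  have T₂ : TensorLaw 1 1 θ₂ θ₁ := tensorLaw_polyPull θ₁ q 0 0 0 0 one one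
  have G₂ : θ₂.2.1.1 = ![c₁, 0, c₂] := by rw [T₂.orbit, congrTriple_one, G₁]
  set t := cubicCoef c₁ c₂ fun m => (θ₂.2.2.2 m).1 with ht
  set θ₃ := polyPull 1 1 0 t 0 0 0 θ₂ with h₃
  have T₃ : TensorLaw 1 1 θ₃ θ₂ := tensorLaw_polyPull θ₂ 0 t 0 0 0 one one
  have G₃ : θ₃.2.1.1 = ![c₁, 0, c₂] := by rw [T₃.orbit, congrTriple_one, G₂]
  have dG₃ : ∀ i, (θ₃.2.2.1 i).1 = 0 := fun i =>
    (firstG_polyPull_cubic θ₂ t i).trans (firstG_polyPull_quadratic θ₁ hc₁ hc₂ G₁ i)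
  obtain ⟨κ, ddG₃⟩ := secondG_polyPull_cubic θ₂ hc₁ hc₂ G₂
  rw [← ht, ← h₃] at ddG₃
  have H₃ : θ₃.2.1.2.2 = congrTriple α θ.2.1.2.2 := by
    rw [T₃.kill, congrTriple_one, T₂.kill, congrTriple_one, T₁.kill]
  have dH₁ : ∀ i, (θ₁.2.2.1 i).2.2 = linH L α θ i := T₁.killDeriv
  have dH₃ : ∀ i, (θ₃.2.2.1 i).2.2 = linH L α θ i := fun i => by
    rw [killDeriv_one T₃, killDeriv_one T₂, dH₁]
  have ddH₃ : ∀ m, (θ₃.2.2.2 m).2.2 = covHess L α c₁ c₂ θ m := fun m => by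
    rw [h₃, secondH_polyPull_cubic, h₂, secondH_polyPull_quadratic, dH₁, dH₁, h₁,
      secondH_polyPull_linear θ hL hα, covHess, hq]
    have : (fun i => (θ₁.2.2.1 i).1) = linG L θ := funext fun i =>
      firstG_polyPull_linear θ hL hα i
    rw [this]
  have C₃ : ∀ k, curvF k θ₃ = c k := by
    have h3 := T₁.curvature
    rw [← curvF_one T₂, ← curvF_one T₃, ← curvF_one T₂, ← curvF_one T₃] at h3
    have a := (h3 0).trans (hc 0).symm
    have b := (h3 1).trans (hc 1).symm
    -- Cramer's rule for the invertible `α`: the curvature and `c` solve the same linear system.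
    have e0 : α.det * (curvF 0 θ₃ - c 0) = 0 := by
      rw [Matrix.det_fin_two]; linear_combination α 1 1 * a - α 0 1 * b
    have e1 : α.det * (curvF 1 θ₃ - c 1) = 0 := by
      rw [Matrix.det_fin_two]; linear_combination α 0 0 * b - α 1 0 * a
    intro k
    rcases eq_zero_or_one k with rfl | rfl
    · exact sub_eq_zero.1 ((mul_eq_zero.1 e0).resolve_left hα)
    · exact sub_eq_zero.1 ((mul_eq_zero.1 e1).resolve_left hα)
  -- the shifts are removed by a transformation of the fibres
  set M : Fin 2 → Fin 2 → ℝ := fun k i => -θ₃.2.1.2.1 i k with hM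
  set N : Fin 2 → Fin 3 → ℝ := fun k =>
    ![-(θ₃.2.2.1 0).2.1 0 k, -(θ₃.2.2.1 0).2.1 1 k, -(θ₃.2.2.1 1).2.1 1 k] with hN
  set O : Fin 2 → Fin 4 → ℝ := fun k =>
    ![-(θ₃.2.2.2 0).2.1 0 k, -(θ₃.2.2.2 0).2.1 1 k, -(θ₃.2.2.2 1).2.1 1 k,
      -(θ₃.2.2.2 2).2.1 1 k] with hO
  -- The second derivatives of ψᵏ absorb three of the four first derivatives of fᵏ, and the third
  -- ones absorb four of its six second derivatives. What is left are f_1ᵏ,2 − f_2ᵏ,1 and its two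
  -- derivatives, which form `c`, `d` and `e`.
  refine ⟨κ, fun k => (θ₃.2.2.2 1).2.1 0 k + O k 1, fun k => (θ₃.2.2.2 2).2.1 0 k + O k 2, ?_⟩
  have R₁ : Rel (Real.sign L.det) (Real.sign α.det) θ₁ θ := rel_polyPull θ 0 0 0 0 0 hL hα
  have R₂ : Rel 1 1 θ₂ θ₁ := by simpa using rel_polyPull θ₁ q 0 0 0 0 one one
  have R₃ : Rel 1 1 θ₃ θ₂ := by simpa using rel_polyPull θ₂ 0 t 0 0 0 one one
  have R₄ : Rel 1 1 (polyPull 1 1 0 0 M N O θ₃) θ₃ := by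
    simpa using rel_polyPull θ₃ 0 0 M N O one one
  have R := ((R₄.trans R₃).trans R₂).trans R₁
  simp only [mul_one] at R
  convert R using 1
  refine jet_ext rfl (fun m => ?_) (fun i k => ?_) fun m => ?_
  · rw [compJet_G_polyPull_shift]
    refine Prod.ext ?_ (Prod.ext (funext fun i => ?_) (funext fun i => funext fun j => ?_))
    · exact (congrFun G₃ m).symm
    · refine Eq.trans ?_ (congrFun (dG₃ i) m).symm
      rcases eq_zero_or_one i with rfl | rfl <;> rfl
    · refine Eq.trans ?_ (congrFun (ddG₃ (symIdx i j)) m).symm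
      rcases eq_zero_or_one i with rfl | rfl <;> rcases eq_zero_or_one j with rfl | rfl <;> rfl
  · rw [compJet_F_polyPull_shift]
    have hk := C₃ k
    unfold curvF at hk
    refine Prod.ext ?_ (Prod.ext (funext fun a => ?_) (funext fun a => funext fun b => ?_)) <;>
    rcases eq_zero_or_one i with rfl | rfl <;> (try rcases eq_zero_or_one a with rfl | rfl) <;>
    (try rcases eq_zero_or_one b with rfl | rfl) <;>
    simp [compJet, normalJet, symIdx, cubIdx, hM, hN, hO] <;> linarith
  · rw [compJet_H_polyPull_shift]
    refine Prod.ext ?_ (Prod.ext (funext fun i => ?_) (funext fun i => funext fun j => ?_))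
    · exact (congrFun H₃ m).symm
    · refine Eq.trans ?_ (congrFun (dH₃ i) m).symm
      rcases eq_zero_or_one i with rfl | rfl <;> rfl
    · refine Eq.trans ?_ (congrFun (ddH₃ (symIdx i j)) m).symm
      rcases eq_zero_or_one i with rfl | rfl <;> rcases eq_zero_or_one j with rfl | rfl <;> rfl

/-! ### The Ricci tensor at jets in normal form -/

section RicciAlg

variable (n : Idx → ℝ) (A : Idx → Idx → Idx → ℝ) (B : Idx → Idx → Idx → Idx → ℝ)

/-- Christoffel symbols computed from a diagonal inverse metric `n` and the first derivatives
`A a c d = ∂_a g_cd`. -/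
def chrAlg (c a b : Idx) : ℝ := n c * ((A a c b + A b a c - A c a b) / 2)

/-- Their derivatives, computed from the second derivatives `B a b c d = ∂_a ∂_b g_cd`. -/
def dchrAlg (e c a b : Idx) : ℝ :=
  n c * ((B e a c b + B e b a c - B e c a b) / 2 - ∑ f, A e c f * chrAlg n A f a b)

/-- The Ricci tensor computed from the derivatives of the metric. -/
def ricciAlg (a b : Idx) : ℝ :=
  (∑ c, (dchrAlg n A B c c a b - dchrAlg n A B b c a c)) +
    ∑ c, ∑ d, (chrAlg n A c c d * chrAlg n A d a b - chrAlg n A c b d * chrAlg n A d a c)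

end RicciAlg

/-- The derivatives of Γ come from differentiating the product G·Γ, which equals the lowered symbol.
The inverse matrix is then needed only at the point itself, where it is diagonal. -/
theorem ricciMat_eq_ricciAlg {G : Plane → Matrix Idx Idx ℝ} {t : Plane}
    (hG : ∀ a b, ContDiffAt ℝ ∞ (fun s => G s a b) t) {n : Idx → ℝ} (hn : ∀ a, n a ≠ 0)
    (hGt : G t = Matrix.diagonal n) (a b : Idx) :
    ricciMat G t a b = ricciAlg (fun a => (n a)⁻¹) (fun a c d => coordD a (fun s => G s c d) t)
      (fun a b c d => coordD a (coordD b fun s => G s c d) t) a b := by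
  have hd : ∀ᶠ s in 𝓝 t, (G s).det ≠ 0 :=
    (contDiffAt_matrix_det hG).continuousAt.eventually_ne (by
      rw [hGt, Matrix.det_diagonal]; exact Finset.prod_ne_zero_iff.2 fun i _ => hn i)
  have hdt := hd.self_of_nhds
  have hinv : (G t)⁻¹ = Matrix.diagonal fun a => (n a)⁻¹ := by
    refine Matrix.inv_eq_right_inv ?_
    rw [hGt, Matrix.diagonal_mul_diagonal]
    simp [hn]
  have hchr : ∀ c a b, chrSym G c a b t = chrAlg (fun a => (n a)⁻¹)
      (fun a c d => coordD a (fun s => G s c d) t) c a b := by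
    intro c a b
    simp only [chrSym, hinv, chrAlg, Matrix.diagonal_apply, ite_mul, zero_mul, Finset.sum_ite_eq,
      Finset.mem_univ, if_true]
    ring
  have hd1 : ∀ a c d, DifferentiableAt ℝ (coordD a fun s => G s c d) t := by
    intro a c d
    rcases a with i | k
    · exact differentiableAt_of_smooth (contDiffAt_pd (hG c d) i)
    · exact differentiableAt_const _
  have hGd : MatDiff G t := fun c b => differentiableAt_of_smooth (hG c b)
  have hconn : ∀ a, MatDiff (connMat G a) t := matDiff_connMat hG hdt
  have hdchr : ∀ e c a b, coordD e (chrSym G c a b) t = dchrAlg (fun a => (n a)⁻¹)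
      (fun a c d => coordD a (fun s => G s c d) t)
      (fun a b c d => coordD a (coordD b fun s => G s c d) t) e c a b := by
    intro e c a b
    have h1 : matD e (fun s => G s * connMat G a s) t = matD e (lowConn G a) t := by
      refine matD_congr (hd.mono fun s hs => ?_) e
      simp only [connMat_eq, ← Matrix.mul_assoc]
      rw [Matrix.mul_nonsing_inv _ (isUnit_iff_ne_zero.2 hs), Matrix.one_mul]
    rw [matD_mul hGd (hconn a)] at h1
    have h2 := congrFun (congrFun h1 c) b
    have h3 : matD e (lowConn G a) t c b = 1 / 2 * (coordD e (coordD a fun s => G s c b) t +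
        coordD e (coordD b fun s => G s a c) t - coordD e (coordD c fun s => G s a b) t) := by
      have h4 : (fun s => lowConn G a s c b) = fun s => 1 / 2 * (coordD a (fun s => G s c b) s +
        coordD b (fun s => G s a c) s - coordD c (fun s => G s a b) s) := rfl
      simp only [matD, Matrix.of_apply, h4]
      rcases e with i | k
      · simp only [coordD.eq_1]
        rw [pd_const_mul _ (((hd1 a c b).fun_add (hd1 b a c)).fun_sub (hd1 c a b)),
          pd_sub ((hd1 a c b).fun_add (hd1 b a c)) (hd1 c a b), pd_add (hd1 a c b) (hd1 b a c)]
      · simp [coordD]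
    rw [h3, Matrix.add_apply, hGt, Matrix.diagonal_mul, Matrix.mul_apply] at h2
    have h5 : matD e (connMat G a) t c b = coordD e (chrSym G c a b) t := rfl
    have h6 : ∑ f, matD e G t c f * connMat G a t f b = ∑ f, coordD e (fun s => G s c f) t *
        chrAlg (fun a => (n a)⁻¹) (fun a c d => coordD a (fun s => G s c d) t) f a b :=
      Finset.sum_congr rfl fun f _ => by
        rw [← hchr]; rfl
    rw [h5, h6] at h2
    rw [dchrAlg]
    rw [eq_inv_mul_iff_mul_eq₀ (hn c)]
    linear_combination h2
  simp only [ricciMat, Matrix.of_apply, hchr, hdchr, ricciAlg]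

/-- The 2-jets of the components of the metric. -/
def metricJet (θ : Jet2) : Idx → Idx → ScalarJet
  | Sum.inl i, Sum.inl j => compJet (compG (symIdx i j)) θ + ∑ l, ∑ k, jmul
      (jmul (compJet (compF i k) θ) (compJet (compH (symIdx k l)) θ)) (compJet (compF j l) θ)
  | Sum.inl i, Sum.inr k => ∑ l, jmul (compJet (compF i l) θ) (compJet (compH (symIdx l k)) θ)
  | Sum.inr k, Sum.inl i => ∑ l, jmul (compJet (compF i l) θ) (compJet (compH (symIdx l k)) θ)
  | Sum.inr k, Sum.inr l => compJet (compH (symIdx k l)) θ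

/-- First and second derivatives of a 2-jet with respect to the four coordinates. -/
def ScalarJet.d (a : Idx) (w : ScalarJet) : ℝ :=
  match a with
  | Sum.inl i => w.2.1 i
  | Sum.inr _ => 0

/-- Second derivatives of a 2-jet with respect to the four coordinates. -/
def ScalarJet.dd (a b : Idx) (w : ScalarJet) : ℝ :=
  match a, b with
  | Sum.inl i, Sum.inl j => w.2.2 i j
  | _, _ => 0

/-- The Ricci tensor of a jet whose metric is diagonal. -/
def ricciJet (n : Idx → ℝ) (θ : Jet2) : Idx → Idx → ℝ :=
  ricciAlg n (fun a c d => (metricJet θ c d).d a) (fun a b c d => (metricJet θ c d).dd a b)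


theorem scalarJet_metricMat {σ : Plane → Fib} {x : Base} (hσ : ContDiffAt ℝ ∞ σ x.1) (a b : Idx) :
    scalarJet (fun s => metricMat (σ s) a b) x.1 = metricJet (jetAt σ x) a b := by
  have hc : ∀ c : Fib →L[ℝ] ℝ, ContDiffAt ℝ ∞ (fun s => c (σ s)) x.1 := fun c =>
    c.contDiff.contDiffAt.comp _ hσ
  have hs : ∀ i k, (fun s => metricMat (σ s) (Sum.inl i) (Sum.inr k)) = fun s =>
      ∑ l, compF i l (σ s) * compH (symIdx l k) (σ s) := fun i k => by
    funext s; simp [metricMat, Matrix.mul_apply, shiftMat, killMat]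
  have hs' : ∀ i k, (fun s => metricMat (σ s) (Sum.inr k) (Sum.inl i)) = fun s =>
      ∑ l, compF i l (σ s) * compH (symIdx l k) (σ s) := fun i k => by
    rw [← hs]; funext s; exact congrFun (congrFun (metricMat_transpose (σ s)) (Sum.inl i)) (Sum.inr k)
  have hr : ∀ i k, scalarJet (fun s => ∑ l, compF i l (σ s) * compH (symIdx l k) (σ s)) x.1 =
      ∑ l, jmul (compJet (compF i l) (jetAt σ x)) (compJet (compH (symIdx l k)) (jetAt σ x)) := by
    intro i k
    rw [scalarJet_sum _ fun l _ => (hc _).mul (hc _)]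
    exact Finset.sum_congr rfl fun l _ => by
      rw [scalarJet_mul (hc _) (hc _), compJet_jetAt _ hσ, compJet_jetAt _ hσ]
  rcases a with i | k <;> rcases b with j | l
  · have : (fun s => metricMat (σ s) (Sum.inl i) (Sum.inl j)) = fun s => compG (symIdx i j) (σ s) +
        ∑ l, ∑ k, compF i k (σ s) * compH (symIdx k l) (σ s) * compF j l (σ s) := by
      funext s
      simp [metricMat, Matrix.mul_apply, shiftMat, killMat, orbitMat, add_mul]
    rw [this, scalarJet_add (hc _) (ContDiffAt.sum fun l _ => ContDiffAt.sum fun k _ =>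
      ((hc _).mul (hc _)).mul (hc _)), scalarJet_sum _ fun l _ => ContDiffAt.sum fun k _ =>
      ((hc _).mul (hc _)).mul (hc _), metricJet, compJet_jetAt _ hσ]
    congr 1
    refine Finset.sum_congr rfl fun l _ => ?_
    rw [scalarJet_sum _ fun k _ => ((hc _).mul (hc _)).mul (hc _)]
    refine Finset.sum_congr rfl fun k _ => ?_
    rw [scalarJet_mul ((hc _).mul (hc _)) (hc _), scalarJet_mul (hc _) (hc _),
      compJet_jetAt _ hσ, compJet_jetAt _ hσ, compJet_jetAt _ hσ]
  · rw [hs, hr, metricJet]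
  · rw [hs', hr, metricJet]
  · exact (compJet_jetAt (compH (symIdx k l)) hσ).symm

/-- This replaces derivatives by an algebraic expression in jet coordinates, which the simplifier
can expand. -/
theorem ricci_eq_ricciJet {θ : Jet2} (hθ : θ ∈ metricJets) {n : Idx → ℝ} (hn : ∀ a, n a ≠ 0)
    (h : metricMat θ.2.1 = Matrix.diagonal n) (a b : Idx) :
    ricci a b θ = ricciJet (fun a => (n a)⁻¹) θ a b := by
  have hσ := contDiff_polySec θ
  have hj := jetAt_polySec θ
  have h1 := ricci_jetAt (σ := polySec θ) (x := θ.1) hσ.contDiffAt (by rwa [hj]) a b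
  rw [hj] at h1
  have h2 : metricMat (polySec θ θ.1.1) = Matrix.diagonal n := by
    rw [← h]; exact congrArg (fun η : Jet2 => metricMat η.2.1) hj
  have hs : ∀ a b, ContDiffAt ℝ ∞ (fun s => metricMat (polySec θ s) a b) θ.1.1 := fun a b =>
    (contDiff_metricMat a b).contDiffAt.comp _ hσ.contDiffAt
  rw [h1, ricciMat_eq_ricciAlg (G := fun s => metricMat (polySec θ s)) hs hn h2, ricciJet]
  have h3 := fun c d => scalarJet_metricMat (σ := polySec θ) (x := θ.1) hσ.contDiffAt c d
  rw [hj] at h3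
  congr 1
  · funext a c d
    rw [← h3]
    rcases a with i | k <;> rfl
  · funext a b c d
    rw [← h3]
    rcases a with i | k <;> rcases b with j | l
    · rfl
    · exact pd_const _ i _
    · rfl
    · rfl

/-! ### The Einstein equations solved at normal forms. -/

section Solved

variable (Λ c₁ c₂ h₁ h₂ : ℝ) (H : Fin 2 → Fin 3 → ℝ) (c : Fin 2 → ℝ) (x : Fin 4 → ℝ)

/-- The first-order terms of `R_kl - Λ g_kl` along the Killing leaves. -/
def leafTerm : Fin 3 → ℝ :=
  ![c 0 ^ 2 * h₁ ^ 2 / (2 * (c₁ * c₂)) +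
      (H 0 0 ^ 2 / (4 * h₁) - H 0 0 * H 0 2 / (4 * h₂) + H 0 1 ^ 2 / (2 * h₂)) / c₁ +
      (H 1 0 ^ 2 / (4 * h₁) - H 1 0 * H 1 2 / (4 * h₂) + H 1 1 ^ 2 / (2 * h₂)) / c₂ - Λ * h₁,
    c 0 * c 1 * h₁ * h₂ / (2 * (c₁ * c₂)) + H 0 1 / 4 * (H 0 0 / h₁ + H 0 2 / h₂) / c₁ +
      H 1 1 / 4 * (H 1 0 / h₁ + H 1 2 / h₂) / c₂,
    c 1 ^ 2 * h₂ ^ 2 / (2 * (c₁ * c₂)) +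
      (H 0 2 ^ 2 / (4 * h₂) - H 0 0 * H 0 2 / (4 * h₁) + H 0 1 ^ 2 / (2 * h₁)) / c₁ +
      (H 1 2 ^ 2 / (4 * h₂) - H 1 0 * H 1 2 / (4 * h₁) + H 1 1 ^ 2 / (2 * h₁)) / c₂ - Λ * h₂]

/-- A quarter of the trace of `(h⁻¹ h_,i)²`. -/
def squareTerm (i : Fin 2) : ℝ :=
  H i 1 ^ 2 / (2 * (h₁ * h₂)) + H i 0 ^ 2 / (4 * h₁ ^ 2) + H i 2 ^ 2 / (4 * h₂ ^ 2)

/-- The value of `h_22,11` determined by the Einstein equations. -/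
def solveFirst : ℝ :=
  h₂ * (c₁ * (leafTerm Λ c₁ c₂ h₁ h₂ H c 0 / h₁ + leafTerm Λ c₁ c₂ h₁ h₂ H c 2 / h₂ +
    squareTerm h₁ h₂ H 0 / c₁ - squareTerm h₁ h₂ H 1 / c₂) - x 0 / h₁)

/-- The value of `h_22,12` determined by the Einstein equations. -/
def solveMixed : ℝ :=
  h₂ * (-x 2 / h₁ + H 1 1 * H 0 1 / (h₁ * h₂) + H 1 2 * H 0 2 / (2 * h₂ ^ 2) +
    H 1 0 * H 0 0 / (2 * h₁ ^ 2))

/-- The second derivatives of `h` determined by the Einstein equations. -/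
def solveHess : Fin 3 → Fin 3 → ℝ :=
  ![![x 0, x 1, solveFirst Λ c₁ c₂ h₁ h₂ H c x], ![x 2, x 3, solveMixed h₁ h₂ H x],
    ![c₂ * (2 * leafTerm Λ c₁ c₂ h₁ h₂ H c 0 - x 0 / c₁),
      c₂ * (2 * leafTerm Λ c₁ c₂ h₁ h₂ H c 1 - x 1 / c₁),
      c₂ * (2 * leafTerm Λ c₁ c₂ h₁ h₂ H c 2 - solveFirst Λ c₁ c₂ h₁ h₂ H c x / c₁)]]

/-- The curvature of the orbit metric determined by the Einstein equations. -/
def solveCurv : ℝ :=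
  c₂ * (Λ * c₁ + (h₁ * c 0 ^ 2 + h₂ * c 1 ^ 2) / (2 * c₂) +
    (x 0 / h₁ + solveFirst Λ c₁ c₂ h₁ h₂ H c x / h₂) / 2 - squareTerm h₁ h₂ H 0)

/-- The derivatives of the curvature field determined by the Einstein equations. -/
def solveShift (i : Fin 2) : Fin 2 → ℝ :=
  ![-(c 0 * (H i 0 / h₁ + H i 2 / h₂) / 2 + (c 0 * H i 0 + c 1 * H i 1) / h₁),
    -(c 1 * (H i 0 / h₁ + H i 2 / h₂) / 2 + (c 0 * H i 1 + c 1 * H i 2) / h₂)]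

/-- The normal form of a jet satisfying the Einstein equations. -/
def einJet : Jet2 :=
  normalJet c₁ c₂ (solveCurv Λ c₁ c₂ h₁ h₂ H c x) ![h₁, 0, h₂] H
    (solveHess Λ c₁ c₂ h₁ h₂ H c x) c (solveShift h₁ h₂ H c 0) (solveShift h₁ h₂ H c 1)

end Solved

variable {Λ c₁ c₂ h₁ h₂ κ : ℝ} {H : Fin 2 → Fin 3 → ℝ} {K : Fin 3 → Fin 3 → ℝ}
    {c d e : Fin 2 → ℝ} {x : Fin 4 → ℝ}

theorem metricMat_normalJet : metricMat (normalJet c₁ c₂ κ ![h₁, 0, h₂] H K c d e).2.1 =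
    Matrix.diagonal (Sum.elim ![c₁, c₂] ![h₁, h₂]) := by
  ext a b
  rcases a with i | i <;> rcases b with j | j <;> rcases eq_zero_or_one i with rfl | rfl <;>
    rcases eq_zero_or_one j with rfl | rfl <;>
    simp [metricMat, normalJet, orbitMat, shiftMat, killMat, symIdx, Matrix.mul_apply]

theorem normalJet_mem_metricJets (h1 : c₁ ≠ 0) (h2 : c₂ ≠ 0) (h3 : h₁ ≠ 0) (h4 : h₂ ≠ 0) :
    normalJet c₁ c₂ κ ![h₁, 0, h₂] H K c d e ∈ metricJets := by
  simp [metricJets, normalJet, orbitMat_eq, killMat_eq, Matrix.det_fin_two, h1, h2, h3, h4]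

section Residual

variable (Λ c₁ c₂ κ h₁ h₂ : ℝ) (H : Fin 2 → Fin 3 → ℝ) (K : Fin 3 → Fin 3 → ℝ) (c d e : Fin 2 → ℝ)

/-- The components of `R_ij - Λ g_ij` at a jet in normal form. -/
def orbitResidual : Fin 3 → ℝ :=
  ![(κ - (h₁ * c 0 ^ 2 + h₂ * c 1 ^ 2) / 2) / c₂ - (K 0 0 / h₁ + K 0 2 / h₂) / 2 +
      squareTerm h₁ h₂ H 0 - Λ * c₁,
    -(K 1 0 / h₁ + K 1 2 / h₂) / 2 + H 1 1 * H 0 1 / (2 * (h₁ * h₂)) +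
      H 1 0 * H 0 0 / (4 * h₁ ^ 2) + H 1 2 * H 0 2 / (4 * h₂ ^ 2),
    (κ - (h₁ * c 0 ^ 2 + h₂ * c 1 ^ 2) / 2) / c₁ - (K 2 0 / h₁ + K 2 2 / h₂) / 2 +
      squareTerm h₁ h₂ H 1 - Λ * c₂]

/-- The components of `R_ik - Λ g_ik` at a jet in normal form. -/
def mixedResidual : Fin 2 → Fin 2 → ℝ :=
  ![fun k => -(![h₁, h₂] k / (2 * c₂)) * (e k - solveShift h₁ h₂ H c 1 k),
    fun k => ![h₁, h₂] k / (2 * c₁) * (d k - solveShift h₁ h₂ H c 0 k)]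

/-- The components of `R_kl - Λ g_kl` at a jet in normal form. -/
def leafResidual (m : Fin 3) : ℝ :=
  leafTerm Λ c₁ c₂ h₁ h₂ H c m - (K 0 m / c₁ + K 2 m / c₂) / 2

end Residual

theorem metric_normalJet (a b : Idx) : metric a b (normalJet c₁ c₂ κ ![h₁, 0, h₂] H K c d e) =
    Matrix.diagonal (Sum.elim ![c₁, c₂] ![h₁, h₂]) a b :=
  congrFun (congrFun metricMat_normalJet a) b

theorem ricci_normalJet (h1 : c₁ ≠ 0) (h2 : c₂ ≠ 0) (h3 : h₁ ≠ 0) (h4 : h₂ ≠ 0) (a b : Idx) :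
    ricci a b (normalJet c₁ c₂ κ ![h₁, 0, h₂] H K c d e) =
      ricciJet (Sum.elim ![c₁⁻¹, c₂⁻¹] ![h₁⁻¹, h₂⁻¹])
        (normalJet c₁ c₂ κ ![h₁, 0, h₂] H K c d e) a b := by
  have hR := ricci_eq_ricciJet (normalJet_mem_metricJets (κ := κ) (H := H) (K := K) (c := c)
    (d := d) (e := e) h1 h2 h3 h4) (n := Sum.elim ![c₁, c₂] ![h₁, h₂]) (by
    rintro (i | i) <;> rcases eq_zero_or_one i with rfl | rfl <;> simpa) metricMat_normalJet a b
  rw [hR]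
  congr 1
  funext a
  rcases a with i | i <;> rcases eq_zero_or_one i with rfl | rfl <;> rfl

-- For this and the three following computations, `ricci_normalJet` makes the left side an explicit
-- rational function of the normal-form coordinates, and the claim is an identity of such functions.
set_option linter.unusedSimpArgs false in
set_option maxHeartbeats 1000000 in
theorem residual_orbit (h1 : c₁ ≠ 0) (h2 : c₂ ≠ 0) (h3 : h₁ ≠ 0) (h4 : h₂ ≠ 0) (i j : Fin 2) :
    ricci (Sum.inl i) (Sum.inl j) (normalJet c₁ c₂ κ ![h₁, 0, h₂] H K c d e) -
      Λ * metric (Sum.inl i) (Sum.inl j) (normalJet c₁ c₂ κ ![h₁, 0, h₂] H K c d e) =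
        orbitResidual Λ c₁ c₂ κ h₁ h₂ H K c (symIdx i j) := by
  rw [ricci_normalJet h1 h2 h3 h4, metric_normalJet]
  rcases eq_zero_or_one i with rfl | rfl <;> rcases eq_zero_or_one j with rfl | rfl <;>
    simp [ricciJet, ricciAlg, dchrAlg, chrAlg, metricJet, ScalarJet.d, ScalarJet.dd, normalJet,
      compJet, jmul, symIdx, Fin.sum_univ_two, leafTerm, squareTerm, solveShift, orbitResidual,
      mixedResidual, leafResidual] <;> field_simp <;> ring

set_option linter.unusedSimpArgs false in
set_option maxHeartbeats 1000000 in
theorem residual_mixed (h1 : c₁ ≠ 0) (h2 : c₂ ≠ 0) (h3 : h₁ ≠ 0) (h4 : h₂ ≠ 0) (i j : Fin 2) :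
    ricci (Sum.inl i) (Sum.inr j) (normalJet c₁ c₂ κ ![h₁, 0, h₂] H K c d e) -
      Λ * metric (Sum.inl i) (Sum.inr j) (normalJet c₁ c₂ κ ![h₁, 0, h₂] H K c d e) =
        mixedResidual c₁ c₂ h₁ h₂ H c d e i j := by
  rw [ricci_normalJet h1 h2 h3 h4, metric_normalJet]
  rcases eq_zero_or_one i with rfl | rfl <;> rcases eq_zero_or_one j with rfl | rfl <;>
    simp [ricciJet, ricciAlg, dchrAlg, chrAlg, metricJet, ScalarJet.d, ScalarJet.dd, normalJet,
      compJet, jmul, symIdx, Fin.sum_univ_two, leafTerm, squareTerm, solveShift, orbitResidual,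
      mixedResidual, leafResidual] <;> field_simp <;> ring

set_option linter.unusedSimpArgs false in
set_option maxHeartbeats 1000000 in
theorem residual_mixed_symm (h1 : c₁ ≠ 0) (h2 : c₂ ≠ 0) (h3 : h₁ ≠ 0) (h4 : h₂ ≠ 0) (i j : Fin 2) :
    ricci (Sum.inr i) (Sum.inl j) (normalJet c₁ c₂ κ ![h₁, 0, h₂] H K c d e) -
      Λ * metric (Sum.inr i) (Sum.inl j) (normalJet c₁ c₂ κ ![h₁, 0, h₂] H K c d e) =
        mixedResidual c₁ c₂ h₁ h₂ H c d e j i := by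
  rw [ricci_normalJet h1 h2 h3 h4, metric_normalJet]
  rcases eq_zero_or_one i with rfl | rfl <;> rcases eq_zero_or_one j with rfl | rfl <;>
    simp [ricciJet, ricciAlg, dchrAlg, chrAlg, metricJet, ScalarJet.d, ScalarJet.dd, normalJet,
      compJet, jmul, symIdx, Fin.sum_univ_two, leafTerm, squareTerm, solveShift, orbitResidual,
      mixedResidual, leafResidual] <;> field_simp <;> ring

set_option linter.unusedSimpArgs false in
set_option maxHeartbeats 1000000 in
theorem residual_leaf (h1 : c₁ ≠ 0) (h2 : c₂ ≠ 0) (h3 : h₁ ≠ 0) (h4 : h₂ ≠ 0) (i j : Fin 2) :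
    ricci (Sum.inr i) (Sum.inr j) (normalJet c₁ c₂ κ ![h₁, 0, h₂] H K c d e) -
      Λ * metric (Sum.inr i) (Sum.inr j) (normalJet c₁ c₂ κ ![h₁, 0, h₂] H K c d e) =
        leafResidual Λ c₁ c₂ h₁ h₂ H K c (symIdx i j) := by
  rw [ricci_normalJet h1 h2 h3 h4, metric_normalJet]
  rcases eq_zero_or_one i with rfl | rfl <;> rcases eq_zero_or_one j with rfl | rfl <;>
    simp [ricciJet, ricciAlg, dchrAlg, chrAlg, metricJet, ScalarJet.d, ScalarJet.dd, normalJet,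
      compJet, jmul, symIdx, Fin.sum_univ_two, leafTerm, squareTerm, solveShift, orbitResidual,
      mixedResidual, leafResidual] <;> field_simp <;> ring

/-- The Einstein equations at a jet in normal form. -/
theorem normalJet_mem_einsteinJets (h1 : c₁ ≠ 0) (h2 : c₂ ≠ 0) (h3 : h₁ ≠ 0) (h4 : h₂ ≠ 0) :
    normalJet c₁ c₂ κ ![h₁, 0, h₂] H K c d e ∈ einsteinJets Λ ↔
      (∀ m, orbitResidual Λ c₁ c₂ κ h₁ h₂ H K c m = 0) ∧
      (∀ i k, mixedResidual c₁ c₂ h₁ h₂ H c d e i k = 0) ∧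
      ∀ m, leafResidual Λ c₁ c₂ h₁ h₂ H K c m = 0 := by
  constructor
  · rintro ⟨-, h⟩
    refine ⟨fun m => ?_, fun i k => ?_, fun m => ?_⟩
    · obtain ⟨i, j, rfl⟩ := exists_symIdx m
      exact (residual_orbit h1 h2 h3 h4 i j).symm.trans (h _ _)
    · exact (residual_mixed h1 h2 h3 h4 i k).symm.trans (h _ _)
    · obtain ⟨i, j, rfl⟩ := exists_symIdx m
      exact (residual_leaf h1 h2 h3 h4 i j).symm.trans (h _ _)
  · rintro ⟨ho, hm, hl⟩
    refine ⟨normalJet_mem_metricJets h1 h2 h3 h4, ?_⟩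
    rintro (i | i) (j | j)
    · exact (residual_orbit h1 h2 h3 h4 i j).trans (ho _)
    · exact (residual_mixed h1 h2 h3 h4 i j).trans (hm _ _)
    · exact (residual_mixed_symm h1 h2 h3 h4 i j).trans (hm _ _)
    · exact (residual_leaf h1 h2 h3 h4 i j).trans (hl _)

theorem einJet_mem_einsteinJets (h1 : c₁ ≠ 0) (h2 : c₂ ≠ 0) (h3 : h₁ ≠ 0) (h4 : h₂ ≠ 0) :
    einJet Λ c₁ c₂ h₁ h₂ H c x ∈ einsteinJets Λ := by
  refine (normalJet_mem_einsteinJets h1 h2 h3 h4).2 ⟨fun m => ?_, fun i k => ?_, fun m => ?_⟩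
  · fin_cases m <;> simp [orbitResidual, solveHess, solveFirst, solveMixed, solveCurv] <;>
      field_simp <;> ring
  · rcases eq_zero_or_one i with rfl | rfl <;> simp [mixedResidual]
  · fin_cases m <;> simp [leafResidual, solveHess] <;> field_simp <;> ring

/-- The system is triangular. The mixed equations give `d` and `e`, and the leaf equations give
h_,22 in terms of h_,11. Eliminating κ between the two diagonal orbit equations gives h_22,11, the
off-diagonal one gives h_22,12, and a diagonal one finally gives κ. Four second derivatives of h
remain free. -/
theorem normalJet_eq_einJet (h1 : c₁ ≠ 0) (h2 : c₂ ≠ 0) (h3 : h₁ ≠ 0) (h4 : h₂ ≠ 0)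
    (h : normalJet c₁ c₂ κ ![h₁, 0, h₂] H K c d e ∈ einsteinJets Λ) :
    normalJet c₁ c₂ κ ![h₁, 0, h₂] H K c d e =
      einJet Λ c₁ c₂ h₁ h₂ H c ![K 0 0, K 0 1, K 1 0, K 1 1] := by
  obtain ⟨ho, hm, hl⟩ := (normalJet_mem_einsteinJets h1 h2 h3 h4).1 h
  have l0 := hl 0
  have l1 := hl 1
  have l2 := hl 2
  have o0 := ho 0
  have o1 := ho 1
  have o2 := ho 2
  simp only [leafResidual] at l0 l1 l2
  simp [orbitResidual] at o0 o1 o2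
  have m0 : d = solveShift h₁ h₂ H c 0 := by
    funext k
    have := hm 1 k
    rcases eq_zero_or_one k with rfl | rfl <;>
      simpa [mixedResidual, h1, h2, h3, h4, sub_eq_zero] using this
  have m1 : e = solveShift h₁ h₂ H c 1 := by
    funext k
    have := hm 0 k
    rcases eq_zero_or_one k with rfl | rfl <;>
      simpa [mixedResidual, h1, h2, h3, h4, sub_eq_zero] using this
  have k20 : K 2 0 = c₂ * (2 * leafTerm Λ c₁ c₂ h₁ h₂ H c 0 - K 0 0 / c₁) := by
    field_simp at l0 ⊢; linear_combination -l0
  have k21 : K 2 1 = c₂ * (2 * leafTerm Λ c₁ c₂ h₁ h₂ H c 1 - K 0 1 / c₁) := by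
    field_simp at l1 ⊢; linear_combination -l1
  have k22 : K 2 2 = c₂ * (2 * leafTerm Λ c₁ c₂ h₁ h₂ H c 2 - K 0 2 / c₁) := by
    field_simp at l2 ⊢; linear_combination -l2
  have k02 : K 0 2 = solveFirst Λ c₁ c₂ h₁ h₂ H c ![K 0 0, K 0 1, K 1 0, K 1 1] := by
    rw [k20, k22] at o2
    simp only [solveFirst, Matrix.cons_val_zero]
    -- This combination of the two diagonal orbit equations eliminates κ.
    linear_combination (norm := skip) (c₁ * h₂ / c₂) * o2 - h₂ * o0
    field_simp
    ring
  have k12 : K 1 2 = solveMixed h₁ h₂ H ![K 0 0, K 0 1, K 1 0, K 1 1] := by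
    simp [solveMixed]
    field_simp at o1 ⊢; linear_combination -o1 / 2
  have hκ : κ = solveCurv Λ c₁ c₂ h₁ h₂ H c ![K 0 0, K 0 1, K 1 0, K 1 1] := by
    rw [solveCurv, ← k02]
    simp
    field_simp at o0 ⊢; linear_combination o0
  have hK : K = solveHess Λ c₁ c₂ h₁ h₂ H c ![K 0 0, K 0 1, K 1 0, K 1 1] := by
    funext i j
    fin_cases i <;> fin_cases j <;> simp [solveHess, ← k02, ← k12, ← k20, ← k21, ← k22]
  rw [einJet, ← hκ, ← hK, ← m0, ← m1]

/-! ### The invariant frame and the slice -/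

theorem orbitMat_inv (θ : Jet2) : (orbitMat θ.2.1)⁻¹ = !![θ.2.1.1 2 / detG θ, -θ.2.1.1 1 / detG θ;
    -θ.2.1.1 1 / detG θ, θ.2.1.1 0 / detG θ] := by
  rw [Matrix.inv_def, Ring.inverse_eq_inv', detG, orbitMat_eq, Matrix.adjugate_fin_two_of]
  ext i j
  fin_cases i <;> fin_cases j <;> simp [div_eq_inv_mul]

theorem traceInv_eq (μ : Jet2 → Matrix (Fin 2) (Fin 2) ℝ) (θ : Jet2) : traceInv μ θ =
    (μ θ 0 0 * θ.2.1.1 2 - (μ θ 0 1 + μ θ 1 0) * θ.2.1.1 1 + μ θ 1 1 * θ.2.1.1 0) / detG θ := by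
  rw [traceInv, orbitMat_inv]
  simp [Fin.sum_univ_two]
  ring

/-- The frame `X, X^⊥`, as columns. -/
def frameL (θ : Jet2) : Matrix (Fin 2) (Fin 2) ℝ :=
  !![(θ.2.1.1 2 * sig 0 θ - θ.2.1.1 1 * sig 1 θ) / detG θ, sig 1 θ / √|detG θ|;
    (θ.2.1.1 0 * sig 1 θ - θ.2.1.1 1 * sig 0 θ) / detG θ, -sig 0 θ / √|detG θ|]

/-- The curvature field and its orthogonal complement in the Killing leaf, as columns. -/
def frameA (θ : Jet2) : Matrix (Fin 2) (Fin 2) ℝ :=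
  !![curv 0 θ, (θ.2.1.2.2 1 * curv 0 θ + θ.2.1.2.2 2 * curv 1 θ) / √|detH θ|;
    curv 1 θ, -(θ.2.1.2.2 0 * curv 0 θ + θ.2.1.2.2 1 * curv 1 θ) / √|detH θ|]

section Frame

variable {θ : Jet2} (hθ : θ ∈ metricJets)

theorem sqrt_sq_eq {a : ℝ} (h : a ≠ 0) : √|a| ≠ 0 ∧ 1 / √|a| ^ 2 = Real.sign a / a ∧
    Real.sign a ^ 2 = 1 := by
  refine ⟨(Real.sqrt_pos.2 (abs_pos.2 h)).ne', ?_, sign_sq h⟩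
  have := sign_sq h
  rw [Real.sq_sqrt (abs_nonneg a), ← sign_mul_self_abs h, div_eq_div_iff _ h]
  · linear_combination -a * this
  · rw [sign_mul_self_abs h]; exact abs_ne_zero.2 h

theorem traceInv_rho_eq (θ : Jet2) : traceInv rho θ = (sig 0 θ ^ 2 * θ.2.1.1 2 -
    2 * (sig 0 θ * sig 1 θ * θ.2.1.1 1) + sig 1 θ ^ 2 * θ.2.1.1 0) / detG θ := by
  rw [traceInv_eq]
  simp [rho]
  ring

include hθ

/-- X and X^⊥ thus form a frame exactly where C_ρ ≠ 0; the next lemma plays the same role for 𝒞 and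
ℓ_𝒞. -/
theorem det_frameL : (frameL θ).det = -(traceInv rho θ / √|detG θ|) := by
  have hD := detG_ne_zero hθ
  obtain ⟨hr, -, -⟩ := sqrt_sq_eq hD
  rw [frameL, Matrix.det_fin_two_of, traceInv_rho_eq]
  field_simp
  ring

theorem det_frameA : (frameA θ).det = -(ellC θ / √|detH θ|) := by
  obtain ⟨hr, -, -⟩ := sqrt_sq_eq (detH_ne_zero hθ)
  rw [frameA, Matrix.det_fin_two_of, ellC_eq]
  field_simp
  ring

/-- Since g̃(X, ·) = σ, one has g̃(X, X) = σ(X) = C_ρ, and X^⊥ spans the kernel of σ. -/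
theorem congrTriple_frameL : congrTriple (frameL θ) θ.2.1.1 =
    ![traceInv rho θ, 0, Real.sign (detG θ) * traceInv rho θ] := by
  have hD := detG_ne_zero hθ
  obtain ⟨hr, h1, h2⟩ := sqrt_sq_eq hD
  have hE := detG_eq θ
  rw [traceInv_rho_eq]
  funext m
  fin_cases m <;> simp [congrTriple, frameL]
  · field_simp
    rw [hE]; ring
  · field_simp
    ring
  · linear_combination (sig 0 θ ^ 2 * θ.2.1.1 2 - 2 * (sig 0 θ * sig 1 θ * θ.2.1.1 1) +
      sig 1 θ ^ 2 * θ.2.1.1 0) * h1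

theorem congrTriple_frameA : congrTriple (frameA θ) θ.2.1.2.2 =
    ![ellC θ, 0, Real.sign (detH θ) * ellC θ] := by
  have hD := detH_ne_zero hθ
  obtain ⟨hr, h1, h2⟩ := sqrt_sq_eq hD
  have hE := detH_eq θ
  rw [ellC_eq]
  funext m
  fin_cases m <;> simp [congrTriple, frameA]
  · ring
  · field_simp
    ring
  · have h3 : Real.sign (detH θ) / detH θ *
        (θ.2.1.2.2 0 * θ.2.1.2.2 2 - θ.2.1.2.2 1 ^ 2) = Real.sign (detH θ) := by
      rw [← hE]; field_simp
    linear_combination (θ.2.1.2.2 0 * θ.2.1.2.2 2 - θ.2.1.2.2 1 ^ 2) * (θ.2.1.2.2 0 * curv 0 θ ^ 2 +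
      2 * (θ.2.1.2.2 1 * (curv 0 θ * curv 1 θ)) + θ.2.1.2.2 2 * curv 1 θ ^ 2) * h1 +
      (θ.2.1.2.2 0 * curv 0 θ ^ 2 + 2 * (θ.2.1.2.2 1 * (curv 0 θ * curv 1 θ)) +
        θ.2.1.2.2 2 * curv 1 θ ^ 2) * h3

/-- 𝒞 is the first vector of the leaf frame, so its components there are proportional to (1, 0). The
factor −C_ρ is the determinant of the orbit frame times √|det g̃|. -/
theorem curvF_frame (k : Fin 2) : frameA θ k 0 * (![-traceInv rho θ, 0] : Fin 2 → ℝ) 0 +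
    frameA θ k 1 * (![-traceInv rho θ, 0] : Fin 2 → ℝ) 1 = (frameL θ).det * curvF k θ := by
  obtain ⟨hr, -, -⟩ := sqrt_sq_eq (detG_ne_zero hθ)
  rw [det_frameL hθ]
  have : ∀ k, curvF k θ = curv k θ * √|detG θ| := fun k => by rw [curv_eq]; field_simp
  rw [this]
  rcases eq_zero_or_one k with rfl | rfl <;> simp [frameA] <;> field_simp

/-- The trace of h⁻¹h_,i is σ_i, and σ has components (C_ρ, 0) in the frame. As h is diagonal there,
the last component of h_,i is fixed by the first. The polarized determinant `hp` carries the trace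
identity from the original basis to the frame. -/
theorem linH_frame_trace (hℓ : ellC θ ≠ 0) (i : Fin 2) : linH (frameL θ) (frameA θ) θ i 2 =
    Real.sign (detH θ) * (ellC θ * (![traceInv rho θ, 0] : Fin 2 → ℝ) i -
      linH (frameL θ) (frameA θ) θ i 0) := by
  have hD := detH_ne_zero hθ
  have hG := detG_ne_zero hθ
  obtain ⟨hr, h1, h2⟩ := sqrt_sq_eq hD
  obtain ⟨hr', -, -⟩ := sqrt_sq_eq hG
  have hA := congrTriple_frameA hθ
  have hp : ∀ p : Fin 3 → ℝ, polarDet (congrTriple (frameA θ) p)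
      (congrTriple (frameA θ) θ.2.1.2.2) = (frameA θ).det ^ 2 * polarDet p θ.2.1.2.2 := by
    intro p
    simp only [polarDet, congrTriple, Matrix.det_fin_two]
    simp
    ring
  have key : ∀ j, congrTriple (frameA θ) (θ.2.2.1 j).2.2 2 = Real.sign (detH θ) *
      (ellC θ * sig j θ - congrTriple (frameA θ) (θ.2.2.1 j).2.2 0) := by
    intro j
    have h3 := hp (θ.2.2.1 j).2.2
    have h4 : polarDet (θ.2.2.1 j).2.2 θ.2.1.2.2 = sig j θ * detH θ := by
      rw [sig_eq, div_mul_cancel₀ _ hD, detHDeriv, polarDet]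
      ring
    have h5 : (frameA θ).det ^ 2 * detH θ = ellC θ ^ 2 * Real.sign (detH θ) := by
      rw [det_frameA hθ]
      calc (-(ellC θ / √|detH θ|)) ^ 2 * detH θ = ellC θ ^ 2 * (1 / √|detH θ| ^ 2) * detH θ := by
            ring
        _ = _ := by rw [h1]; field_simp
    rw [hA, h4] at h3
    simp [polarDet] at h3
    refine mul_left_cancel₀ hℓ ?_
    linear_combination h3 + sig j θ * h5
  have e : ∑ j, frameL θ j i * sig j θ = (![traceInv rho θ, 0] : Fin 2 → ℝ) i := by
    rw [traceInv_rho_eq]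
    rcases eq_zero_or_one i with rfl | rfl <;> simp [frameL, Fin.sum_univ_two]
    · field_simp; ring
    · ring
  rw [← e]
  simp only [linH, Pi.add_apply, Pi.smul_apply, smul_eq_mul, key, Fin.sum_univ_two]
  ring

end Frame

/-! ### The slice -/

/-- The first derivatives of `h` at the points of the slice. -/
def sliceDeriv (δ : ℝ) (s : Fin 10 → ℝ) : Fin 2 → Fin 3 → ℝ :=
  ![![s 1 * (s 2 + s 0 / 2), s 1 * s 4, δ * (s 1 * (s 0 / 2 - s 2))],
    ![s 1 * s 3, s 1 * s 5, δ * (s 1 * -s 3)]]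

/-- Jets satisfying the Einstein equations whose invariant frame is the coordinate frame. -/
def sliceJet (Λ ε δ : ℝ) (s : Fin 10 → ℝ) : Jet2 :=
  einJet Λ (s 0) (ε * s 0) (s 1) (δ * s 1) (sliceDeriv δ s) ![-s 0, 0] ![s 6, s 7, s 8, s 9]

/-- The coordinates on the slice of the normal form of a jet. -/
def sliceCoord (θ : Jet2) : Fin 10 → ℝ :=
  ![traceInv rho θ, ellC θ,
    linH (frameL θ) (frameA θ) θ 0 0 / ellC θ - traceInv rho θ / 2,
    linH (frameL θ) (frameA θ) θ 1 0 / ellC θ,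
    linH (frameL θ) (frameA θ) θ 0 1 / ellC θ,
    linH (frameL θ) (frameA θ) θ 1 1 / ellC θ,
    covHess (frameL θ) (frameA θ) (traceInv rho θ) (Real.sign (detG θ) * traceInv rho θ) θ 0 0,
    covHess (frameL θ) (frameA θ) (traceInv rho θ) (Real.sign (detG θ) * traceInv rho θ) θ 0 1,
    covHess (frameL θ) (frameA θ) (traceInv rho θ) (Real.sign (detG θ) * traceInv rho θ) θ 1 0,
    covHess (frameL θ) (frameA θ) (traceInv rho θ) (Real.sign (detG θ) * traceInv rho θ) θ 1 1]

/-- The reduction to normal form uses the frames determined by the jet itself, so the resulting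
parameters are explicit functions of the jet. The Einstein equations and the trace condition leave
ten of them. -/
theorem rel_sliceJet {Λ : ℝ} {θ : Jet2} (hθ : θ ∈ einsteinJets Λ) (hC : traceInv rho θ ≠ 0)
    (hℓ : ellC θ ≠ 0) :
    Rel (Real.sign (frameL θ).det) (Real.sign (frameA θ).det)
      (sliceJet Λ (Real.sign (detG θ)) (Real.sign (detH θ)) (sliceCoord θ)) θ := by
  have hm := hθ.1
  have hG := detG_ne_zero hm
  have hH := detH_ne_zero hm
  have hε : Real.sign (detG θ) ≠ 0 := by simpa [Real.sign_eq_zero_iff] using hG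
  have hδ : Real.sign (detH θ) ≠ 0 := by simpa [Real.sign_eq_zero_iff] using hH
  obtain ⟨hr, -, -⟩ := sqrt_sq_eq hG
  obtain ⟨hr', -, -⟩ := sqrt_sq_eq hH
  have hL : (frameL θ).det ≠ 0 := by
    rw [det_frameL hm]; exact neg_ne_zero.2 (div_ne_zero hC hr)
  have hA : (frameA θ).det ≠ 0 := by
    rw [det_frameA hm]; exact neg_ne_zero.2 (div_ne_zero hℓ hr')
  obtain ⟨κ, d, e, hR⟩ := exists_rel_normalJet hL hA hC (mul_ne_zero hε hC) (congrTriple_frameL hm)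
    ![-traceInv rho θ, 0] (curvF_frame hm)
  rw [congrTriple_frameA hm] at hR
  have hE := einsteinJets_of_rel hR hθ
  rw [normalJet_eq_einJet hC (mul_ne_zero hε hC) hℓ (mul_ne_zero hδ hℓ) hE] at hR
  have hH : linH (frameL θ) (frameA θ) θ = sliceDeriv (Real.sign (detH θ)) (sliceCoord θ) := by
    have h0 := linH_frame_trace hm hℓ
    funext i m
    rcases eq_zero_or_one i with rfl | rfl <;> fin_cases m <;> simp [sliceDeriv, sliceCoord, h0] <;>
      first | (field_simp; done) | (refine Or.inl ?_; field_simp; try ring)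
  rw [hH] at hR
  exact hR

/-! ### Smoothness of the normalization -/

theorem contDiffAt_congrTriple {θ : Jet2} {A : Jet2 → Matrix (Fin 2) (Fin 2) ℝ} {p : Jet2 → Fin 3 → ℝ}
    (hA : ∀ i j, ContDiffAt ℝ ∞ (fun θ => A θ i j) θ) (hp : ∀ m, ContDiffAt ℝ ∞ (fun θ => p θ m) θ)
    (m : Fin 3) : ContDiffAt ℝ ∞ (fun θ => congrTriple (A θ) (p θ) m) θ := by
  fin_cases m
  · exact ((((hA 0 0).pow 2).mul (hp 0)).add (contDiffAt_const.mul
      (((hA 0 0).mul (hA 1 0)).mul (hp 1)))).add (((hA 1 0).pow 2).mul (hp 2))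
  · exact ((((hA 0 0).mul (hA 0 1)).mul (hp 0)).add ((((hA 0 0).mul (hA 1 1)).add
      ((hA 1 0).mul (hA 0 1))).mul (hp 1))).add (((hA 1 0).mul (hA 1 1)).mul (hp 2))
  · exact ((((hA 0 1).pow 2).mul (hp 0)).add (contDiffAt_const.mul
      (((hA 0 1).mul (hA 1 1)).mul (hp 1)))).add (((hA 1 1).pow 2).mul (hp 2))

theorem eventually_sign_eq {θ : Jet2} {f : Jet2 → ℝ} (hf : ContinuousAt f θ) (h : f θ ≠ 0) :
    ∀ᶠ η in 𝓝 θ, Real.sign (f η) = Real.sign (f θ) := by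
  rcases lt_or_gt_of_ne h with h | h
  · filter_upwards [hf.eventually_lt_const h] with η hη
    rw [Real.sign_of_neg hη, Real.sign_of_neg h]
  · filter_upwards [hf.eventually_const_lt h] with η hη
    rw [Real.sign_of_pos hη, Real.sign_of_pos h]

section Smooth

variable {θ : Jet2} (hθ : θ ∈ metricJets)

include hθ

theorem contDiffAt_frameL (i j : Fin 2) : ContDiffAt ℝ ∞ (fun θ => frameL θ i j) θ := by
  have hs := contDiffAt_sig hθ
  have hg := fun m => (contDiff_gcoord m).contDiffAt (x := θ)
  have hq := contDiffAt_sqrt_abs contDiff_detG.contDiffAt (detG_ne_zero hθ)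
  have hq0 := (sqrt_sq_eq (detG_ne_zero hθ)).1
  have hd := contDiff_detG.contDiffAt (x := θ)
  rcases eq_zero_or_one i with rfl | rfl <;> rcases eq_zero_or_one j with rfl | rfl
  · exact ((((hg 2).mul (hs 0)).sub ((hg 1).mul (hs 1))).div hd (detG_ne_zero hθ))
  · exact (hs 1).div hq hq0
  · exact ((((hg 0).mul (hs 1)).sub ((hg 1).mul (hs 0))).div hd (detG_ne_zero hθ))
  · exact (hs 0).neg.div hq hq0

theorem contDiffAt_frameA (i j : Fin 2) : ContDiffAt ℝ ∞ (fun θ => frameA θ i j) θ := by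
  have hs := contDiffAt_curv hθ
  have hg := fun m => (contDiff_hcoord m).contDiffAt (x := θ)
  have hq := contDiffAt_sqrt_abs contDiff_detH.contDiffAt (detH_ne_zero hθ)
  have hq0 := (sqrt_sq_eq (detH_ne_zero hθ)).1
  rcases eq_zero_or_one i with rfl | rfl <;> rcases eq_zero_or_one j with rfl | rfl
  · exact hs 0
  · exact ((((hg 1).mul (hs 0)).add ((hg 2).mul (hs 1))).div hq hq0)
  · exact hs 1
  · exact ((((hg 0).mul (hs 0)).add ((hg 1).mul (hs 1))).neg.div hq hq0)

theorem contDiffAt_linH_frame (i : Fin 2) (m : Fin 3) :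
    ContDiffAt ℝ ∞ (fun θ => linH (frameL θ) (frameA θ) θ i m) θ := by
  have h := fun j => contDiffAt_congrTriple (contDiffAt_frameA hθ)
    (fun m => (contDiff_deriv (compH m) j).contDiffAt)
  exact ((contDiffAt_frameL hθ 0 i).mul (h 0 m)).add ((contDiffAt_frameL hθ 1 i).mul (h 1 m))

theorem contDiffAt_linG_frame (i : Fin 2) (m : Fin 3) :
    ContDiffAt ℝ ∞ (fun θ => linG (frameL θ) θ i m) θ := by
  have h := fun j => contDiffAt_congrTriple (contDiffAt_frameL hθ)
    (fun m => (contDiff_deriv (compG m) j).contDiffAt)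
  exact ((contDiffAt_frameL hθ 0 i).mul (h 0 m)).add ((contDiffAt_frameL hθ 1 i).mul (h 1 m))

theorem contDiffAt_linHH_frame (l m : Fin 3) :
    ContDiffAt ℝ ∞ (fun θ => linHH (frameL θ) (frameA θ) θ l m) θ := by
  have hL := contDiffAt_frameL hθ
  have hK : ∀ (j : Fin 3) (m : Fin 3), ContDiffAt ℝ ∞ (fun θ : Jet2 => (θ.2.2.2 j).2.2 m) θ :=
    fun j m => by fun_prop
  refine contDiffAt_congrTriple (contDiffAt_frameA hθ) (fun m => ?_) m
  fin_cases l
  · exact ((((hL 0 0).pow 2).mul (hK 0 m)).add ((contDiffAt_const.mul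
      ((hL 0 0).mul (hL 1 0))).mul (hK 1 m))).add (((hL 1 0).pow 2).mul (hK 2 m))
  · exact ((((hL 0 0).mul (hL 0 1)).mul (hK 0 m)).add ((((hL 0 0).mul (hL 1 1)).add
      ((hL 1 0).mul (hL 0 1))).mul (hK 1 m))).add (((hL 1 0).mul (hL 1 1)).mul (hK 2 m))
  · exact ((((hL 0 1).pow 2).mul (hK 0 m)).add ((contDiffAt_const.mul
      ((hL 0 1).mul (hL 1 1))).mul (hK 1 m))).add (((hL 1 1).pow 2).mul (hK 2 m))

theorem contDiffAt_covHess_frame (hC : traceInv rho θ ≠ 0) {ε : ℝ} (hε : ε ≠ 0) (l : Fin 3)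
    (hl : l ≠ 2) (m : Fin 3) : ContDiffAt ℝ ∞ (fun θ => covHess (frameL θ) (frameA θ)
      (traceInv rho θ) (ε * traceInv rho θ) θ l m) θ := by
  have hc₁ := contDiffAt_traceInv hθ (contDiffAt_rho hθ)
  have hc₂ : ContDiffAt ℝ ∞ (fun θ => ε * traceInv rho θ) θ := contDiffAt_const.mul hc₁
  have hC₂ : ε * traceInv rho θ ≠ 0 := mul_ne_zero hε hC
  have hG := contDiffAt_linG_frame hθ
  have hq : ∀ k, ContDiffAt ℝ ∞ (fun θ => geodCoef (traceInv rho θ) (ε * traceInv rho θ)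
      (linG (frameL θ) θ) k l) θ := by
    intro k
    have h2 : (2 : ℝ) * traceInv rho θ ≠ 0 := mul_ne_zero two_ne_zero hC
    have h3 : (2 : ℝ) * (ε * traceInv rho θ) ≠ 0 := mul_ne_zero two_ne_zero hC₂
    rcases eq_zero_or_one k with rfl | rfl <;> fin_cases l
    · exact (hG 0 0).neg.div (contDiffAt_const.mul hc₁) h2
    · exact (hG 1 0).neg.div (contDiffAt_const.mul hc₁) h2
    · exact absurd rfl hl
    · exact ((hG 0 1).sub ((hG 1 0).div_const 2)).neg.div hc₂ hC₂
    · exact (hG 0 2).neg.div (contDiffAt_const.mul hc₂) h3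
    · exact absurd rfl hl
  exact (contDiffAt_linHH_frame hθ l m).add (((hq 0).mul (contDiffAt_linH_frame hθ 0 m)).add
    ((hq 1).mul (contDiffAt_linH_frame hθ 1 m)))

/-- The only non-smooth ingredient, the sign of det g̃, is locally constant. -/
theorem differentiableAt_sliceCoord (hC : traceInv rho θ ≠ 0) (hℓ : ellC θ ≠ 0) :
    DifferentiableAt ℝ sliceCoord θ := by
  have hε : Real.sign (detG θ) ≠ 0 := by simpa [Real.sign_eq_zero_iff] using detG_ne_zero hθ
  have hc := contDiffAt_traceInv hθ (contDiffAt_rho hθ)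
  have hl := contDiffAt_ellC hθ
  have hH := contDiffAt_linH_frame hθ
  have hK := fun l hl m => contDiffAt_covHess_frame hθ hC hε l hl m
  have hs := eventually_sign_eq contDiff_detG.continuous.continuousAt hθ.1
  have hK' : ∀ l, l ≠ 2 → ∀ m, DifferentiableAt ℝ (fun θ => covHess (frameL θ) (frameA θ)
      (traceInv rho θ) (Real.sign (detG θ) * traceInv rho θ) θ l m) θ := fun l hl m =>
    (differentiableAt_of_smooth (hK l hl m)).congr_of_eventuallyEq
      (hs.mono fun η hη => by simp only [hη])
  refine differentiableAt_pi.2 fun i => ?_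
  fin_cases i
  · exact differentiableAt_of_smooth hc
  · exact differentiableAt_of_smooth hl
  · exact differentiableAt_of_smooth (((hH 0 0).div hl hℓ).sub (hc.div_const 2))
  · exact differentiableAt_of_smooth ((hH 1 0).div hl hℓ)
  · exact differentiableAt_of_smooth ((hH 0 1).div hl hℓ)
  · exact differentiableAt_of_smooth ((hH 1 1).div hl hℓ)
  · exact hK' 0 (by decide) 0
  · exact hK' 0 (by decide) 1
  · exact hK' 1 (by decide) 0
  · exact hK' 1 (by decide) 1

end Smooth

/-! ### The invariants along the slice -/

/-- The quadratic form `-γ` on the slice. -/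
def sliceForm (δ : ℝ) (s : Fin 10 → ℝ) : Fin 3 → ℝ :=
  ![s 2 ^ 2 + δ * s 4 ^ 2, s 2 * s 3 + δ * (s 4 * s 5), s 3 ^ 2 + δ * s 5 ^ 2]

/-- The determinant of the tracefree parts of `h⁻¹ h_,i` on the slice. -/
def sliceDet (s : Fin 10 → ℝ) : ℝ := s 2 * s 5 - s 3 * s 4

section Evaluate

variable {Λ ε δ : ℝ} {s : Fin 10 → ℝ} (hε : ε ^ 2 = 1) (hδ : δ ^ 2 = 1) (h0 : s 0 ≠ 0)
  (h1 : s 1 ≠ 0)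

theorem detG_sliceJet : detG (sliceJet Λ ε δ s) = ε * s 0 ^ 2 := by
  rw [detG_eq]; simp [sliceJet, einJet, normalJet]; ring

theorem detH_sliceJet : detH (sliceJet Λ ε δ s) = δ * s 1 ^ 2 := by
  rw [detH_eq]; simp [sliceJet, einJet, normalJet]; ring

theorem abs_eq_one {a : ℝ} (h : a ^ 2 = 1) : |a| = 1 := by
  exact (pow_eq_one_iff_of_nonneg (abs_nonneg a) two_ne_zero).1 (by rw [sq_abs, h])

theorem ne_zero_of_sq {a : ℝ} (h : a ^ 2 = 1) : a ≠ 0 := by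
  rintro rfl; simp at h

include hε in
theorem sqrt_detG_sliceJet : √|detG (sliceJet Λ ε δ s)| = |s 0| := by
  rw [detG_sliceJet, abs_mul, abs_eq_one hε, one_mul, abs_pow, Real.sqrt_sq (abs_nonneg _)]

include hδ in
theorem sqrt_detH_sliceJet : √|detH (sliceJet Λ ε δ s)| = |s 1| := by
  rw [detH_sliceJet, abs_mul, abs_eq_one hδ, one_mul, abs_pow, Real.sqrt_sq (abs_nonneg _)]

include hδ h1 in
theorem sig_sliceJet (i : Fin 2) : sig i (sliceJet Λ ε δ s) = (![s 0, 0] : Fin 2 → ℝ) i := by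
  have := ne_zero_of_sq hδ
  rw [sig_eq, detH_sliceJet]
  rcases eq_zero_or_one i with rfl | rfl <;>
    simp [detHDeriv, sliceJet, einJet, normalJet, sliceDeriv]
  · field_simp; ring
  · exact Or.inl (by ring)

include hε in
theorem curv_sliceJet (k : Fin 2) :
    curv k (sliceJet Λ ε δ s) = (![-(s 0 / |s 0|), 0] : Fin 2 → ℝ) k := by
  rw [curv_eq, sqrt_detG_sliceJet hε]
  rcases eq_zero_or_one k with rfl | rfl <;>
    simp [curvF, sliceJet, einJet, normalJet, neg_div]

include hδ h1 in
theorem chi_sliceJet (i j : Fin 2) : chi (sliceJet Λ ε δ s) i j =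
    (![s 0, 0] : Fin 2 → ℝ) i * (![s 0, 0] : Fin 2 → ℝ) j / 4 - sliceForm δ s (symIdx i j) := by
  have := ne_zero_of_sq hδ
  rw [chi_eq, detH_sliceJet]
  have h2 : δ * s 1 ^ 2 ≠ 0 := by positivity
  rw [div_eq_iff (by positivity)]
  rcases eq_zero_or_one i with rfl | rfl <;> rcases eq_zero_or_one j with rfl | rfl <;>
    simp [polarDet, sliceJet, einJet, normalJet, sliceDeriv, sliceForm, symIdx]
  · linear_combination 2 * s 1 ^ 2 * s 4 ^ 2 * hδ
  · linear_combination 2 * s 1 ^ 2 * s 4 * s 5 * hδ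
  · linear_combination 2 * s 1 ^ 2 * s 4 * s 5 * hδ
  · linear_combination 2 * s 1 ^ 2 * s 5 ^ 2 * hδ

-- χ polarizes the determinant of h⁻¹h_,i; subtracting ρ/4 removes the traces and leaves the
-- polarized determinant of the tracefree parts.
include hδ h1 in
theorem gam_sliceJet (i j : Fin 2) :
    gam (sliceJet Λ ε δ s) i j = -sliceForm δ s (symIdx i j) := by
  simp [gam, chi_sliceJet hδ h1, rho, sig_sliceJet hδ h1]
  ring

/-- `sliceForm` is the Gram matrix of (s 2, s 4) and (s 3, s 5) with respect to diag(1, δ). -/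
theorem sliceForm_det : sliceForm δ s 0 * sliceForm δ s 2 - sliceForm δ s 1 ^ 2 =
    δ * sliceDet s ^ 2 := by
  simp [sliceForm, sliceDet]; ring

include hε h0

theorem traceInv_sliceJet (μ : Jet2 → Matrix (Fin 2) (Fin 2) ℝ) : traceInv μ (sliceJet Λ ε δ s) =
    (μ (sliceJet Λ ε δ s) 0 0 + ε * μ (sliceJet Λ ε δ s) 1 1) / s 0 := by
  have := ne_zero_of_sq hε
  have hg : (sliceJet Λ ε δ s).2.1.1 = ![s 0, 0, ε * s 0] := rfl
  rw [traceInv_eq, detG_sliceJet, hg]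
  simp
  field_simp
  linear_combination (-μ (sliceJet Λ ε δ s) 1 1) * hε

theorem detInv_sliceJet (μ : Jet2 → Matrix (Fin 2) (Fin 2) ℝ) : detInv μ (sliceJet Λ ε δ s) =
    ε * (μ (sliceJet Λ ε δ s)).det / s 0 ^ 2 := by
  have := ne_zero_of_sq hε
  rw [detInv, detG_sliceJet]
  field_simp
  rw [hε, mul_one]

include hδ h1

theorem traceInv_rho_sliceJet : traceInv rho (sliceJet Λ ε δ s) = s 0 := by
  rw [traceInv_sliceJet hε h0]
  simp [rho, sig_sliceJet hδ h1]

theorem traceInv_chi_sliceJet : traceInv chi (sliceJet Λ ε δ s) =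
    s 0 / 4 - (sliceForm δ s 0 + ε * sliceForm δ s 2) / s 0 := by
  rw [traceInv_sliceJet hε h0, chi_sliceJet hδ h1, chi_sliceJet hδ h1]
  simp [symIdx]
  field_simp
  try ring

theorem detInv_gam_sliceJet : detInv gam (sliceJet Λ ε δ s) =
    ε * δ * sliceDet s ^ 2 / s 0 ^ 2 := by
  rw [detInv_sliceJet hε h0, Matrix.det_fin_two]
  simp only [gam_sliceJet hδ h1]
  rw [mul_assoc ε δ, ← sliceForm_det]
  simp [symIdx]
  ring

theorem detInv_chi_sliceJet : detInv chi (sliceJet Λ ε δ s) =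
    ε * δ * sliceDet s ^ 2 / s 0 ^ 2 - ε / 4 * sliceForm δ s 2 := by
  rw [detInv_sliceJet hε h0, Matrix.det_fin_two]
  simp only [chi_sliceJet hδ h1]
  rw [mul_assoc ε δ, ← sliceForm_det]
  simp [symIdx]
  field_simp
  ring

omit hδ h1 in
theorem ellC_sliceJet : ellC (sliceJet Λ ε δ s) = s 1 := by
  rw [ellC_eq]
  simp [curv_sliceJet hε, div_pow]
  field_simp
  simp [sliceJet, einJet, normalJet]

theorem thetaI_sliceJet : thetaI (sliceJet Λ ε δ s) =
    |s 1| / |s 0| * (s 0 * s 5 / 2 + sliceDet s) := by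
  have a1 : |s 1| ^ 2 = s 1 ^ 2 := sq_abs _
  have h2 : |s 1| ≠ 0 := abs_ne_zero.2 h1
  rw [thetaI_eq, sqrt_detG_sliceJet hε, sqrt_detH_sliceJet hδ]
  simp [curv_sliceJet hε, div_pow]
  simp [sliceJet, einJet, normalJet, sliceDeriv, sliceDet]
  field_simp
  rw [a1]
  ring

theorem transCurv_sliceJet : transCurv (sliceJet Λ ε δ s) = -(s 0 * s 1 * s 3 / |s 0|) := by
  rw [transCurv, sqrt_detG_sliceJet hε]
  simp [curv_sliceJet hε, sig_sliceJet hδ h1, div_pow]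
  simp [sliceJet, einJet, normalJet, sliceDeriv]
  field_simp

/-- On the slice σ = (s 0, 0) and g̃¹¹ = 1 / s 0, so X is D_1; in the same way X^⊥ is D_2 up to a
sign. -/
theorem diffX_sliceJet (F : Jet2 → ℝ) :
    diffX F (sliceJet Λ ε δ s) = totalD (Sum.inl 0) F (sliceJet Λ ε δ s) := by
  have := ne_zero_of_sq hε
  simp [diffX, orbitMat_inv, detG_sliceJet, sig_sliceJet hδ h1, Fin.sum_univ_two]
  simp [sliceJet, einJet, normalJet]
  field_simp

omit h0 in
theorem diffXperp_sliceJet (F : Jet2 → ℝ) :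
    diffXperp F (sliceJet Λ ε δ s) =
      -(s 0 / |s 0|) * totalD (Sum.inl 1) F (sliceJet Λ ε δ s) := by
  simp [diffXperp, sqrt_detG_sliceJet hε, sig_sliceJet hδ h1]

end Evaluate

/-! ### Second-order variations along the slice -/

theorem fderiv_eq_of_second {F : Jet2 → ℝ} (hF : FirstOrder F) (θ : Jet2) (w : Fin 3 → Fib) :
    fderiv ℝ F (θ.1, θ.2.1, θ.2.2.1, w) = fderiv ℝ F θ := by
  have h : (fun η : Jet2 => F (η + (0, 0, 0, w - θ.2.2.2))) = F := by
    funext η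
    rw [← hF η (η + (0, 0, 0, w - θ.2.2.2)).1 (η + (0, 0, 0, w - θ.2.2.2)).2.2.2]
    congr 1
    simp [Prod.ext_iff]
  have e : θ + (0, 0, 0, w - θ.2.2.2) = (θ.1, θ.2.1, θ.2.2.1, w) := by simp [Prod.ext_iff]
  rw [← e, ← fderiv_comp_add_right, h]

/-- The differential of `F` does not depend on the second-order coordinates, and the total
derivative vector depends on them linearly. Total derivatives are therefore affine in these
coordinates. -/
theorem totalD_second {F : Jet2 → ℝ} (hF : FirstOrder F) (θ : Jet2) (w : Fin 3 → Fib) (i : Fin 2) :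
    totalD (Sum.inl i) F (θ.1, θ.2.1, θ.2.2.1, w) = totalD (Sum.inl i) F θ +
      fderiv ℝ F θ (0, 0, fun j => w (symIdx i j) - θ.2.2.2 (symIdx i j), 0) := by
  simp only [totalD]
  rw [fderiv_eq_of_second hF, ← map_add]
  congr 1
  simp [totalVec, Prod.ext_iff]
  funext j
  simp

theorem hasDerivAt_line {F : Jet2 → ℝ} {θ : Jet2} (hF : DifferentiableAt ℝ F θ) (v : Jet2) :
    HasDerivAt (fun τ : ℝ => F (θ + τ • v)) (fderiv ℝ F θ v) 0 := by
  have h1 : HasDerivAt (fun τ : ℝ => θ + τ • v) v 0 := by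
    simpa using ((hasDerivAt_id (0 : ℝ)).smul_const v).const_add θ
  have h2 : HasFDerivAt F (fderiv ℝ F θ) (θ + (0 : ℝ) • v) := by simpa using hF.hasFDerivAt
  exact h2.comp_hasDerivAt 0 h1

/-- Along the lines considered below C_χ is a quadratic and Q_γ a quartic polynomial, so a
directional derivative is just a linear coefficient. -/
theorem fderiv_eq_of_quadratic {F : Jet2 → ℝ} {θ v : Jet2} (hF : DifferentiableAt ℝ F θ)
    {a b c : ℝ} {p q : ℝ} (h : ∀ τ : ℝ, F (θ + τ • v) = a + b * τ + c * τ ^ 2 + p * τ ^ 3 + q * τ ^ 4) :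
    fderiv ℝ F θ v = b := by
  have h1 := hasDerivAt_line hF v
  rw [show (fun τ : ℝ => F (θ + τ • v)) = fun τ => _ from funext h] at h1
  have h2 := (((((hasDerivAt_id (0 : ℝ)).const_mul b).const_add a).add
    (((hasDerivAt_id (0 : ℝ)).pow 2).const_mul c)).add
    (((hasDerivAt_id (0 : ℝ)).pow 3).const_mul p)).add
    (((hasDerivAt_id (0 : ℝ)).pow 4).const_mul q)
  simpa using h1.unique h2

theorem firstOrder_traceInv_chi : FirstOrder (traceInv chi) := by
  intro θ x w
  simp only [traceInv, chi_eq]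
  rfl

theorem firstOrder_detInv_gam : FirstOrder (detInv gam) := by
  intro θ x w
  have h1 : ∀ i j, chi (x, θ.2.1, θ.2.2.1, w) i j = chi θ i j := fun i j => by
    rw [chi_eq, chi_eq]; rfl
  have h2 : ∀ i, sig i (x, θ.2.1, θ.2.2.1, w) = sig i θ := fun i => by
    rw [sig_eq, sig_eq]; rfl
  simp only [detInv, Matrix.det_fin_two, gam, rho, Matrix.sub_apply, Matrix.smul_apply,
    Matrix.of_apply, h1, h2]
  rfl

/-- Equality of the metric coefficients and of the first derivatives of `h`. -/
def SameKill (θ η : Jet2) : Prop :=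
  θ.2.1.1 = η.2.1.1 ∧ θ.2.1.2.2 = η.2.1.2.2 ∧ ∀ i, (θ.2.2.1 i).2.2 = (η.2.2.1 i).2.2

theorem SameKill.traceInv_chi {θ η : Jet2} (h : SameKill θ η) :
    traceInv chi θ = traceInv chi η := by
  simp only [traceInv_eq, chi_eq, detG_eq, detH_eq, h.1, h.2.1, h.2.2]

theorem SameKill.detInv_gam {θ η : Jet2} (h : SameKill θ η) : detInv gam θ = detInv gam η := by
  simp only [detInv, Matrix.det_fin_two, gam, rho, Matrix.sub_apply, Matrix.smul_apply,
    Matrix.of_apply, chi_eq, sig_eq, detHDeriv, detG_eq, detH_eq, h.1, h.2.1, h.2.2]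

/-- The genericity conditions on points of the slice. -/
structure SliceGeneric (ε δ : ℝ) (s : Fin 10 → ℝ) : Prop where
  trace_ne : s 0 ≠ 0
  length_ne : s 1 ≠ 0
  trans_ne : s 3 ≠ 0
  det_ne : sliceDet s ≠ 0
  mixed_ne : sliceForm δ s 1 ≠ 0
  disc_ne : ε * (sliceForm δ s 0 - ε * sliceForm δ s 2) ^ 2 + 4 * sliceForm δ s 1 ^ 2 ≠ 0

section Variation

variable {Λ ε δ : ℝ} {s v : Fin 10 → ℝ}

/-- Changing h_,i by tracefree matrices preserves σ, hence leads to another point of the slice as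
far as C_χ and Q_γ can tell. Their values on the slice then yield directional derivatives in the
full jet space. -/
theorem sameKill_step (p q : Fin 2 → ℝ) {w : Fin 2 → Fib}
    (hw : ∀ j, (w j).2.2 = ![s 1 * p j, s 1 * q j, -(δ * (s 1 * p j))]) (τ : ℝ) :
    SameKill (sliceJet Λ ε δ s + τ • ((0, 0, w, 0) : Jet2))
      (sliceJet Λ ε δ (s + τ • ![0, 0, p 0, p 1, q 0, q 1, 0, 0, 0, 0])) := by
  refine ⟨?_, ?_, fun i => ?_⟩
  · simp [sliceJet, einJet, normalJet]
  · simp [sliceJet, einJet, normalJet]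
  · change ((sliceJet Λ ε δ s).2.2.1 i).2.2 + τ • (w i).2.2 = _
    rw [hw]
    rcases eq_zero_or_one i with rfl | rfl <;> simp [sliceJet, einJet, normalJet, sliceDeriv]
    all_goals refine ⟨?_, ?_, ?_⟩ <;> ring

variable (hε : ε ^ 2 = 1) (hδ : δ ^ 2 = 1) (h0 : s 0 ≠ 0) (h1 : s 1 ≠ 0)

include hε in
theorem sliceJet_mem_einsteinJets (hδ : δ ^ 2 = 1) (h0 : s 0 ≠ 0) (h1 : s 1 ≠ 0) :
    sliceJet Λ ε δ s ∈ einsteinJets Λ :=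
  einJet_mem_einsteinJets h0 (mul_ne_zero (ne_zero_of_sq hε) h0) h1
    (mul_ne_zero (ne_zero_of_sq hδ) h1)

include hε hδ h0 h1

theorem fderiv_traceInv_chi (p q : Fin 2 → ℝ) {w : Fin 2 → Fib}
    (hw : ∀ j, (w j).2.2 = ![s 1 * p j, s 1 * q j, -(δ * (s 1 * p j))]) :
    fderiv ℝ (traceInv chi) (sliceJet Λ ε δ s) (0, 0, w, 0) =
      -(2 / s 0) * (s 2 * p 0 + δ * (s 4 * q 0) + ε * (s 3 * p 1 + δ * (s 5 * q 1))) := by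
  have hm := (sliceJet_mem_einsteinJets (Λ := Λ) hε hδ h0 h1).1
  refine fderiv_eq_of_quadratic (a := s 0 / 4 - (sliceForm δ s 0 + ε * sliceForm δ s 2) / s 0)
    (c := -(p 0 ^ 2 + δ * q 0 ^ 2 + ε * (p 1 ^ 2 + δ * q 1 ^ 2)) / s 0) (p := 0) (q := 0)
    (differentiableAt_of_smooth (contDiffAt_traceInv hm (contDiffAt_chi hm))) fun τ => ?_
  rw [(sameKill_step p q hw τ).traceInv_chi, traceInv_chi_sliceJet hε hδ (by simpa) (by simpa)]
  simp [sliceForm]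
  field_simp
  ring

theorem fderiv_detInv_gam (p q : Fin 2 → ℝ) {w : Fin 2 → Fib}
    (hw : ∀ j, (w j).2.2 = ![s 1 * p j, s 1 * q j, -(δ * (s 1 * p j))]) :
    fderiv ℝ (detInv gam) (sliceJet Λ ε δ s) (0, 0, w, 0) = 2 * ε * δ * sliceDet s / s 0 ^ 2 *
      (p 0 * s 5 + s 2 * q 1 - p 1 * s 4 - s 3 * q 0) := by
  have hm := (sliceJet_mem_einsteinJets (Λ := Λ) hε hδ h0 h1).1
  refine fderiv_eq_of_quadratic (a := ε * δ * sliceDet s ^ 2 / s 0 ^ 2)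
    (c := ε * δ / s 0 ^ 2 * ((p 0 * s 5 + s 2 * q 1 - p 1 * s 4 - s 3 * q 0) ^ 2 +
      2 * sliceDet s * (p 0 * q 1 - p 1 * q 0)))
    (p := ε * δ / s 0 ^ 2 * (2 * (p 0 * s 5 + s 2 * q 1 - p 1 * s 4 - s 3 * q 0) *
      (p 0 * q 1 - p 1 * q 0))) (q := ε * δ / s 0 ^ 2 * (p 0 * q 1 - p 1 * q 0) ^ 2)
    (differentiableAt_of_smooth (contDiffAt_detInv hm (contDiffAt_gam hm))) fun τ => ?_
  rw [(sameKill_step p q hw τ).detInv_gam, detInv_gam_sliceJet hε hδ (by simpa) (by simpa)]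
  simp [sliceDet]
  field_simp
  ring

/-- The variation of the second derivatives of `h` along the slice. -/
theorem sliceJet_second_sub (hv : ∀ i < 6, v i = 0) (τ : ℝ) (m : Fin 3) :
    ((sliceJet Λ ε δ (s + τ • v)).2.2.2 m - (sliceJet Λ ε δ s).2.2.2 m).2.2 =
      ![s 1 * (![v 6, v 8, -(ε * v 6)] m * (τ / s 1)), s 1 * (![v 7, v 9, -(ε * v 7)] m * (τ / s 1)),
        -(δ * (s 1 * (![v 6, v 8, -(ε * v 6)] m * (τ / s 1))))] := by
  have e0 := hv 0 (by decide)
  have e1 := hv 1 (by decide)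
  have e2 := hv 2 (by decide)
  have e3 := hv 3 (by decide)
  have e4 := hv 4 (by decide)
  have e5 := hv 5 (by decide)
  have hd : sliceDeriv δ (s + τ • v) = sliceDeriv δ s := by
    simp [sliceDeriv, e0, e1, e2, e3, e4, e5]
  have hε' := ne_zero_of_sq hε
  have hδ' := ne_zero_of_sq hδ
  funext l
  fin_cases m <;> fin_cases l <;>
    simp [sliceJet, einJet, normalJet, hd, e0, e1, solveHess, solveFirst, solveMixed] <;>
    field_simp <;> ring

-- When the first six slice coordinates are fixed, only the second-order components of the jet move,
-- so the affine formula `totalD_second` is exact.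
omit hε hδ h0 h1 in
theorem totalD_slice {F : Jet2 → ℝ} (hF : FirstOrder F) (hv : ∀ i < 6, v i = 0) (τ : ℝ)
    (i : Fin 2) : totalD (Sum.inl i) F (sliceJet Λ ε δ (s + τ • v)) =
      totalD (Sum.inl i) F (sliceJet Λ ε δ s) + fderiv ℝ F (sliceJet Λ ε δ s)
        (0, 0, fun j => (sliceJet Λ ε δ (s + τ • v)).2.2.2 (symIdx i j) -
          (sliceJet Λ ε δ s).2.2.2 (symIdx i j), 0) := by
  rw [← totalD_second hF]
  have hd : sliceDeriv δ (s + τ • v) = sliceDeriv δ s := by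
    simp [sliceDeriv, hv 0 (by decide), hv 1 (by decide), hv 2 (by decide), hv 3 (by decide),
      hv 4 (by decide), hv 5 (by decide)]
  congr 1
  simp [sliceJet, einJet, normalJet, hd, hv 0 (by decide), hv 1 (by decide)]

theorem totalD_traceInv_chi_slice (hv : ∀ i < 6, v i = 0) (τ : ℝ) (i : Fin 2) :
    totalD (Sum.inl i) (traceInv chi) (sliceJet Λ ε δ (s + τ • v)) =
      totalD (Sum.inl i) (traceInv chi) (sliceJet Λ ε δ s) + τ * (-(2 / (s 0 * s 1)) *
        (![s 2 * v 6 + δ * (s 4 * v 7) + ε * (s 3 * v 8 + δ * (s 5 * v 9)),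
          s 2 * v 8 + δ * (s 4 * v 9) - (s 3 * v 6 + δ * (s 5 * v 7))] : Fin 2 → ℝ) i) := by
  rw [totalD_slice firstOrder_traceInv_chi hv, fderiv_traceInv_chi hε hδ h0 h1
    (fun j => ![v 6, v 8, -(ε * v 6)] (symIdx i j) * (τ / s 1))
    (fun j => ![v 7, v 9, -(ε * v 7)] (symIdx i j) * (τ / s 1)) fun j =>
      sliceJet_second_sub hε hδ h0 h1 hv τ _]
  rcases eq_zero_or_one i with rfl | rfl <;> simp [symIdx] <;> field_simp
  rw [hε]
  ring

theorem totalD_detInv_gam_slice (hv : ∀ i < 6, v i = 0) (τ : ℝ) (i : Fin 2) :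
    totalD (Sum.inl i) (detInv gam) (sliceJet Λ ε δ (s + τ • v)) =
      totalD (Sum.inl i) (detInv gam) (sliceJet Λ ε δ s) + τ *
        (2 * ε * δ * sliceDet s / (s 0 ^ 2 * s 1) *
        (![v 6 * s 5 + s 2 * v 9 - v 8 * s 4 - s 3 * v 7,
          v 8 * s 5 - ε * (s 2 * v 7) + ε * (v 6 * s 4) - s 3 * v 9] : Fin 2 → ℝ) i) := by
  rw [totalD_slice firstOrder_detInv_gam hv, fderiv_detInv_gam hε hδ h0 h1
    (fun j => ![v 6, v 8, -(ε * v 6)] (symIdx i j) * (τ / s 1))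
    (fun j => ![v 7, v 9, -(ε * v 7)] (symIdx i j) * (τ / s 1)) fun j =>
      sliceJet_second_sub hε hδ h0 h1 hv τ _]
  rcases eq_zero_or_one i with rfl | rfl <;> simp [symIdx] <;> field_simp
  ring

end Variation

/-- The linear system for the second-order variations. -/
theorem eq_zero_of_hess {ε δ a₁ a₂ b₁ b₂ p q r t : ℝ} (hε : ε ^ 2 = 1) (hD : a₁ * b₂ - a₂ * b₁ ≠ 0)
    (hN : ε * ((a₁ ^ 2 + δ * b₁ ^ 2) - ε * (a₂ ^ 2 + δ * b₂ ^ 2)) ^ 2 +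
      4 * (a₁ * a₂ + δ * (b₁ * b₂)) ^ 2 ≠ 0)
    (e1 : a₁ * p + δ * (b₁ * q) + ε * (a₂ * r + δ * (b₂ * t)) = 0)
    (e2 : a₁ * r + δ * (b₁ * t) - (a₂ * p + δ * (b₂ * q)) = 0)
    (e3 : p * b₂ + a₁ * t - r * b₁ - a₂ * q = 0)
    (e4 : r * b₂ - ε * (a₁ * q) + ε * (p * b₁) - a₂ * t = 0) :
    p = 0 ∧ q = 0 ∧ r = 0 ∧ t = 0 := by
  set D := a₁ * b₂ - a₂ * b₁ with hDdef
  set X := (a₁ ^ 2 + δ * b₁ ^ 2) - ε * (a₂ ^ 2 + δ * b₂ ^ 2) with hX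
  set m := a₁ * a₂ + δ * (b₁ * b₂) with hm
  -- `A / D` and `B / D` are the components of (p, q) in the basis (a₁, b₁), (a₂, b₂). The equations
  -- `e3` and `e4` then express (r, t) in this basis through `A` and `B`.
  obtain ⟨A, hA⟩ : ∃ A, A = p * b₂ - a₂ * q := ⟨_, rfl⟩
  obtain ⟨B, hB⟩ : ∃ B, B = a₁ * q - p * b₁ := ⟨_, rfl⟩
  have hp : D * p = A * a₁ + B * a₂ := by rw [hA, hB, hDdef]; ring
  have hq : D * q = A * b₁ + B * b₂ := by rw [hA, hB, hDdef]; ring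
  have c1 : a₁ * t - r * b₁ = -A := by rw [hA]; linear_combination e3
  have c2 : r * b₂ - a₂ * t = ε * B := by rw [hB]; linear_combination e4
  have hr : D * r = ε * B * a₁ - A * a₂ := by
    rw [hDdef]; linear_combination a₁ * c2 + a₂ * c1
  have ht : D * t = ε * B * b₁ - A * b₂ := by
    rw [hDdef]; linear_combination b₁ * c2 + b₂ * c1
  have f1 : A * X + 2 * B * m = 0 := by
    rw [hX, hm]
    linear_combination D * e1 - a₁ * hp - δ * b₁ * hq - ε * a₂ * hr - ε * δ * b₂ * ht -
      B * (a₁ * a₂ + δ * (b₁ * b₂)) * hε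
  have f2 : ε * B * X - 2 * A * m = 0 := by
    rw [hX, hm]
    linear_combination D * e2 - a₁ * hr - δ * b₁ * ht + a₂ * hp + δ * b₂ * hq -
      B * (a₂ ^ 2 + δ * b₂ ^ 2) * hε
  -- `f1` and `f2` are linear in `A`, `B`, and their determinant is ε X² + 4 m², nonzero by `hN`.
  have hA0 : A = 0 := by
    have : A * (ε * X ^ 2 + 4 * m ^ 2) = 0 := by linear_combination ε * X * f1 - 2 * m * f2
    exact (mul_eq_zero.1 this).resolve_right hN
  have hB0 : B = 0 := by
    have : B * (ε * X ^ 2 + 4 * m ^ 2) = 0 := by linear_combination 2 * m * f1 + X * f2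
    exact (mul_eq_zero.1 this).resolve_right hN
  rw [hA0, hB0] at hp hq hr ht
  refine ⟨?_, ?_, ?_, ?_⟩ <;>
    first
    | exact (mul_eq_zero.1 (hp.trans (by ring))).resolve_left hD
    | exact (mul_eq_zero.1 (hq.trans (by ring))).resolve_left hD
    | exact (mul_eq_zero.1 (hr.trans (by ring))).resolve_left hD
    | exact (mul_eq_zero.1 (ht.trans (by ring))).resolve_left hD

theorem hasDerivAt_affine (a b : ℝ) : HasDerivAt (fun t : ℝ => a + t * b) b 0 := by
  simpa using ((hasDerivAt_id (0 : ℝ)).mul_const b).const_add a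

/-- The differential of the ten invariants along the slice is injective at generic points. -/
theorem eq_zero_of_hasDerivAt_slice {Λ ε δ : ℝ} {s v : Fin 10 → ℝ} (hε : ε ^ 2 = 1)
    (hδ : δ ^ 2 = 1) (hs : SliceGeneric ε δ s)
    (h : ∀ i, HasDerivAt (fun t : ℝ => tenInv i (sliceJet Λ ε δ (s + t • v))) 0 0) : v = 0 := by
  obtain ⟨h0, h1, h3, hD, hm, hN⟩ := hs
  have hε' := ne_zero_of_sq hε
  have hδ' := ne_zero_of_sq hδ
  have ev : ∀ i, s i ≠ 0 → ∀ᶠ t : ℝ in 𝓝 0, (s + t • v) i ≠ 0 := fun i hi => by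
    have := (hasDerivAt_affine (s i) (v i)).continuousAt.eventually_ne (by simpa using hi)
    simpa using this
  have ev0 := ev 0 h0
  have ev1 := ev 1 h1
  -- C_ρ and ℓ_𝒞 are themselves slice coordinates. Once these are stationary, `s 0` and `s 1` are
  -- constant along the line in all other evaluations.
  have v0 : v 0 = 0 := by
    refine (hasDerivAt_affine (s 0) (v 0)).unique ((h 0).congr_of_eventuallyEq ?_)
    filter_upwards [ev0, ev1] with t a b
    exact (traceInv_rho_sliceJet (Λ := Λ) hε hδ a b).symm
  have v1 : v 1 = 0 := by
    refine (hasDerivAt_affine (s 1) (v 1)).unique ((h 4).congr_of_eventuallyEq ?_)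
    filter_upwards [ev0] with t a
    exact (ellC_sliceJet (Λ := Λ) (δ := δ) hε a).symm
  have s0 : ∀ t : ℝ, (s + t • v) 0 = s 0 := fun t => by simp [v0]
  have s1 : ∀ t : ℝ, (s + t • v) 1 = s 1 := fun t => by simp [v1]
  have n0 : ∀ t : ℝ, (s + t • v) 0 ≠ 0 := fun t => by rwa [s0]
  have n1 : ∀ t : ℝ, (s + t • v) 1 ≠ 0 := fun t => by rwa [s1]
  have da : ∀ i, HasDerivAt (fun t : ℝ => (s + t • v) i) (v i) 0 := fun i =>
    hasDerivAt_affine (s i) (v i)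
  have dD : HasDerivAt (fun t : ℝ => sliceDet (s + t • v))
      (v 2 * s 5 + s 2 * v 5 - (v 3 * s 4 + s 3 * v 4)) 0 := by
    have := ((da 2).fun_mul (da 5)).fun_sub ((da 3).fun_mul (da 4))
    simp only [zero_smul, add_zero] at this
    exact this
  have df0 : HasDerivAt (fun t : ℝ => sliceForm δ (s + t • v) 0)
      (2 * (s 2 * v 2) + δ * (2 * (s 4 * v 4))) 0 := by
    have := ((da 2).pow 2).add (((da 4).pow 2).const_mul δ)
    simp [mul_assoc] at this
    exact this
  have df2 : HasDerivAt (fun t : ℝ => sliceForm δ (s + t • v) 2)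
      (2 * (s 3 * v 3) + δ * (2 * (s 5 * v 5))) 0 := by
    have := ((da 3).pow 2).add (((da 5).pow 2).const_mul δ)
    simp [mul_assoc] at this
    exact this
  -- With `s 0` fixed, Q_γ depends only on `sliceDet`. Then Q_χ isolates the component 22 of
  -- `sliceForm`, C_χ the component 11, and Θ_I the coordinate `s 5`.
  have D' : v 2 * s 5 + s 2 * v 5 - (v 3 * s 4 + s 3 * v 4) = 0 := by
    have e : (fun t : ℝ => tenInv 3 (sliceJet Λ ε δ (s + t • v))) = fun t =>
        ε * δ / s 0 ^ 2 * sliceDet (s + t • v) ^ 2 := by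
      funext t
      refine (detInv_gam_sliceJet hε hδ (n0 t) (n1 t)).trans ?_
      rw [s0]; ring
    have := (e ▸ h 3).unique ((dD.fun_pow 2).const_mul (ε * δ / s 0 ^ 2))
    simp at this
    tauto
  rw [D'] at dD
  have f2 : 2 * (s 3 * v 3) + δ * (2 * (s 5 * v 5)) = 0 := by
    have e : (fun t : ℝ => tenInv 2 (sliceJet Λ ε δ (s + t • v))) = fun t =>
        ε * δ / s 0 ^ 2 * sliceDet (s + t • v) ^ 2 - ε / 4 * sliceForm δ (s + t • v) 2 := by
      funext t
      refine (detInv_chi_sliceJet hε hδ (n0 t) (n1 t)).trans ?_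
      rw [s0]; ring
    have := (e ▸ h 2).unique (((dD.fun_pow 2).const_mul (ε * δ / s 0 ^ 2)).fun_sub (df2.const_mul (ε / 4)))
    simp [hε'] at this
    linear_combination this
  have f0 : 2 * (s 2 * v 2) + δ * (2 * (s 4 * v 4)) = 0 := by
    have e : (fun t : ℝ => tenInv 1 (sliceJet Λ ε δ (s + t • v))) = fun t =>
        s 0 / 4 - (sliceForm δ (s + t • v) 0 + ε * sliceForm δ (s + t • v) 2) / s 0 := by
      funext t
      refine (traceInv_chi_sliceJet hε hδ (n0 t) (n1 t)).trans ?_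
      rw [s0]
    rw [f2] at df2
    have := (e ▸ h 1).unique (((df0.fun_add (df2.const_mul ε)).div_const (s 0)).const_sub (s 0 / 4))
    simp [h0] at this
    linear_combination this
  have v5 : v 5 = 0 := by
    have e : (fun t : ℝ => tenInv 5 (sliceJet Λ ε δ (s + t • v))) = fun t =>
        |s 1| / |s 0| * (s 0 * (s + t • v) 5 / 2 + sliceDet (s + t • v)) := by
      funext t
      refine (thetaI_sliceJet hε hδ (n0 t) (n1 t)).trans ?_
      rw [s0, s1]
    have := (e ▸ h 5).unique (((((da 5).const_mul (s 0)).div_const 2).fun_add dD).const_mul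
      (|s 1| / |s 0|))
    simpa [h0, h1] using this
  have v3 : v 3 = 0 := by
    rw [v5] at f2
    exact (mul_eq_zero.1 (show s 3 * v 3 = 0 by linear_combination f2 / 2)).resolve_left h3
  have v2 : v 2 = 0 := by
    rw [v3, v5] at D'
    -- `f0` and `D'` are now two linear equations for `v 2` and `v 4`, with determinant, up to sign
    -- and a factor 2, `sliceForm δ s 1`.
    refine (mul_eq_zero.1 (?_ : v 2 * sliceForm δ s 1 = 0)).resolve_right hm
    change v 2 * (s 2 * s 3 + δ * (s 4 * s 5)) = 0
    linear_combination s 3 * f0 / 2 + δ * s 4 * D'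
  have v4 : v 4 = 0 := by
    rw [v3, v5, v2] at D'
    exact (mul_eq_zero.1 (show s 3 * v 4 = 0 by linear_combination -D')).resolve_left h3
  have hv : ∀ i < 6, v i = 0 := by
    intro i hi
    fin_cases i <;> first | assumption | exact absurd hi (by decide)
  have hX : ∀ c k : ℝ, HasDerivAt (fun t : ℝ => c + t * k) 0 0 → k = 0 := fun c k hk =>
    (hasDerivAt_affine c k).unique hk
  have key := fun (F : Jet2 → ℝ) (i : Fin 10) (hF : tenInv i = diffX F) (t : ℝ) =>
    (congrFun hF (sliceJet Λ ε δ (s + t • v))).trans (diffX_sliceJet hε hδ (n0 t) (n1 t) F)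
  have key' := fun (F : Jet2 → ℝ) (i : Fin 10) (hF : tenInv i = diffXperp F) (t : ℝ) =>
    (congrFun hF (sliceJet Λ ε δ (s + t • v))).trans (diffXperp_sliceJet hε hδ (n1 t) F)
  have g6 := h 6
  have g7 := h 7
  have g8 := h 8
  have g9 := h 9
  -- The second-order functions are affine in the remaining four directions, so stationarity is a
  -- homogeneous linear system for `v 6` to `v 9`.
  simp only [key _ 6 rfl, key _ 7 rfl, key' _ 8 rfl, key' _ 9 rfl, s0,
    totalD_traceInv_chi_slice hε hδ h0 h1 hv, totalD_detInv_gam_slice hε hδ h0 h1 hv] at g6 g7 g8 g9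
  have k6 := hX _ _ g6
  have k7 := hX _ _ g7
  have k8 := (((hasDerivAt_affine _ _).const_mul (-(s 0 / |s 0|))).unique g8)
  have k9 := (((hasDerivAt_affine _ _).const_mul (-(s 0 / |s 0|))).unique g9)
  simp [h0, h1] at k6 k8
  simp [h0, h1, hε', hδ', hD] at k7 k9
  obtain ⟨v6, v7, v8, v9⟩ := eq_zero_of_hess hε hD hN k6 k8 k7 k9
  funext i
  fin_cases i <;> assumption

/-! ### Generic jets -/

/-- The first-order invariant vanishing where `g̃(X, ·)` is an eigenform of `γ`. -/
def mixedInv (θ : Jet2) : ℝ :=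
  4 * (detInv gam θ - detInv chi θ) * (-traceInv rho θ * (traceInv chi θ - traceInv rho θ / 4) -
    4 * (detInv gam θ - detInv chi θ)) - traceInv rho θ ^ 2 * detInv gam θ

/-- The discriminant of `γ` with respect to `g̃`. -/
def discInv (θ : Jet2) : ℝ :=
  (traceInv chi θ - traceInv rho θ / 4) ^ 2 - 4 * detInv gam θ

/-- The (semi-)invariants required to be nonzero at generic jets. -/
def genInv : Fin 6 → Jet2 → ℝ :=
  ![traceInv rho, ellC, detInv gam, transCurv, mixedInv, discInv]

/-- The open set of generic jets. -/
def genericJets : Set Jet2 := {θ | θ ∈ metricJets ∧ ∀ i, genInv i θ ≠ 0}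

theorem contDiffAt_transCurv {θ : Jet2} (hθ : θ ∈ metricJets) : ContDiffAt ℝ ∞ transCurv θ := by
  have hs := contDiffAt_sig hθ
  have hc := contDiffAt_curv hθ
  have hh := fun m i => (contDiff_deriv (compH m) i).contDiffAt (x := θ)
  have hd := fun m => ((hs 1).mul (hh m 0)).sub ((hs 0).mul (hh m 1))
  exact ((((hd 0).mul ((hc 0).pow 2)).add (contDiffAt_const.mul ((hd 1).mul ((hc 0).mul
    (hc 1))))).add ((hd 2).mul ((hc 1).pow 2))).div
      (contDiffAt_sqrt_abs contDiff_detG.contDiffAt (detG_ne_zero hθ))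
      (sqrt_sq_eq (detG_ne_zero hθ)).1

theorem contDiffAt_genInv {θ : Jet2} (hθ : θ ∈ metricJets) (i : Fin 6) :
    ContDiffAt ℝ ∞ (genInv i) θ := by
  have hr := contDiffAt_traceInv hθ (contDiffAt_rho hθ)
  have hc := contDiffAt_traceInv hθ (contDiffAt_chi hθ)
  have hd := contDiffAt_detInv hθ (contDiffAt_chi hθ)
  have hg := contDiffAt_detInv hθ (contDiffAt_gam hθ)
  have h4 := contDiffAt_const (c := (4 : ℝ)).mul (hg.sub hd)
  fin_cases i
  · exact hr
  · exact contDiffAt_ellC hθ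
  · exact hg
  · exact contDiffAt_transCurv hθ
  · exact (h4.mul ((hr.neg.mul (hc.sub (hr.div_const 4))).sub h4)).sub ((hr.pow 2).mul hg)
  · exact ((hc.sub (hr.div_const 4)).pow 2).sub (contDiffAt_const.mul hg)

theorem isOpen_genericJets : IsOpen genericJets := by
  refine isOpen_iff_mem_nhds.2 fun θ hθ => ?_
  filter_upwards [isOpen_metricJets.mem_nhds hθ.1, Filter.eventually_all.2 fun i =>
    (contDiffAt_genInv hθ.1 i).continuousAt.eventually_ne (hθ.2 i)] with η h1 h2
  exact ⟨h1, h2⟩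

theorem genInv_semi (i : Fin 6) : ∃ m n, TensorSemi m n (genInv i) := by
  fin_cases i
  · exact ⟨0, 0, tensorSemi_traceInv_rho⟩
  · exact ⟨0, 0, tensorSemi_ellC⟩
  · exact ⟨0, 0, tensorSemi_detInv_gam⟩
  · exact ⟨1, 0, tensorSemi_transCurv⟩
  all_goals
    refine ⟨0, 0, fun J α θ θ' h hJ hα hm => ?_⟩
    have e1 := tensorSemi_traceInv_rho J α θ θ' h hJ hα hm
    have e2 := tensorSemi_traceInv_chi J α θ θ' h hJ hα hm
    have e3 := tensorSemi_detInv_chi J α θ θ' h hJ hα hm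
    have e4 := tensorSemi_detInv_gam J α θ θ' h hJ hα hm
    simp only [pow_zero, one_mul] at e1 e2 e3 e4 ⊢
  · show mixedInv θ' = mixedInv θ
    rw [mixedInv, mixedInv, e1, e2, e3, e4]
  · show discInv θ' = discInv θ
    rw [discInv, discInv, e1, e2, e4]

theorem genericJets_of_rel {a b : ℝ} {θ θ' : Jet2} (h : Rel a b θ θ') (hθ' : θ' ∈ genericJets) :
    θ ∈ genericJets := by
  have hm := metricJets_of_rel h hθ'.1
  refine ⟨hm, fun i h0 => hθ'.2 i ?_⟩
  obtain ⟨m, n, hi⟩ := genInv_semi i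
  rw [hi.transformsWith.rel h hm hθ'.1, h0, mul_zero]

/-- Each genericity condition on the slice is the trace of an invariant one. The formula of
`mixedInv` is designed so that 4(Q_γ − Q_χ) gives ε times the component 22 of `sliceForm`, its other
factor the component 11, and the last term the determinant. It evaluates to ε times the square of
the component 12. -/
theorem sliceGeneric_iff {Λ ε δ : ℝ} {s : Fin 10 → ℝ} (hε : ε ^ 2 = 1) (hδ : δ ^ 2 = 1)
    (h0 : s 0 ≠ 0) (h1 : s 1 ≠ 0) :
    sliceJet Λ ε δ s ∈ genericJets ↔ SliceGeneric ε δ s := by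
  have hε' := ne_zero_of_sq hε
  have hδ' := ne_zero_of_sq hδ
  have hm := (sliceJet_mem_einsteinJets (Λ := Λ) hε hδ h0 h1).1
  have e3 : genInv 3 (sliceJet Λ ε δ s) = -(s 0 * s 1 * s 3 / |s 0|) :=
    transCurv_sliceJet hε hδ h0 h1
  have e2 : genInv 2 (sliceJet Λ ε δ s) = ε * δ * sliceDet s ^ 2 / s 0 ^ 2 :=
    detInv_gam_sliceJet hε hδ h0 h1
  have e4 : genInv 4 (sliceJet Λ ε δ s) = ε * sliceForm δ s 1 ^ 2 := by
    change mixedInv _ = _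
    rw [mixedInv, traceInv_rho_sliceJet hε hδ h0 h1, traceInv_chi_sliceJet hε hδ h0 h1,
      detInv_chi_sliceJet hε hδ h0 h1, detInv_gam_sliceJet hε hδ h0 h1]
    have := sliceForm_det (δ := δ) (s := s)
    field_simp
    linear_combination 4 * s 0 ^ 4 * this
  have e5 : genInv 5 (sliceJet Λ ε δ s) = ε * (ε * (sliceForm δ s 0 - ε * sliceForm δ s 2) ^ 2 +
      4 * sliceForm δ s 1 ^ 2) / s 0 ^ 2 := by
    change discInv _ = _
    rw [discInv, traceInv_rho_sliceJet hε hδ h0 h1, traceInv_chi_sliceJet hε hδ h0 h1,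
      detInv_gam_sliceJet hε hδ h0 h1]
    have := sliceForm_det (δ := δ) (s := s)
    field_simp
    linear_combination 64 * ε * this - 16 * (sliceForm δ s 0 - ε * sliceForm δ s 2) ^ 2 * hε
  constructor
  · rintro ⟨-, h⟩
    refine ⟨h0, h1, ?_, ?_, ?_, ?_⟩ <;> intro hz
    · exact h 3 (by rw [e3, hz]; simp)
    · exact h 2 (by rw [e2, hz]; simp)
    · exact h 4 (by rw [e4, hz]; simp)
    · exact h 5 (by rw [e5, hz]; simp)
  · rintro ⟨-, -, h3, hD, hf, hN⟩
    refine ⟨hm, fun i => ?_⟩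
    have a0 : |s 0| ≠ 0 := abs_ne_zero.2 h0
    fin_cases i
    · exact (traceInv_rho_sliceJet (Λ := Λ) hε hδ h0 h1).trans_ne h0
    · exact (ellC_sliceJet (Λ := Λ) (δ := δ) hε h0).trans_ne h1
    · exact e2.trans_ne (by positivity)
    · exact e3.trans_ne (by simp [h0, h1, h3])
    · exact e4.trans_ne (by positivity)
    · exact e5.trans_ne (div_ne_zero (mul_ne_zero hε' hN) (by positivity))

/-! ### Differentiability of the parametrized normal forms. -/

theorem differentiableAt_vec {n : ℕ} {E : Type*} [NormedAddCommGroup E] [NormedSpace ℝ E]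
    {V : Type*} [NormedAddCommGroup V] [NormedSpace ℝ V] {f : V → E} {g : V → Fin n → E} {x : V}
    (hf : DifferentiableAt ℝ f x) (hg : DifferentiableAt ℝ g x) :
    DifferentiableAt ℝ (fun y => Matrix.vecCons (f y) (g y) : V → Fin (n + 1) → E) x := by
  rw [differentiableAt_pi] at hg ⊢
  refine Fin.cases ?_ fun i => ?_
  · simpa using hf
  · simpa using hg i

theorem differentiableAt_einJet {P : Type*} [NormedAddCommGroup P] [NormedSpace ℝ P] {Λ : ℝ}
    {c₁ c₂ h₁ h₂ : P → ℝ} {H : P → Fin 2 → Fin 3 → ℝ} {c : P → Fin 2 → ℝ} {x : P → Fin 4 → ℝ}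
    {p : P} (d₁ : DifferentiableAt ℝ c₁ p) (d₂ : DifferentiableAt ℝ c₂ p)
    (d₃ : DifferentiableAt ℝ h₁ p) (d₄ : DifferentiableAt ℝ h₂ p)
    (dH : DifferentiableAt ℝ H p) (dc : DifferentiableAt ℝ c p) (dx : DifferentiableAt ℝ x p)
    (n₁ : c₁ p ≠ 0) (n₂ : c₂ p ≠ 0) (n₃ : h₁ p ≠ 0) (n₄ : h₂ p ≠ 0) :
    DifferentiableAt ℝ (fun q => einJet Λ (c₁ q) (c₂ q) (h₁ q) (h₂ q) (H q) (c q) (x q)) p := by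
  have dH' : ∀ i, DifferentiableAt ℝ (fun q => H q i) p := differentiableAt_pi.1 dH
  have dH'' : ∀ i m, DifferentiableAt ℝ (fun q => H q i m) p := fun i =>
    differentiableAt_pi.1 (dH' i)
  have dc' : ∀ i, DifferentiableAt ℝ (fun q => c q i) p := differentiableAt_pi.1 dc
  have dx' : ∀ i, DifferentiableAt ℝ (fun q => x q i) p := differentiableAt_pi.1 dx
  have hl : ∀ i, DifferentiableAt ℝ (fun q => leafTerm Λ (c₁ q) (c₂ q) (h₁ q) (h₂ q) (H q)
      (c q) i) p := by
    intro i
    fin_cases i <;> simp [leafTerm] <;> fun_prop (disch := simp [*])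
  have hq : ∀ i, DifferentiableAt ℝ (fun q => squareTerm (h₁ q) (h₂ q) (H q) i) p := by
    intro i
    simp only [squareTerm]
    fun_prop (disch := simp [*])
  have hF : DifferentiableAt ℝ (fun q => solveFirst Λ (c₁ q) (c₂ q) (h₁ q) (h₂ q) (H q)
      (c q) (x q)) p := by
    simp only [solveFirst]
    fun_prop (disch := simp [*])
  have hM : DifferentiableAt ℝ (fun q => solveMixed (h₁ q) (h₂ q) (H q) (x q)) p := by
    simp only [solveMixed]
    fun_prop (disch := simp [*])
  have hC : DifferentiableAt ℝ (fun q => solveCurv Λ (c₁ q) (c₂ q) (h₁ q) (h₂ q) (H q)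
      (c q) (x q)) p := by
    simp only [solveCurv]
    fun_prop (disch := simp [*])
  have hS : ∀ i, DifferentiableAt ℝ (fun q => solveShift (h₁ q) (h₂ q) (H q) (c q) i) p := by
    refine fun i => differentiableAt_pi.2 fun k => ?_
    rcases eq_zero_or_one k with rfl | rfl <;> simp [solveShift] <;> fun_prop (disch := simp [*])
  have hK : ∀ l, DifferentiableAt ℝ (fun q => solveHess Λ (c₁ q) (c₂ q) (h₁ q) (h₂ q) (H q)
      (c q) (x q) l) p := by
    refine fun l => differentiableAt_pi.2 fun m => ?_
    fin_cases l <;> fin_cases m <;> simp [solveHess] <;> fun_prop (disch := simp [*])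
  have c0 := fun {V : Type} [NormedAddCommGroup V] [NormedSpace ℝ V] (v : V) =>
    differentiableAt_const (𝕜 := ℝ) (x := p) v
  refine (c0 0).prodMk (((?_ : DifferentiableAt ℝ _ p).prodMk ((c0 0).prodMk ?_)).prodMk
    ((?_ : DifferentiableAt ℝ _ p).prodMk ?_))
  · exact differentiableAt_vec d₁ (differentiableAt_vec (c0 0) (differentiableAt_vec d₂ (c0 _)))
  · exact differentiableAt_vec d₃ (differentiableAt_vec (c0 0) (differentiableAt_vec d₄ (c0 _)))
  · exact differentiableAt_vec ((c0 _).prodMk ((c0 _).prodMk (dH' 0)))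
      (differentiableAt_vec ((c0 _).prodMk ((differentiableAt_vec dc
        (differentiableAt_vec (c0 0) (c0 _))).prodMk (dH' 1))) (c0 _))
  · exact differentiableAt_vec ((c0 _).prodMk ((c0 _).prodMk (hK 0)))
      (differentiableAt_vec ((differentiableAt_vec (c0 0) (differentiableAt_vec hC
        (differentiableAt_vec (c0 0) (c0 _)))).prodMk ((differentiableAt_vec (hS 0)
          (differentiableAt_vec (c0 0) (c0 _))).prodMk (hK 1)))
        (differentiableAt_vec ((c0 _).prodMk ((differentiableAt_vec (hS 1)
          (differentiableAt_vec (c0 0) (c0 _))).prodMk (hK 2))) (c0 _)))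

theorem differentiableAt_sliceJet {Λ ε δ : ℝ} {s : Fin 10 → ℝ} (hε : ε ≠ 0) (hδ : δ ≠ 0)
    (h0 : s 0 ≠ 0) (h1 : s 1 ≠ 0) : DifferentiableAt ℝ (sliceJet Λ ε δ) s := by
  have p : ∀ i, DifferentiableAt ℝ (fun s : Fin 10 → ℝ => s i) s := fun i => by fun_prop
  have hD : DifferentiableAt ℝ (sliceDeriv δ) s := by
    refine differentiableAt_pi.2 fun i => differentiableAt_pi.2 fun m => ?_
    rcases eq_zero_or_one i with rfl | rfl <;> fin_cases m <;> simp [sliceDeriv] <;> fun_prop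
  exact differentiableAt_einJet (p 0) ((p 0).const_mul ε) (p 1) ((p 1).const_mul δ) hD
    (differentiableAt_vec (p 0).neg (differentiableAt_const _))
    (differentiableAt_vec (p 6) (differentiableAt_vec (p 7) (differentiableAt_vec (p 8)
      (differentiableAt_vec (p 9) (differentiableAt_const _)))))
    h0 (mul_ne_zero hε h0) h1 (mul_ne_zero hδ h1)

/-! ### Differentials on the equation -/

/-- A family of linear forms separating points spans the dual space. -/
theorem span_range_eq_top_of_separating {n : ℕ} {φ : Fin n → (Fin n → ℝ) →ₗ[ℝ] ℝ}
    (h : ∀ v, (∀ i, φ i v = 0) → v = 0) : Submodule.span ℝ (Set.range φ) = ⊤ := by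
  have hinj : Function.Injective (LinearMap.pi φ) := by
    refine (injective_iff_map_eq_zero _).2 fun v hv => h v fun i => congrFun hv i
  set e := LinearEquiv.ofInjectiveEndo (LinearMap.pi φ) hinj
  refine Submodule.eq_top_iff'.2 fun ψ => ?_
  have : ψ = ∑ i, ψ (e.symm (Pi.single i 1)) • φ i := by
    refine LinearMap.ext fun v => ?_
    have hv : v = e.symm (∑ i, φ i v • Pi.single i (1 : ℝ)) := by
      rw [LinearEquiv.eq_symm_apply]
      exact pi_eq_sum_univ' (e v)
    conv_lhs => rw [hv]
    simp [mul_comm]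
  rw [this]
  exact Submodule.sum_mem _ fun i _ => Submodule.smul_mem _ _ (Submodule.subset_span ⟨i, rfl⟩)

theorem linearIndependent_of_separating {n : ℕ} {φ : Fin n → (Fin n → ℝ) →ₗ[ℝ] ℝ}
    (h : ∀ v, (∀ i, φ i v = 0) → v = 0) : LinearIndependent ℝ φ :=
  linearIndependent_of_top_le_span_of_card_eq_finrank (span_range_eq_top_of_separating h).ge
    (by simp [Subspace.dual_finrank_eq])

/-- The preimage of `E` is a neighbourhood, so its tangent cone is the whole space, and a derivative
maps tangent cones into tangent cones. -/
theorem fderiv_mem_tanSpace {n : ℕ} {E : Set Jet2} {f : (Fin n → ℝ) → Jet2} {s : Fin n → ℝ}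
    (hf : DifferentiableAt ℝ f s) (hE : ∀ᶠ s' in 𝓝 s, f s' ∈ E) (v : Fin n → ℝ) :
    fderiv ℝ f s v ∈ tanSpace E (f s) := by
  have h := (hf.hasFDerivAt.hasFDerivWithinAt (s := {s' | f s' ∈ E})).mapsTo_tangent_cone
  refine Submodule.subset_span (tangentConeAt_mono ?_ (h ?_))
  · rintro _ ⟨s', hs', rfl⟩
    exact hs'
  · rw [tangentConeAt_of_mem_nhds hE]
    trivial

/-- Functions which coincide on `E` have the same differential on the tangent space. -/
theorem fderiv_eq_on_tanSpace {E : Set Jet2} {F : Jet2 → ℝ} {G' : Jet2 →L[ℝ] ℝ} {G : Jet2 → ℝ}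
    {θ : Jet2} (hθ : θ ∈ E) (hF : DifferentiableAt ℝ F θ) (hG : HasFDerivAt G G' θ)
    (h : F =ᶠ[𝓝[E] θ] G) {w : Jet2} (hw : w ∈ tanSpace E θ) : fderiv ℝ F θ w = G' w := by
  have h1 := hF.hasFDerivAt.hasFDerivWithinAt (s := E)
  have h2 := (hG.hasFDerivWithinAt (s := E)).congr_of_eventuallyEq h (h.eq_of_nhdsWithin hθ)
  exact LinearMap.eqOn_span (f := (fderiv ℝ F θ).toLinearMap) (g := G'.toLinearMap)
    (h1.unique_on h2) hw

/-- Invariants of a retraction: differentials of functions factoring through a parametrized slice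
are spanned by any family separating the tangent vectors of the slice. -/
theorem diffOn_basis_of_slice {n : ℕ} {E : Set Jet2} {θ : Jet2} (hθ : θ ∈ E)
    {f : (Fin n → ℝ) → Jet2} {S : Jet2 → Fin n → ℝ} (hfθ : f (S θ) = θ)
    (hf : DifferentiableAt ℝ f (S θ)) (hS : DifferentiableAt ℝ S θ)
    (hE : ∀ᶠ s in 𝓝 (S θ), f s ∈ E) {I : Fin n → Jet2 → ℝ}
    (hI : ∀ i, DifferentiableAt ℝ (I i) θ) (hIS : ∀ i, I i =ᶠ[𝓝[E] θ] fun η => I i (f (S η)))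
    (hsep : ∀ v, (∀ i, fderiv ℝ (I i) θ (fderiv ℝ f (S θ) v) = 0) → v = 0) :
    LinearIndependent ℝ (fun i => diffOn E (I i) θ) ∧
      ∀ F : Jet2 → ℝ, DifferentiableAt ℝ F θ → F =ᶠ[𝓝[E] θ] (fun η => F (f (S η))) →
        diffOn E F θ ∈ Submodule.span ℝ (Set.range fun i => diffOn E (I i) θ) := by
  set A := fderiv ℝ f (S θ) with hA
  have hmem : ∀ v, A v ∈ tanSpace E θ := fun v => by
    have := fderiv_mem_tanSpace hf hE v
    rwa [hfθ] at this
  let B : (Fin n → ℝ) →ₗ[ℝ] tanSpace E θ := A.toLinearMap.codRestrict _ hmem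
  let R : tanSpace E θ →ₗ[ℝ] (Fin n → ℝ) := (fderiv ℝ S θ).toLinearMap.domRestrict _
  -- On tangent vectors of `E` the differential of `F` equals that of `F ∘ f ∘ S`, so it is
  -- determined by its restriction to the slice directions.
  have key : ∀ F : Jet2 → ℝ, DifferentiableAt ℝ F θ → F =ᶠ[𝓝[E] θ] (fun η => F (f (S η))) →
      diffOn E F θ = (diffOn E F θ ∘ₗ B) ∘ₗ R := fun F hF hFS => by
    ext w
    have hF' : HasFDerivAt F (fderiv ℝ F θ) (f (S θ)) := by
      rw [hfθ]; exact hF.hasFDerivAt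
    exact fderiv_eq_on_tanSpace hθ hF ((hF'.comp (S θ) hf.hasFDerivAt).comp θ hS.hasFDerivAt)
      hFS w.2
  have hsep' : ∀ v, (∀ i, (diffOn E (I i) θ ∘ₗ B) v = 0) → v = 0 := hsep
  constructor
  · exact (linearIndependent_of_separating hsep').of_comp (LinearMap.lcomp ℝ ℝ B)
  · intro F hF hFS
    have h := (span_range_eq_top_of_separating hsep').ge (Submodule.mem_top (x := diffOn E F θ ∘ₗ B))
    have h' := Submodule.mem_map_of_mem (f := LinearMap.lcomp ℝ ℝ R) h
    rw [Submodule.map_span, ← Set.range_comp] at h'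
    rw [key F hF hFS]
    convert h' using 3
    · funext i
      exact key _ (hI i) (hIS i)
    · rfl

/-! ### Invariance of the ten functions, and the basis property at generic jets. -/

theorem tenInv_invariant {i : Fin 10} (hi : i ∈ ({0, 1, 2, 3, 4, 6, 7} : Set (Fin 10))) :
    IsInvariantOn (tenInv i) metricJets := by
  have h1 := fun θ (hθ : θ ∈ metricJets) => contDiffAt_traceInv hθ (contDiffAt_chi hθ)
  have h2 := fun θ (hθ : θ ∈ metricJets) => contDiffAt_detInv hθ (contDiffAt_gam hθ)
  rcases hi with rfl | rfl | rfl | rfl | rfl | rfl | rfl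
  · exact tensorSemi_traceInv_rho.transformsWith
  · exact tensorSemi_traceInv_chi.transformsWith
  · exact tensorSemi_detInv_chi.transformsWith
  · exact tensorSemi_detInv_gam.transformsWith
  · exact tensorSemi_ellC.transformsWith
  · exact tensorSemi_traceInv_chi.diffX firstOrder_traceInv_chi h1
  · exact tensorSemi_detInv_gam.diffX firstOrder_detInv_gam h2

theorem tenInv_semiInvariant {i : Fin 10} (hi : i ∈ ({5, 8, 9} : Set (Fin 10))) :
    IsSemiInvariantOn (tenInv i) metricJets := by
  have h1 := fun θ (hθ : θ ∈ metricJets) => contDiffAt_traceInv hθ (contDiffAt_chi hθ)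
  have h2 := fun θ (hθ : θ ∈ metricJets) => contDiffAt_detInv hθ (contDiffAt_gam hθ)
  rcases hi with rfl | rfl | rfl
  · exact ⟨1, 1, tensorSemi_thetaI.transformsWith⟩
  · exact ⟨1, 0, tensorSemi_traceInv_chi.diffXperp firstOrder_traceInv_chi h1⟩
  · exact ⟨1, 0, tensorSemi_detInv_gam.diffXperp firstOrder_detInv_gam h2⟩

theorem tenInv_transformsWith (i : Fin 10) : ∃ m n, TransformsWith m n (tenInv i) metricJets := by
  fin_cases i
  on_goal 6 => exact tenInv_semiInvariant (by simp)
  on_goal 8 => exact tenInv_semiInvariant (by simp)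
  on_goal 8 => exact tenInv_semiInvariant (by simp)
  all_goals exact ⟨0, 0, tenInv_invariant (by simp)⟩

/-- Near a generic jet, the equation is retracted by the pseudogroup to a transversal slice. -/
theorem exists_slice {Λ : ℝ} {θ : Jet2} (hθ : θ ∈ einsteinJets Λ) (hC : traceInv rho θ ≠ 0)
    (hℓ : ellC θ ≠ 0) :
    ∃ (a b : ℝ) (f : (Fin 10 → ℝ) → Jet2), f (sliceCoord θ) = θ ∧
      DifferentiableAt ℝ f (sliceCoord θ) ∧
      (∀ᶠ s in 𝓝 (sliceCoord θ), f s ∈ einsteinJets Λ ∧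
        Rel a b (f s) (sliceJet Λ (Real.sign (detG θ)) (Real.sign (detH θ)) s)) ∧
      ∀ᶠ η in 𝓝[einsteinJets Λ] θ, f (sliceCoord η) ∈ einsteinJets Λ ∧
        Rel 1 1 (f (sliceCoord η)) η := by
  have hm := hθ.1
  have hε := sign_sq (detG_ne_zero hm)
  have hδ := sign_sq (detH_ne_zero hm)
  have hR := rel_sliceJet hθ hC hℓ
  set ε := Real.sign (detG θ)
  set δ := Real.sign (detH θ)
  set a := Real.sign (frameL θ).det
  set b := Real.sign (frameA θ).det
  have cC := (contDiffAt_traceInv hm (contDiffAt_rho hm)).continuousAt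
  have cℓ := (contDiffAt_ellC hm).continuousAt
  have cL : ContinuousAt (fun η => (frameL η).det) θ := by
    simp only [Matrix.det_fin_two]
    have := fun i j => (contDiffAt_frameL hm i j).continuousAt
    exact ((this 0 0).mul (this 1 1)).sub ((this 0 1).mul (this 1 0))
  have cA : ContinuousAt (fun η => (frameA η).det) θ := by
    simp only [Matrix.det_fin_two]
    have := fun i j => (contDiffAt_frameA hm i j).continuousAt
    exact ((this 0 0).mul (this 1 1)).sub ((this 0 1).mul (this 1 0))
  have nL : (frameL θ).det ≠ 0 := by
    rw [det_frameL hm]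
    exact neg_ne_zero.2 (div_ne_zero hC (sqrt_sq_eq (detG_ne_zero hm)).1)
  have nA : (frameA θ).det ≠ 0 := by
    rw [det_frameA hm]
    exact neg_ne_zero.2 (div_ne_zero hℓ (sqrt_sq_eq (detH_ne_zero hm)).1)
  have ha : a * a = 1 := by rw [← sq]; exact sign_sq nL
  have hb : b * b = 1 := by rw [← sq]; exact sign_sq nA
  have s0 : sliceCoord θ 0 ≠ 0 := hC
  have s1 : sliceCoord θ 1 ≠ 0 := hℓ
  -- The slice lies over the origin. One fixed transformation, carrying the slice point of `θ` back
  -- to `θ`, moves the whole slice through `θ`.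
  obtain ⟨T, hT, hTθ, hTR⟩ := hR.symm.exists_transport
  have hev : ∀ᶠ s in 𝓝 (sliceCoord θ), T (sliceJet Λ ε δ s) ∈ einsteinJets Λ ∧
      Rel a b (T (sliceJet Λ ε δ s)) (sliceJet Λ ε δ s) := by
    filter_upwards [(continuous_apply 0).continuousAt.eventually_ne s0,
      (continuous_apply 1).continuousAt.eventually_ne s1] with s h0 h1
    have h := hTR (sliceJet Λ ε δ s) rfl
    exact ⟨einsteinJets_of_rel h (sliceJet_mem_einsteinJets hε hδ h0 h1), h⟩
  have hS := differentiableAt_sliceCoord hm hC hℓ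
  refine ⟨a, b, fun s => T (sliceJet Λ ε δ s), hTθ, ?_, hev, ?_⟩
  · exact ((hT.differentiable (by simp)).differentiableAt).comp _
      (differentiableAt_sliceJet (ne_zero_of_sq hε) (ne_zero_of_sq hδ) s0 s1)
  · filter_upwards [self_mem_nhdsWithin, nhdsWithin_le_nhds (hS.continuousAt.eventually hev),
      nhdsWithin_le_nhds (cC.eventually_ne hC), nhdsWithin_le_nhds (cℓ.eventually_ne hℓ),
      nhdsWithin_le_nhds (eventually_sign_eq cL nL), nhdsWithin_le_nhds (eventually_sign_eq cA nA),
      nhdsWithin_le_nhds (eventually_sign_eq contDiff_detG.continuous.continuousAt hm.1),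
      nhdsWithin_le_nhds (eventually_sign_eq contDiff_detH.continuous.continuousAt hm.2)]
      with η hη h1 h2 h3 h4 h5 h6 h7
    -- Near `θ` the frame determinants and the two metric determinants keep their signs. The
    -- equivalences from the moved slice to the slice and from the slice to `η` both have signs `a`,
    -- `b`, so their composite has signs a² = b² = 1.
    have h := rel_sliceJet hη h2 h3
    rw [h4, h5, h6, h7] at h
    have := h1.2.trans h
    rw [ha, hb] at this
    exact ⟨h1.1, this⟩

/-- At generic jets of the equation, the differentials of the ten (semi-)invariants form a basis of
the space spanned by the differentials of all (semi-)invariants. -/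
theorem diffOn_basis {Λ : ℝ} {θ : Jet2} (hθ : θ ∈ einsteinJets Λ) (hg : θ ∈ genericJets) :
    LinearIndependent ℝ (fun i => diffOn (einsteinJets Λ) (tenInv i) θ) ∧
      ∀ (W : Set Jet2) (F : Jet2 → ℝ), IsOpen W → θ ∈ W → DifferentiableOn ℝ F W →
        IsSemiInvariantOn F (einsteinJets Λ ∩ W) →
        diffOn (einsteinJets Λ) F θ ∈
          Submodule.span ℝ (Set.range fun i => diffOn (einsteinJets Λ) (tenInv i) θ) := by
  have hm := hθ.1
  have hC : traceInv rho θ ≠ 0 := hg.2 0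
  have hℓ : ellC θ ≠ 0 := hg.2 1
  have hε := sign_sq (detG_ne_zero hm)
  have hδ := sign_sq (detH_ne_zero hm)
  obtain ⟨a, b, f, hfθ, hf, hev, hret⟩ := exists_slice hθ hC hℓ
  have hs := (sliceGeneric_iff (s := sliceCoord θ) hε hδ hC hℓ).1
    (genericJets_of_rel (rel_sliceJet hθ hC hℓ) hg)
  have hS := differentiableAt_sliceCoord hm hC hℓ
  have hI := fun i => differentiableAt_of_smooth (contDiffAt_tenInv hm i)
  have hIS : ∀ i, tenInv i =ᶠ[𝓝[einsteinJets Λ] θ] fun η => tenInv i (f (sliceCoord η)) := by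
    intro i
    obtain ⟨m, n, hi⟩ := tenInv_transformsWith i
    filter_upwards [self_mem_nhdsWithin, hret] with η hη h
    simpa using hi.rel h.2 h.1.1 hη.1
  have hsep : ∀ v, (∀ i, fderiv ℝ (tenInv i) θ (fderiv ℝ f (sliceCoord θ) v) = 0) → v = 0 := by
    intro v hv
    refine eq_zero_of_hasDerivAt_slice (Λ := Λ) hε hδ hs fun i => ?_
    obtain ⟨m, n, hi⟩ := tenInv_transformsWith i
    have hline : HasDerivAt (fun t : ℝ => sliceCoord θ + t • v) v 0 := by
      simpa using ((hasDerivAt_id (0 : ℝ)).smul_const v).const_add (sliceCoord θ)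
    have hz : sliceCoord θ + (0 : ℝ) • v = sliceCoord θ := by simp
    have hf' : HasFDerivAt f (fderiv ℝ f (sliceCoord θ)) (sliceCoord θ + (0 : ℝ) • v) := by
      rw [hz]; exact hf.hasFDerivAt
    have hI' : HasFDerivAt (tenInv i) (fderiv ℝ (tenInv i) θ) (f (sliceCoord θ + (0 : ℝ) • v)) := by
      rw [hz, hfθ]; exact (hI i).hasFDerivAt
    have h := hI'.comp_hasDerivAt (0 : ℝ) (hf'.comp_hasDerivAt (0 : ℝ) hline)
    rw [hv i] at h
    -- On the moved slice and on the slice itself a semi-invariant differs only by this constant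
    -- factor, which does not affect stationarity.
    have h' := h.const_mul (a ^ m * b ^ n)
    rw [mul_zero] at h'
    refine h'.congr_of_eventuallyEq ?_
    have hc : ContinuousAt (fun t : ℝ => sliceCoord θ + t • v) 0 := hline.continuousAt
    rw [← hz] at hev
    filter_upwards [hc.eventually hev] with t ht
    exact hi.rel ht.2 ht.1.1 (metricJets_of_rel ht.2.symm ht.1.1)
  obtain ⟨h1, h2⟩ := diffOn_basis_of_slice hθ hfθ hf hS (hev.mono fun _ h => h.1) hI hIS hsep
  refine ⟨h1, fun W F hW hθW hF ⟨m, n, hFi⟩ => h2 F (hF.differentiableAt (hW.mem_nhds hθW)) ?_⟩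
  -- `F` is (semi-)invariant only within `W`, so the retracted jet has to remain in `W` as well.
  have hcont : ContinuousAt (fun η => f (sliceCoord η)) θ := hf.continuousAt.comp hS.continuousAt
  have hW' : W ∈ 𝓝 (f (sliceCoord θ)) := by rw [hfθ]; exact hW.mem_nhds hθW
  filter_upwards [self_mem_nhdsWithin, hret, nhdsWithin_le_nhds (hW.mem_nhds hθW),
    nhdsWithin_le_nhds (hcont.eventually_mem hW')] with η hη h hηW hfW
  simpa using hFi.rel h.2 ⟨h.1, hfW⟩ ⟨hη, hηW⟩

/-! ### Density of the generic jets -/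

/-- Complete the square, then rescale both basis vectors to length ±1. A form with both diagonal
entries zero is first diagonalized by the sum and the difference of the basis vectors. -/
theorem exists_congrTriple_diagonal {p : Fin 3 → ℝ} (hp : p 0 * p 2 - p 1 ^ 2 ≠ 0) :
    ∃ (L : Matrix (Fin 2) (Fin 2) ℝ) (a b : ℝ), L.det ≠ 0 ∧ a ^ 2 = 1 ∧ b ^ 2 = 1 ∧
      congrTriple L p = ![a, 0, b] := by
  obtain ⟨L, hL, h1⟩ : ∃ L : Matrix (Fin 2) (Fin 2) ℝ, L.det ≠ 0 ∧ congrTriple L p 1 = 0 := by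
    by_cases h0 : p 0 = 0
    · by_cases h2 : p 2 = 0
      · exact ⟨!![1, 1; 1, -1], by simp [Matrix.det_fin_two]; norm_num, by simp [congrTriple, h0, h2]⟩
      · exact ⟨!![p 2, 0; -p 1, 1], by simpa, by simp [congrTriple]; ring⟩
    · exact ⟨!![1, -p 1; 0, p 0], by simpa, by simp [congrTriple]; ring⟩
  set q := congrTriple L p with hq
  have hdet : q 0 * q 2 = L.det ^ 2 * (p 0 * p 2 - p 1 ^ 2) := by
    have : q 0 * q 2 = q 0 * q 2 - q 1 ^ 2 := by rw [h1]; ring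
    rw [this, hq, Matrix.det_fin_two]
    simp [congrTriple]
    ring
  have hq02 : q 0 * q 2 ≠ 0 := by rw [hdet]; positivity
  have h0 := left_ne_zero_of_mul hq02
  have h2 := right_ne_zero_of_mul hq02
  obtain ⟨r0, e0, s0⟩ := sqrt_sq_eq h0
  obtain ⟨r2, e2, s2⟩ := sqrt_sq_eq h2
  refine ⟨L * Matrix.diagonal ![1 / √|q 0|, 1 / √|q 2|], Real.sign (q 0), Real.sign (q 2),
    ?_, s0, s2, ?_⟩
  · rw [Matrix.det_mul, Matrix.det_diagonal]
    simp [hL, r0, r2, Fin.prod_univ_two]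
  · have : ∀ r t : ℝ, congrTriple (L * Matrix.diagonal ![r, t]) p =
        ![r ^ 2 * q 0, r * t * q 1, t ^ 2 * q 2] := by
      intro r t
      rw [hq]
      ext m
      fin_cases m <;> simp [congrTriple, Matrix.mul_diagonal] <;> ring
    rw [this, div_pow, div_pow, one_pow, e0, e2, h1, div_mul_cancel₀ _ h0, div_mul_cancel₀ _ h2,
      mul_zero]

/-- Every jet satisfying the Einstein equations is equivalent to a normal form over an orthonormal
basis. -/
theorem exists_rel_einJet {Λ : ℝ} {θ : Jet2} (hθ : θ ∈ einsteinJets Λ) :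
    ∃ (a b c₁ c₂ h₁ h₂ : ℝ) (H : Fin 2 → Fin 3 → ℝ) (c : Fin 2 → ℝ) (x : Fin 4 → ℝ),
      c₁ ^ 2 = 1 ∧ c₂ ^ 2 = 1 ∧ h₁ ^ 2 = 1 ∧ h₂ ^ 2 = 1 ∧
      Rel a b (einJet Λ c₁ c₂ h₁ h₂ H c x) θ := by
  have hG := detG_ne_zero hθ.1
  have hH := detH_ne_zero hθ.1
  rw [detG_eq] at hG
  rw [detH_eq] at hH
  obtain ⟨L, c₁, c₂, hL, hc₁, hc₂, hLg⟩ := exists_congrTriple_diagonal hG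
  obtain ⟨α, h₁, h₂, hα, hh₁, hh₂, hαh⟩ := exists_congrTriple_diagonal hH
  set c : Fin 2 → ℝ := α⁻¹ *ᵥ fun k => L.det * curvF k θ with hc
  have hαc : α *ᵥ c = fun k => L.det * curvF k θ := by
    rw [hc, Matrix.mulVec_mulVec, Matrix.mul_nonsing_inv _ hα.isUnit, Matrix.one_mulVec]
  obtain ⟨κ, d, e, hR⟩ := exists_rel_normalJet hL hα (ne_zero_of_sq hc₁) (ne_zero_of_sq hc₂) hLg c
    fun k => by
      rw [← congrFun hαc k, Matrix.mulVec, dotProduct, Fin.sum_univ_two]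
  rw [hαh] at hR
  rw [normalJet_eq_einJet (ne_zero_of_sq hc₁) (ne_zero_of_sq hc₂) (ne_zero_of_sq hh₁)
    (ne_zero_of_sq hh₂) (einsteinJets_of_rel hR hθ)] at hR
  exact ⟨_, _, c₁, c₂, h₁, h₂, _, c, _, hc₁, hc₂, hh₁, hh₂, hR⟩

/-- The invariants are analytic along curves of jets over a fixed fibre point. -/
theorem analyticAt_genInv {g : ℝ → Jet2} {G h : Fin 3 → ℝ} (hG : ∀ t, (g t).2.1.1 = G)
    (hh : ∀ t, (g t).2.1.2.2 = h) {t : ℝ}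
    (hd : ∀ i m, AnalyticAt ℝ (fun t => ((g t).2.2.1 i).2.2 m) t)
    (hc : ∀ k, AnalyticAt ℝ (fun t => curvF k (g t)) t) (i : Fin 6) :
    AnalyticAt ℝ (fun t => genInv i (g t)) t := by
  have aS : ∀ i, AnalyticAt ℝ (fun t => sig i (g t)) t := fun i => by
    simp only [sig_eq, detHDeriv, detH_eq, hh, div_eq_mul_inv]
    fun_prop
  have aK : ∀ k, AnalyticAt ℝ (fun t => curv k (g t)) t := fun k => by
    simp only [curv_eq, detG_eq, hG, div_eq_mul_inv]
    fun_prop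
  have aX : ∀ i j, AnalyticAt ℝ (fun t => chi (g t) i j) t := fun i j => by
    simp only [chi_eq, detH_eq, polarDet, hh, div_eq_mul_inv]
    fun_prop
  have aR : ∀ i j, AnalyticAt ℝ (fun t => rho (g t) i j) t := fun i j => (aS i).mul (aS j)
  have aG : ∀ i j, AnalyticAt ℝ (fun t => gam (g t) i j) t := fun i j =>
    (aX i j).sub (analyticAt_const.mul (aR i j))
  have tr : ∀ μ : Jet2 → Matrix (Fin 2) (Fin 2) ℝ, (∀ i j, AnalyticAt ℝ (fun t => μ (g t) i j) t) →
      AnalyticAt ℝ (fun t => traceInv μ (g t)) t := fun μ hμ => by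
    simp only [traceInv_eq, detG_eq, hG, div_eq_mul_inv]
    exact ((((hμ 0 0).mul analyticAt_const).sub (((hμ 0 1).add (hμ 1 0)).mul analyticAt_const)).add
      ((hμ 1 1).mul analyticAt_const)).mul analyticAt_const
  have dt : ∀ μ : Jet2 → Matrix (Fin 2) (Fin 2) ℝ, (∀ i j, AnalyticAt ℝ (fun t => μ (g t) i j) t) →
      AnalyticAt ℝ (fun t => detInv μ (g t)) t := fun μ hμ => by
    simp only [detInv, Matrix.det_fin_two, detG_eq, hG, div_eq_mul_inv]
    exact (((hμ 0 0).mul (hμ 1 1)).sub ((hμ 0 1).mul (hμ 1 0))).mul analyticAt_const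
  have t1 := tr rho aR
  have t2 := tr chi aX
  have d1 := dt chi aX
  have d2 := dt gam aG
  fin_cases i
  · exact t1
  · change AnalyticAt ℝ (fun t => ellC (g t)) t
    simp only [ellC_eq, hh]
    fun_prop
  · exact d2
  · change AnalyticAt ℝ (fun t => transCurv (g t)) t
    simp only [transCurv, detG_eq, hG, div_eq_mul_inv]
    fun_prop
  · change AnalyticAt ℝ (fun t => mixedInv (g t)) t
    simp only [mixedInv, div_eq_mul_inv]
    fun_prop
  · change AnalyticAt ℝ (fun t => discInv (g t)) t
    simp only [discInv, div_eq_mul_inv]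
    fun_prop

/-- An analytic function on the line which is nonzero somewhere is nonzero near, but off, any given
point. -/
theorem eventually_ne_zero_of_analytic {f : ℝ → ℝ} (hf : ∀ t, AnalyticAt ℝ f t) {t₁ : ℝ}
    (h : f t₁ ≠ 0) (t₀ : ℝ) : ∀ᶠ t in 𝓝[≠] t₀, f t ≠ 0 := by
  rcases (hf t₀).eventually_eq_zero_or_eventually_ne_zero with h0 | h0
  · have := AnalyticOnNhd.eqOn_zero_of_preconnected_of_eventuallyEq_zero (U := Set.univ)
      (fun t _ => hf t) isPreconnected_univ (Set.mem_univ t₀) h0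
    exact absurd (this (Set.mem_univ t₁)) h
  · exact h0

theorem sq_eq_one_cases {a : ℝ} (h : a ^ 2 = 1) : a = 1 ∨ a = -1 :=
  eq_or_eq_neg_of_sq_eq_sq a 1 (by rw [h, one_pow])

/-- Over every orthonormal basis there is a generic normal form. -/
theorem exists_einJet_mem_genericJets {c₁ c₂ h₁ h₂ : ℝ} (hc₁ : c₁ ^ 2 = 1) (hc₂ : c₂ ^ 2 = 1)
    (hh₁ : h₁ ^ 2 = 1) (hh₂ : h₂ ^ 2 = 1) (Λ : ℝ) (x : Fin 4 → ℝ) :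
    ∃ (H : Fin 2 → Fin 3 → ℝ) (c : Fin 2 → ℝ),
      einJet Λ c₁ c₂ h₁ h₂ H c x ∈ genericJets := by
  set ε := c₁ * c₂ with hε
  set δ := h₁ * h₂ with hδ
  have hε2 : ε ^ 2 = 1 := by rw [hε, mul_pow, hc₁, hc₂, one_mul]
  have hδ2 : δ ^ 2 = 1 := by rw [hδ, mul_pow, hh₁, hh₂, one_mul]
  -- These values give `sliceForm` the components 1, 1, 1 + δ and `sliceDet` the value 1. The
  -- quantity in `disc_ne` then takes the values 5, −5, 5, 3 for (ε, δ) = (1, 1), (−1, 1), (1, −1),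
  -- (−1, −1).
  set s : Fin 10 → ℝ := ![c₁, h₁, 1, 1, 0, 1, x 0, x 1, x 2, x 3] with hs
  have e1 : sliceForm δ s 1 = 1 := by simp [sliceForm, hs]
  have h := (sliceGeneric_iff (Λ := Λ) (s := s) hε2 hδ2 (ne_zero_of_sq hc₁) (ne_zero_of_sq hh₁)).2
    { trace_ne := ne_zero_of_sq hc₁
      length_ne := ne_zero_of_sq hh₁
      trans_ne := one_ne_zero
      det_ne := by simp [sliceDet, hs]
      mixed_ne := by simp [e1]
      disc_ne := by
        have e : sliceForm δ s 0 = 1 := by simp [sliceForm, hs]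
        have e' : sliceForm δ s 2 = 1 + δ := by simp [sliceForm, hs]
        rw [e, e1, e']
        rcases sq_eq_one_cases hε2 with h | h <;>
          rcases sq_eq_one_cases hδ2 with h' | h' <;>
          rw [h, h'] <;> norm_num }
  refine ⟨sliceDeriv δ s, ![-c₁, 0], ?_⟩
  have e : sliceJet Λ ε δ s = einJet Λ c₁ c₂ h₁ h₂ (sliceDeriv δ s) ![-c₁, 0] x := by
    have a1 : ε * s 0 = c₂ := by
      change c₁ * c₂ * c₁ = c₂
      linear_combination c₂ * hc₁
    have a2 : δ * s 1 = h₂ := by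
      change h₁ * h₂ * h₁ = h₂
      linear_combination h₂ * hh₁
    have a3 : ![s 6, s 7, s 8, s 9] = x := by
      ext i
      fin_cases i <;> rfl
    rw [sliceJet, a1, a2, a3]
    rfl
  rwa [← e]

/-- In an orthonormal normal form `H` and `c` are arbitrary, the solved second-order data adjusting
themselves to them. A segment to a generic choice thus stays in the equation, and along it the
genericity conditions are analytic and not identically zero, so they hold at points arbitrarily
close to the start. -/
theorem mem_closure_generic {Λ : ℝ} {θ : Jet2} (hθ : θ ∈ einsteinJets Λ) :
    θ ∈ closure (einsteinJets Λ ∩ genericJets) := by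
  obtain ⟨a, b, c₁, c₂, h₁, h₂, H, c, x, hc₁, hc₂, hh₁, hh₂, hR⟩ := exists_rel_einJet hθ
  obtain ⟨H', c', hg⟩ := exists_einJet_mem_genericJets hc₁ hc₂ hh₁ hh₂ Λ x
  obtain ⟨T, hT, hTθ, hTR⟩ := hR.symm.exists_transport
  have n1 := ne_zero_of_sq hc₁
  have n2 := ne_zero_of_sq hc₂
  have n3 := ne_zero_of_sq hh₁
  have n4 := ne_zero_of_sq hh₂
  -- Keeping the metric coefficients fixed along the curve makes the square roots and denominators
  -- in the invariants constant, which is what analyticity in `t` rests on.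
  set g : ℝ → Jet2 := fun t =>
    einJet Λ c₁ c₂ h₁ h₂ (H + t • (H' - H)) (c + t • (c' - c)) x with hgdef
  have g0 : g 0 = einJet Λ c₁ c₂ h₁ h₂ H c x := by simp [hgdef]
  have g1 : g 1 = einJet Λ c₁ c₂ h₁ h₂ H' c' x := by simp [hgdef]
  have hgE : ∀ t, g t ∈ einsteinJets Λ := fun t => einJet_mem_einsteinJets n1 n2 n3 n4
  have hgR : ∀ t, Rel a b (T (g t)) (g t) := fun t => hTR (g t) rfl
  have hgc : ContinuousAt g 0 :=
    (differentiableAt_einJet (differentiableAt_const c₁) (differentiableAt_const c₂)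
      (differentiableAt_const h₁) (differentiableAt_const h₂)
      (((differentiableAt_id).smul_const (H' - H)).const_add H)
      (((differentiableAt_id).smul_const (c' - c)).const_add c)
      (differentiableAt_const x) n1 n2 n3 n4).continuousAt
  have han : ∀ i t, AnalyticAt ℝ (fun t => genInv i (g t)) t := fun i t => by
    refine analyticAt_genInv (G := ![c₁, 0, c₂]) (h := ![h₁, 0, h₂]) (fun _ => rfl) (fun _ => rfl)
      (fun i m => ?_) (fun k => ?_) i
    · have : (fun t => ((g t).2.2.1 i).2.2 m) = fun t => H i m + t * (H' i m - H i m) := by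
        funext t
        rcases eq_zero_or_one i with rfl | rfl <;> rfl
      rw [this]
      fun_prop
    · have : (fun t => curvF k (g t)) = fun t => c k + t * (c' k - c k) := by
        funext t
        simp [curvF, hgdef, einJet, normalJet]
      rw [this]
      fun_prop
  have hev : ∀ᶠ t in 𝓝[≠] (0 : ℝ), ∀ i, genInv i (g t) ≠ 0 :=
    Filter.eventually_all.2 fun i => eventually_ne_zero_of_analytic (han i)
      (t₁ := 1) (by rw [g1]; exact hg.2 i) 0
  have hlim : Filter.Tendsto (fun t => T (g t)) (𝓝[≠] 0) (𝓝 θ) := by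
    have : ContinuousAt (fun t => T (g t)) 0 := hT.continuous.continuousAt.comp hgc
    have h := this.tendsto
    rw [g0, hTθ] at h
    exact h.mono_left nhdsWithin_le_nhds
  refine mem_closure_of_tendsto hlim (hev.mono fun t ht => ⟨?_, ?_⟩)
  · exact einsteinJets_of_rel (hgR t) (hgE t)
  · exact genericJets_of_rel (hgR t) ⟨(hgE t).1, ht⟩

end

end KillingJet

theorem mainTheorem11 (Λ : ℝ) :
    (∀ i ∈ ({0, 1, 2, 3, 4, 6, 7} : Set (Fin 10)),
      KillingJet.IsInvariantOn (KillingJet.tenInv i) KillingJet.metricJets) ∧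
    (∀ i ∈ ({5, 8, 9} : Set (Fin 10)),
      KillingJet.IsSemiInvariantOn (KillingJet.tenInv i) KillingJet.metricJets) ∧
    ∃ O : Set KillingJet.Jet2, IsOpen O ∧
      KillingJet.einsteinJets Λ ⊆ closure (KillingJet.einsteinJets Λ ∩ O) ∧
      ∀ θ ∈ KillingJet.einsteinJets Λ ∩ O,
        LinearIndependent ℝ
          (fun i => KillingJet.diffOn (KillingJet.einsteinJets Λ) (KillingJet.tenInv i) θ) ∧
        ∀ (W : Set KillingJet.Jet2) (F : KillingJet.Jet2 → ℝ), IsOpen W → θ ∈ W →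
          DifferentiableOn ℝ F W →
          KillingJet.IsSemiInvariantOn F (KillingJet.einsteinJets Λ ∩ W) →
          KillingJet.diffOn (KillingJet.einsteinJets Λ) F θ ∈
            Submodule.span ℝ (Set.range fun i =>
              KillingJet.diffOn (KillingJet.einsteinJets Λ) (KillingJet.tenInv i) θ) :=
  ⟨fun _ hi => KillingJet.tenInv_invariant hi, fun _ hi => KillingJet.tenInv_semiInvariant hi,
    KillingJet.genericJets, KillingJet.isOpen_genericJets,
    fun _ hθ => KillingJet.mem_closure_generic hθ,
    fun _ hθ => KillingJet.diffOn_basis hθ.1 hθ.2⟩
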